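/- **Setting.** Let $\mathbb F_q\subseteq\mathbb F_{q^m}\subseteq\mathbb F_{q^{m\eta}}$ be finite fields, $(b_1,\dots,b_m)$ an $\mathbb F_q$-basis of $\mathbb F_{q^m}$, and $N=2^D$. An instance is $M_0,\dots,M_k\in\mathbb F_q^{m\times n}$; a witness is $x\in\mathbb F_q^k$ such that $E=M_0+\sum_i x_iM_i$ has rank at most $r$. Write $e_j=\sum_i b_iE_{ij}\in\mathbb F_{q^m}$ for the element associated to the $j$-th column of $E$. Let $\mathsf{PRG}$, $\mathsf{Com}$ and $\mathsf H$ be a pseudorandom generator (used for the binary seed tree, for deriving seeds and commitment tapes from the tree leaves, and for expanding seeds into shares), a commitment and a hash function. The $N$ parties (leaves) are indexed by $i=(i_1,\dots,i_D)\in\{1,2\}^D$. **Protocol** (5 rounds, additive sharing, hypercube technique). 1. Let $U=\langle e_1,\dots,e_n\rangle_{\mathbb F_q}$. The prover computes $L=\bigl(\prod_{u\in U}(X-u)\bigr)^{q^{r-\dim U}}=X^{q^r}+\sum_{l<r}\beta_lX^{q^l}$. It samples a root seed in $\{0,1\}^\lambda$ and expands it by the seed tree into pairs $(\mathsf{seed}_i,\rho_i)_{i\le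 N}$. For $i<N$ it expands $\mathsf{seed}_i$ into shares $([x]_i,[\beta]_i,[a]_i,[c]_i)$ and sets $\mathsf{state}_i=\mathsf{seed}_i$. For $i=N$ it expands $\mathsf{seed}_N$ into $[a]_N$, chooses $[x]_N,[\beta]_N,[c]_N$ such that all the shares sum to $x$, $\beta$ and $c=-\langle a,\beta\rangle$ with $a=\sum_i[a]_i$, and sets $\mathsf{state}_N=(\mathsf{seed}_N,[x]_N,[\beta]_N,[c]_N)$. It sends $h_0=\mathsf H(\mathsf{cmt}_1,\dots,\mathsf{cmt}_N)$, where $\mathsf{cmt}_i=\mathsf{Com}(\mathsf{state}_i,\rho_i)$. 2. The verifier sends uniform $(\gamma,\varepsilon_0)\in\mathbb F_{q^{m\eta}}^n\times\mathbb F_{q^{m\eta}}$. 3. For each dimension $d\le D$ there are two main parties $(d,1),(d,2)$; the share of $(d,b)$ is the sum of the shares of the leaves with $i_d=b$. They compute shares of $\alpha=\varepsilon_0w+a$, reveal $\alpha$, and compute shares of $v=\varepsilon_0z-\langle\alpha,\beta\rangle-c$, where $w_l=\sum_j\gamma_je_j^{q^l}$ ($0\le l<r$) and $z=-\sum_j\gamma_je_j^{q^r}$;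 the public constant $M_0$ is added by one leaf only. Let $H_d$ be the hash of the four shares of $\alpha$ and $v$ in dimension $d$. The prover sends $h_1=\mathsf H(H_1,\dots,H_D)$. 4. The verifier sends a uniform leaf $i^*$. 5. The prover sends $\mathsf{cmt}_{i^*}$, the share $[\alpha]_{i^*}$, the sibling path of $i^*$ in the seed tree and, if $i^*\ne N$, $[x]_N,[\beta]_N,[c]_N$. The verifier recomputes all leaves other than $i^*$ and hence all commitments. In each dimension it recomputes the shares of $\alpha$ and $v$, adding $[\alpha]_{i^*}$ to the share of $\alpha$ of the main party containing $i^*$, and choosing the share $[v]_{i^*}$ so that $v=0$. It accepts iff $h_0$ and $h_1$ are the resulting hashes, $v=0$ in all dimensions, and $\alpha$ is the same in all dimensions. **Conventions.** Time is the size of straight-line programs whose unit-cost operations are bit, counter and field operations and evaluations of $\mathsf{PRG}$, $\mathsf{Com}$, $\mathsf H$. The size of a parameter set is the sum of $\lambda,N,m,n,k,r,\eta,\lceil\log_2q\rceil$ and the bit lengths of commitment tapes, commitments and digests. Two families of distributions indexed by $\lambda$ are computationally indistinguishable if every (non-uniform) polynomial-size family of distinguishers, given polynomially many independent samples, has advantage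 negligible in $\lambda$. **Theorem.** * **Perfect completeness.** For every instance and every witness $x$, the honest verifier accepts the honest prover with probability $1$. * **Soundness.** Let $$\varepsilon=\frac1N+p\Bigl(1-\frac1N\Bigr),\qquad p=\frac2{q^{m\eta}}-\frac1{q^{2m\eta}}.$$ For all parameters and every $\tilde\varepsilon>\varepsilon$ there is a probabilistic extractor, depending only on the parameters and on $\tilde\varepsilon$, such that for all $\mathsf{PRG},\mathsf{Com},\mathsf H$, all instances and every prover $\tilde{\mathcal P}$ that makes the verifier accept with probability $\tilde\varepsilon$ the following holds. Given rewindable black-box access to $\tilde{\mathcal P}$ (each call runs $\tilde{\mathcal P}$ on challenges chosen by the extractor, either on a fresh random tape or again on the current one), whatever the extractor outputs is a MinRank witness, or a commitment collision, i.e. two different messages with openings to the same $\mathsf{Com}$-value, or two different inputs with the same hash under the function $\mathsf H$ used to commit. The expected number of its calls to $\tilde{\mathcal P}$ is at most $$\frac4{\tilde\varepsilon-\varepsilon}\Bigl(1+\tilde\varepsilon\cdot\frac{2\ln2}{\tilde\varepsilon-\varepsilon}\Bigr),$$ so it halts with probability $1$. Its computing time per call is bounded by a fixed polynomial in the size of the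 parameters. * **Honest-verifier zero-knowledge.** There is a simulator, running in time polynomial in the size of the parameters, which is given an instance and both challenges but no witness, such that the following holds. For all families, indexed by $\lambda$, of parameters of size polynomial in $\lambda$ and of $\mathsf{PRG},\mathsf{Com},\mathsf H$: if the outputs of $\mathsf{PRG}$ on a uniform seed are computationally indistinguishable from uniform, and if for every family of messages $(\mu_\lambda)_\lambda$ the value $\mathsf{Com}(\mu_\lambda,\rho)$ with uniform $\rho$ is computationally indistinguishable from uniform, then for every family of instances with witnesses, the transcript of the honest interaction and the simulated transcript for uniform challenges are computationally indistinguishable. -/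

import Mathlib

open scoped ENNReal

noncomputable section

namespace MinRankPoK

/-! ### Parameters and data types -/

/-- A parameter set: `N = 2 ^ D` parties, MinRank parameters `(q, m, n, k, r)`, the tower of finite
fields `𝔽_q ⊆ 𝔽_{q^m} ⊆ 𝔽_{q^{mη}}` (with bases, and with a binary encoding of `𝔽_q`), and the bit
lengths of commitment randomness, commitments and digests; seeds have `lam` bits. -/
structure Params (lam : ℕ) where
  (D m n k r η : ℕ)
  (lenRho lenCmt lenHash : ℕ)
  (Fq Fqm Fqme : Type)
  [fieldFq : Field Fq]
  [fieldFqm : Field Fqm]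
  [fieldFqme : Field Fqme]
  [fintypeFq : Fintype Fq]
  [fintypeFqm : Fintype Fqm]
  [fintypeFqme : Fintype Fqme]
  [algebraFqm : Algebra Fq Fqm]
  [algebraFqme : Algebra Fqm Fqme]
  basis : Module.Basis (Fin m) Fq Fqm
  basisExt : Module.Basis (Fin η) Fqm Fqme
  bits : Fq → (Fin (Nat.clog 2 (Fintype.card Fq)) → Bool)
  bits_injective : Function.Injective bits

attribute [instance] Params.fieldFq Params.fieldFqm Params.fieldFqme Params.fintypeFq
  Params.fintypeFqm Params.fintypeFqme Params.algebraFqm Params.algebraFqme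

/-- The field size `q`. -/
def Params.q {lam : ℕ} (S : Params lam) : ℕ := Fintype.card S.Fq

/-- The number of parties `N = 2 ^ D`. -/
def Params.N {lam : ℕ} (S : Params lam) : ℕ := 2 ^ S.D

/-- The quantity in which running times are required to be polynomial. -/
def Params.size {lam : ℕ} (S : Params lam) : ℕ :=
  lam + S.N + S.m + S.n + S.k + S.r + S.η + S.lenRho + S.lenCmt + S.lenHash + Nat.clog 2 S.q

abbrev Seed (lam : ℕ) : Type := Fin lam → Bool

section Types

variable {lam : ℕ} (S : Params lam)

abbrev Rho : Type := Fin S.lenRho → Bool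
abbrev Cmt : Type := Fin S.lenCmt → Bool
abbrev Digest : Type := Fin S.lenHash → Bool

/-- The leaves of the hypercube; the coordinate values `1, 2` are `false, true`. -/
abbrev Leaf : Type := Fin S.D → Bool

/-- Matrices `M_0, …, M_k`. -/
abbrev Inst : Type := Fin (S.k + 1) → Fin S.m → Fin S.n → S.Fq

/-- A share of `(x, β, a, c)`. -/
abbrev Share : Type :=
  (Fin S.k → S.Fq) × (Fin S.r → S.Fqm) × (Fin S.r → S.Fqme) × S.Fqme

/-- The shares of `(x, β, c)` of the last leaf, which are not derived from its seed. -/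
abbrev Aux : Type := (Fin S.k → S.Fq) × (Fin S.r → S.Fqm) × S.Fqme

/-- The committed state of a leaf: a seed, or for the last leaf a seed and the auxiliary shares. -/
abbrev Msg : Type := Seed lam ⊕ (Seed lam × Aux S)

/-- The shares of `(α, v)` broadcast by the two main parties of one dimension. -/
abbrev Broadcast : Type := Bool → (Fin S.r → S.Fqme) × S.Fqme

/-- The three kinds of strings that are hashed: all commitments, the broadcast of one dimension,
the digests of all dimensions. -/
abbrev HashIn : Type := (Leaf S → Cmt S) ⊕ (Broadcast S ⊕ (Fin S.D → Digest S))

/-- First challenge `((γ_j)_j, ε)`. -/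
abbrev Ch1 : Type := (Fin S.n → S.Fqme) × S.Fqme

/-- Second response: the commitment and the share of `α` of the hidden leaf, the sibling path, and
the auxiliary shares of the last leaf. If the hidden leaf is the last one then the last component
is not sent: the honest prover fills it with zeros and the verifier ignores it. -/
abbrev Rsp : Type := Cmt S × (Fin S.r → S.Fqme) × (Fin S.D → Seed lam) × Aux S

/-- `(h_0, ch_1, h_1, ch_2, rsp)`. -/
abbrev Transcript : Type := Digest S × Ch1 S × Digest S × Leaf S × Rsp S

/-- The algorithms used by the protocol: the pseudorandom generators (tree node to its two children;
tree leaf to seed and commitment tape; seed to shares of `(x, β, a, c)`; seed of the last leaf to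
its share of `a`), the commitment and the hash function. -/
structure Prims where
  prgNode : Seed lam → Seed lam × Seed lam
  prgLeaf : Seed lam → Seed lam × Rho S
  prgShare : Seed lam → Share S
  prgLast : Seed lam → (Fin S.r → S.Fqme)
  com : Msg S × Rho S → Cmt S
  hash : HashIn S → Digest S

end Types

/-! ### MinRank -/

section MinRank

variable {lam : ℕ} {S : Params lam}

/-- `E = M_0 + ∑ x_i M_i`. -/
def matE (M : Inst S) (x : Fin S.k → S.Fq) : Matrix (Fin S.m) (Fin S.n) S.Fq :=
  Matrix.of fun a b => M 0 a b + ∑ i, x i * M i.succ a b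

def IsSolution (M : Inst S) (x : Fin S.k → S.Fq) : Prop := (matE M x).rank ≤ S.r

/-- The element of `𝔽_{q^m}` associated to the `j`-th column of `E`. -/
def column (E : Fin S.m → Fin S.n → S.Fq) (j : Fin S.n) : S.Fqm := ∑ a, E a j • S.basis a

/-- `U = ⟨e_1, …, e_n⟩`. -/
def suppU (M : Inst S) (x : Fin S.k → S.Fq) : Submodule S.Fq S.Fqm :=
  Submodule.span S.Fq (Set.range (column (matE M x)))

open Classical in
/-- `L = ∏_{u ∈ U} (X - u)`, which has degree `q ^ r` if `dim U = r`; if `dim U < r` it is raised to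
the power `q ^ (r - dim U)`, so as to be a monic `q`-polynomial of `q`-degree `r` in all cases. -/
def annihilator (M : Inst S) (x : Fin S.k → S.Fq) : Polynomial S.Fqm :=
  (∏ u ∈ Finset.univ.filter (fun u => u ∈ suppU M x), (Polynomial.X - Polynomial.C u)) ^
    (S.q ^ (S.r - Module.finrank S.Fq (suppU M x)))

/-- The coefficients `β_0, …, β_{r-1}` of `L`. -/
def beta (M : Inst S) (x : Fin S.k → S.Fq) : Fin S.r → S.Fqm :=
  fun i => (annihilator M x).coeff (S.q ^ (i : ℕ))

end MinRank

/-! ### TreePRG -/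

section Tree

variable {lam : ℕ}

/-- The left (`false`) or right (`true`) child of a node. -/
def child (G : Seed lam → Seed lam × Seed lam) (s : Seed lam) (b : Bool) : Seed lam :=
  if b then (G s).2 else (G s).1

/-- The leaf reached from the node `s` by following the directions `i`. -/
def walk (G : Seed lam → Seed lam × Seed lam) : (d : ℕ) → (Fin d → Bool) → Seed lam → Seed lam
  | 0, _, s => s
  | d + 1, i, s => walk G d (Fin.tail i) (child G s (i 0))

/-- The sibling path of the leaf `i` in the tree with root `s`. -/
def siblings (G : Seed lam → Seed lam × Seed lam) :
    (d : ℕ) → (Fin d → Bool) → Seed lam → (Fin d → Seed lam)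
  | 0, _, _ => Fin.elim0
  | d + 1, i, s =>
      Fin.cons (child G s (!(i 0))) (siblings G d (Fin.tail i) (child G s (i 0)))

/-- The leaf `j ≠ i` computed from the sibling path of `i` (a dummy value if `j = i`). -/
def recover (G : Seed lam → Seed lam × Seed lam) :
    (d : ℕ) → (Fin d → Bool) → (Fin d → Seed lam) → (Fin d → Bool) → Seed lam
  | 0, _, _, _ => fun _ => false
  | d + 1, i, path, j =>
      if j 0 = i 0 then recover G d (Fin.tail i) (Fin.tail path) (Fin.tail j)
      else walk G d (Fin.tail j) (path 0)

end Tree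

/-! ### The multiparty computation on (aggregated) shares -/

section MPC

variable {lam : ℕ} {S : Params lam}

def firstLeaf (S : Params lam) : Leaf S := fun _ => false

/-- The leaf number `N`. -/
def lastLeaf (S : Params lam) : Leaf S := fun _ => true

/-- The leaves that are aggregated into the main party `(d, b)`. -/
def mainParty (S : Params lam) (d : Fin S.D) (b : Bool) : Finset (Leaf S) :=
  Finset.univ.filter fun i => i d = b

/-- The share of `e_j` of an aggregate of the leaves `A`, given its share of `x`. As always with
additive sharings, one party only, here the first leaf, adds the public constant `M_0`. -/
def shareCol (M : Inst S) (A : Finset (Leaf S)) (x : Fin S.k → S.Fq) (j : Fin S.n) : S.Fqm :=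
  column (fun a b => (if firstLeaf S ∈ A then M 0 a b else 0) + ∑ i, x i * M i.succ a b) j

/-- The share of `∑_j γ_j e_j^{q^l}`. -/
def shareW (M : Inst S) (ch : Ch1 S) (A : Finset (Leaf S)) (x : Fin S.k → S.Fq) (l : ℕ) : S.Fqme :=
  ∑ j, ch.1 j * algebraMap S.Fqm S.Fqme (shareCol M A x j ^ S.q ^ l)

/-- The share of `α = ε w + a`. -/
def shareAlpha (M : Inst S) (ch : Ch1 S) (A : Finset (Leaf S)) (s : Share S) : Fin S.r → S.Fqme :=
  fun l => ch.2 * shareW M ch A s.1 l + s.2.2.1 l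

/-- The share of `v = ε z - ⟨α, β⟩ - c`, where `z = -∑_j γ_j e_j^{q^r}`. -/
def shareV (M : Inst S) (ch : Ch1 S) (A : Finset (Leaf S)) (s : Share S)
    (alpha : Fin S.r → S.Fqme) : S.Fqme :=
  ch.2 * (-shareW M ch A s.1 S.r) - (∑ l, alpha l * algebraMap S.Fqm S.Fqme (s.2.1 l)) - s.2.2.2

/-- The input share of an aggregate of leaves. -/
def aggregate (sh : Leaf S → Share S) (A : Finset (Leaf S)) : Share S := ∑ i ∈ A, sh i

/-- The broadcast shares of the two main parties of dimension `d` (honest execution). -/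
def execDim (M : Inst S) (ch : Ch1 S) (sh : Leaf S → Share S) (d : Fin S.D) : Broadcast S :=
  let al : Bool → (Fin S.r → S.Fqme) := fun b =>
    shareAlpha M ch (mainParty S d b) (aggregate sh (mainParty S d b))
  let alpha := al false + al true
  fun b => (al b, shareV M ch (mainParty S d b) (aggregate sh (mainParty S d b)) alpha)

/-- The broadcast shares of dimension `d`, recomputed by the verifier from the shares of all leaves
but `i` and from a claimed share `alphaStar` of `α` of the leaf `i`. The share of `v` of the leaf `i`
is set such that the shares of `v` sum up to zero. -/
def checkDim (M : Inst S) (ch : Ch1 S) (i : Leaf S) (alphaStar : Fin S.r → S.Fqme)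
    (sh : Leaf S → Share S) (d : Fin S.D) : Broadcast S :=
  let part := (mainParty S d (i d)).erase i
  let other := mainParty S d (!(i d))
  let alPart := shareAlpha M ch part (aggregate sh part) + alphaStar
  let alOther := shareAlpha M ch other (aggregate sh other)
  let alpha := alPart + alOther
  let vPart := shareV M ch part (aggregate sh part) alpha
  let vOther := shareV M ch other (aggregate sh other) alpha
  let vStar := -(vPart + vOther)
  fun b => if b = i d then (alPart, vPart + vStar) else (alOther, vOther)

end MPC

/-! ### The protocol -/

section Protocol

variable {lam : ℕ} {S : Params lam} (P : Prims S)

/-- The committed state of the leaf `j`. -/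
def leafState (seed : Seed lam) (aux : Aux S) (j : Leaf S) : Msg S :=
  if j = lastLeaf S then Sum.inr (seed, aux) else Sum.inl seed

/-- The input share of the leaf `j`, as determined by its state. -/
def leafShare (seed : Seed lam) (aux : Aux S) (j : Leaf S) : Share S :=
  if j = lastLeaf S then (aux.1, aux.2.1, P.prgLast seed, aux.2.2) else P.prgShare seed

/-- The pair `(seed_i, ρ_i)` derived from the root seed. -/
def leafSeed (root : Seed lam) (i : Leaf S) : Seed lam × Rho S :=
  P.prgLeaf (walk P.prgNode S.D i root)

/-- The shares of `(x, β, c)` of the last leaf in the honest execution. -/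
def honestAux (M : Inst S) (x : Fin S.k → S.Fq) (root : Seed lam) : Aux S :=
  let rest := ∑ i ∈ Finset.univ.erase (lastLeaf S), P.prgShare (leafSeed P root i).1
  let a := rest.2.2.1 + P.prgLast (leafSeed P root (lastLeaf S)).1
  (x - rest.1, beta M x - rest.2.1,
    -(∑ l, a l * algebraMap S.Fqm S.Fqme (beta M x l)) - rest.2.2.2)

/-- The transcript of the honest prover with witness `x` and root seed `root`, on given challenges. -/
def honestTranscript (M : Inst S) (x : Fin S.k → S.Fq) (root : Seed lam) (ch : Ch1 S) (i : Leaf S) :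
    Transcript S :=
  let aux := honestAux P M x root
  let sh : Leaf S → Share S := fun j => leafShare P (leafSeed P root j).1 aux j
  let cmt : Leaf S → Cmt S := fun j =>
    P.com (leafState (leafSeed P root j).1 aux j, (leafSeed P root j).2)
  let h0 := P.hash (Sum.inl cmt)
  let h1 := P.hash (Sum.inr (Sum.inr fun d => P.hash (Sum.inr (Sum.inl (execDim M ch sh d)))))
  (h0, ch, h1, i, cmt i, shareAlpha M ch {i} (sh i), siblings P.prgNode S.D i root,
    if i = lastLeaf S then 0 else aux)

/-- The verifier's decision. -/
def Accepts (M : Inst S) : Transcript S → Prop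
  | (h0, ch, h1, i, cmtStar, alphaStar, path, aux) =>
    let sr : Leaf S → Seed lam × Rho S := fun j => P.prgLeaf (recover P.prgNode S.D i path j)
    let sh : Leaf S → Share S := fun j => leafShare P (sr j).1 aux j
    let cmt : Leaf S → Cmt S := fun j =>
      if j = i then cmtStar else P.com (leafState (sr j).1 aux j, (sr j).2)
    let br : Fin S.D → Broadcast S := checkDim M ch i alphaStar sh
    h0 = P.hash (Sum.inl cmt) ∧
    (∀ d, (br d false).2 + (br d true).2 = 0) ∧
    (∀ d d', (br d false).1 + (br d true).1 = (br d' false).1 + (br d' true).1) ∧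
    h1 = P.hash (Sum.inr (Sum.inr fun d => P.hash (Sum.inr (Sum.inl (br d)))))

/-- The transcript of the honest interaction. -/
def realDist (M : Inst S) (x : Fin S.k → S.Fq) : PMF (Transcript S) :=
  (PMF.uniformOfFintype (Seed lam)).bind fun root =>
  (PMF.uniformOfFintype (Ch1 S)).bind fun ch =>
  (PMF.uniformOfFintype (Leaf S)).map fun i => honestTranscript P M x root ch i

end Protocol

/-! ### Cost model -/

/-- `Computes f s`: the function `f` is computed by a straight-line program of size at most `s` in
the operations below: pairing, projections, conditionals, constants, arithmetic in the three fields,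
their coordinates and encodings, counters, and evaluation of the algorithms of the protocol. The
program may depend on the parameters `S`, but not on those algorithms: they are given as oracles. -/
inductive Computes {lam : ℕ} (S : Params lam) : {α β : Type} → (Prims S → α → β) → ℕ → Prop
  | id {α : Type} : Computes S (fun _ (a : α) => a) 0
  | comp {α β γ : Type} {f : Prims S → α → β} {g : Prims S → β → γ} {s t : ℕ} :
      Computes S f s → Computes S g t → Computes S (fun P a => g P (f P a)) (s + t)
  | const {α β : Type} (b : β) : Computes S (fun _ (_ : α) => b) 1
  | fst {α β : Type} : Computes S (fun _ (a : α × β) => a.1) 1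
  | snd {α β : Type} : Computes S (fun _ (a : α × β) => a.2) 1
  | pair {α β γ : Type} {f : Prims S → α → β} {g : Prims S → α → γ} {s t : ℕ} :
      Computes S f s → Computes S g t → Computes S (fun P a => (f P a, g P a)) (s + t + 1)
  | proj {ι β : Type} (i : ι) : Computes S (fun _ (a : ι → β) => a i) 1
  | tuple {α ι β : Type} [Fintype ι] {f : ι → Prims S → α → β} {s : ι → ℕ} :
      (∀ i, Computes S (f i) (s i)) → Computes S (fun P a i => f i P a) ((∑ i, s i) + 1)
  | inl {α β : Type} : Computes S (fun _ (a : α) => (Sum.inl a : α ⊕ β)) 1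
  | inr {α β : Type} : Computes S (fun _ (b : β) => (Sum.inr b : α ⊕ β)) 1
  | cond {α β : Type} {c : Prims S → α → Bool} {f g : Prims S → α → β} {s t u : ℕ} :
      Computes S c s → Computes S f t → Computes S g u →
        Computes S (fun P a => if c P a = true then f P a else g P a) (s + t + u + 1)
  | succ : Computes S (fun _ (a : ℕ) => a + 1) 1
  | lt : Computes S (fun _ (a : ℕ × ℕ) => decide (a.1 < a.2)) 1
  | eqBits (w : ℕ) :
      Computes S (fun _ (a : (Fin w → Bool) × (Fin w → Bool)) => decide (a.1 = a.2)) (w + 1)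
  | addFq : Computes S (fun _ (a : S.Fq × S.Fq) => a.1 + a.2) 1
  | mulFq : Computes S (fun _ (a : S.Fq × S.Fq) => a.1 * a.2) 1
  | encFq : Computes S (fun _ (a : S.Fq) => S.bits a) 1
  | decFq : Computes S (fun _ a => Function.invFun S.bits a) 1
  | addFqm : Computes S (fun _ (a : S.Fqm × S.Fqm) => a.1 + a.2) 1
  | mulFqm : Computes S (fun _ (a : S.Fqm × S.Fqm) => a.1 * a.2) 1
  | frobFqm : Computes S (fun _ (a : S.Fqm) => a ^ S.q) 1
  | embFqm : Computes S (fun _ (a : S.Fq) => algebraMap S.Fq S.Fqm a) 1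
  | coordFqm (i : Fin S.m) : Computes S (fun _ (a : S.Fqm) => S.basis.repr a i) 1
  | addFqme : Computes S (fun _ (a : S.Fqme × S.Fqme) => a.1 + a.2) 1
  | mulFqme : Computes S (fun _ (a : S.Fqme × S.Fqme) => a.1 * a.2) 1
  | embFqme : Computes S (fun _ (a : S.Fqm) => algebraMap S.Fqm S.Fqme a) 1
  | coordFqme (i : Fin S.η) : Computes S (fun _ (a : S.Fqme) => S.basisExt.repr a i) 1
  | prgNode : Computes S (fun P a => P.prgNode a) 1
  | prgLeaf : Computes S (fun P a => P.prgLeaf a) 1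
  | prgShare : Computes S (fun P a => P.prgShare a) 1
  | prgLast : Computes S (fun P a => P.prgLast a) 1
  | com : Computes S (fun P a => P.com a) 1
  | hash : Computes S (fun P a => P.hash a) 1

/-! ### Soundness -/

section Soundness

variable {lam : ℕ}

/-- The false positive rate `p = 2 / q^{mη} - 1 / q^{2mη}`. -/
def falsePositive (S : Params lam) : ℝ :=
  2 / (S.q : ℝ) ^ (S.m * S.η) - 1 / (S.q : ℝ) ^ (2 * (S.m * S.η))

/-- The soundness error `1 / N + p (1 - 1 / N)`. -/
def soundnessError (S : Params lam) : ℝ :=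
  1 / (S.N : ℝ) + falsePositive S * (1 - 1 / (S.N : ℝ))

/-- An arbitrary prover, as a function of its random tape and of the challenges received so far. -/
structure CheatingProver (S : Params lam) where
  Tape : Type
  tape : PMF Tape
  h0 : Tape → Digest S
  h1 : Tape → Ch1 S → Digest S
  rsp : Tape → Ch1 S → Leaf S → Rsp S

/-- The transcript of the prover on a given tape and given challenges. -/
def CheatingProver.transcript {S : Params lam} (Pt : CheatingProver S) (τ : Pt.Tape) (ch : Ch1 S)
    (i : Leaf S) : Transcript S :=
  (Pt.h0 τ, ch, Pt.h1 τ ch, i, Pt.rsp τ ch i)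

/-- The transcript of the interaction with the honest verifier. -/
def CheatingProver.dist {S : Params lam} (Pt : CheatingProver S) : PMF (Transcript S) :=
  Pt.tape.bind fun τ =>
  (PMF.uniformOfFintype (Ch1 S)).bind fun ch =>
  (PMF.uniformOfFintype (Leaf S)).map fun i => Pt.transcript τ ch i

/-- The probability that the verifier accepts. -/
def CheatingProver.success {S : Params lam} (Pt : CheatingProver S) (P : Prims S) (M : Inst S) : ℝ :=
  (Pt.dist.toOuterMeasure {T | Accepts P M T}).toReal

/-- Output of an extractor: a MinRank witness, or two openings of a commitment, or two inputs of the
hash function. -/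
abbrev Output (S : Params lam) : Type :=
  (Fin S.k → S.Fq) ⊕ (((Msg S × Rho S) × (Msg S × Rho S)) ⊕ (HashIn S × HashIn S))

/-- The output is a MinRank solution, or a collision of the commitment (for different messages), or
a collision of the hash function that is used to commit. -/
def ValidOutput {S : Params lam} (P : Prims S) (M : Inst S) : Output S → Prop
  | Sum.inl x => IsSolution M x
  | Sum.inr (Sum.inl (u, w)) => u.1 ≠ w.1 ∧ P.com u = P.com w
  | Sum.inr (Sum.inr (u, w)) => u ≠ w ∧ P.hash u = P.hash w

/-- A probabilistic algorithm with rewindable black-box access to a prover. It proceeds in steps,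
each with one call to the prover. In a step, `query` chooses from the current state and fresh coins
whether the prover is restarted with a fresh random tape (`true`) or rewound and run again on the
same tape (`false`), and which challenges it gets; `update` processes the transcript obtained and
yields either the next state or the final output. -/
structure Extractor (S : Params lam) where
  State : Type
  init : State
  query : Prims S → (Inst S × State) × (Ch1 S × Leaf S) → Bool × (Ch1 S × Leaf S)
  update : Prims S → (Inst S × State) × Transcript S → State ⊕ Output S

/-- Each step of the extractor takes time at most `s`. -/
def Extractor.StepTime {S : Params lam} (E : Extractor S) (s : ℕ) : Prop :=
  ∃ s₁ s₂ : ℕ, Computes S E.query s₁ ∧ Computes S E.update s₂ ∧ s₁ + s₂ ≤ s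

/-- One step, from the current tape of the prover (`none` before the first call) and the current
state of the extractor. -/
def Extractor.step {S : Params lam} (E : Extractor S) (P : Prims S) (M : Inst S)
    (Pt : CheatingProver S) (c : Option Pt.Tape × E.State) :
    PMF ((Option Pt.Tape × E.State) ⊕ Output S) :=
  (PMF.uniformOfFintype (Ch1 S × Leaf S)).bind fun coins =>
    let qu := E.query P ((M, c.2), coins)
    let newTape : PMF Pt.Tape :=
      match qu.1, c.1 with
      | false, some τ => PMF.pure τ
      | _, _ => Pt.tape
    newTape.map fun τ =>
      match E.update P ((M, c.2), Pt.transcript τ qu.2.1 qu.2.2) with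
      | Sum.inl st => Sum.inl (some τ, st)
      | Sum.inr o => Sum.inr o

/-- The configuration (or the output) after `t` steps. -/
def Extractor.run {S : Params lam} (E : Extractor S) (P : Prims S) (M : Inst S)
    (Pt : CheatingProver S) : ℕ → PMF ((Option Pt.Tape × E.State) ⊕ Output S)
  | 0 => PMF.pure (Sum.inl (none, E.init))
  | t + 1 => (Extractor.run E P M Pt t).bind fun c =>
      match c with
      | Sum.inl c => E.step P M Pt c
      | Sum.inr o => PMF.pure (Sum.inr o)

/-- The expected number of calls to the prover, as the sum over `t` of the probability that the
extractor has not halted after `t` calls. -/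
def Extractor.expectedCalls {S : Params lam} (E : Extractor S) (P : Prims S) (M : Inst S)
    (Pt : CheatingProver S) : ℝ≥0∞ :=
  ∑' t : ℕ, (E.run P M Pt t).toOuterMeasure (Set.range Sum.inl)

end Soundness

/-! ### Computational indistinguishability and zero-knowledge -/

def PolyBounded (f : ℕ → ℕ) : Prop := ∃ p : Polynomial ℕ, ∀ l, f l ≤ p.eval l

def Negligible (μ : ℕ → ℝ) : Prop :=
  Asymptotics.SuperpolynomialDecay Filter.atTop (fun l : ℕ => (l : ℝ)) μ

/-- `Q` independent samples. -/
def samples {X : Type} (μ : PMF X) : (Q : ℕ) → PMF (Fin Q → X)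
  | 0 => PMF.pure Fin.elim0
  | Q + 1 => μ.bind fun x => (samples μ Q).map fun xs => Fin.cons x xs

/-- The probability that the test `A` accepts `Q` independent samples of `μ`. -/
def acceptProb {X : Type} (μ : PMF X) (Q : ℕ) (A : (Fin Q → X) → Bool) : ℝ :=
  ((samples μ Q).toOuterMeasure {xs | A xs = true}).toReal

/-- Computational indistinguishability: every (non-uniform) polynomial-size family of distinguishers,
with access to polynomially many samples, has negligible advantage. -/
def CompIndist (S : (lam : ℕ) → Params lam) (P : (lam : ℕ) → Prims (S lam)) {X : ℕ → Type}
    (μ ν : (lam : ℕ) → PMF (X lam)) : Prop :=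
  ∀ (Q s : ℕ → ℕ) (A : (lam : ℕ) → Prims (S lam) → (Fin (Q lam) → X lam) → Bool),
    (∀ lam, Computes (S lam) (A lam) (s lam)) → PolyBounded (fun lam => Q lam + s lam) →
    Negligible fun lam =>
      |acceptProb (μ lam) (Q lam) (A lam (P lam)) - acceptProb (ν lam) (Q lam) (A lam (P lam))|

/-- `G` applied to a uniform seed is indistinguishable from the uniform distribution. -/
def IsPRG (S : (lam : ℕ) → Params lam) (P : (lam : ℕ) → Prims (S lam)) {X : ℕ → Type}
    [∀ lam, Fintype (X lam)] [∀ lam, Nonempty (X lam)] (G : (lam : ℕ) → Seed lam → X lam) : Prop :=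
  CompIndist S P (fun lam => (PMF.uniformOfFintype (Seed lam)).map (G lam))
    (fun lam => PMF.uniformOfFintype (X lam))

/-- All the pseudorandom generators of the protocol are secure. -/
def PRGSecure (S : (lam : ℕ) → Params lam) (P : (lam : ℕ) → Prims (S lam)) : Prop :=
  IsPRG S P (fun lam => (P lam).prgNode) ∧ IsPRG S P (fun lam => (P lam).prgLeaf) ∧
    IsPRG S P (fun lam => (P lam).prgShare) ∧ IsPRG S P (fun lam => (P lam).prgLast)

/-- Commitments, to any message, are indistinguishable from uniform. -/
def ComUniform (S : (lam : ℕ) → Params lam) (P : (lam : ℕ) → Prims (S lam)) : Prop :=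
  ∀ msg : (lam : ℕ) → Msg (S lam),
    CompIndist S P
      (fun lam => (PMF.uniformOfFintype (Rho (S lam))).map fun ρ => (P lam).com (msg lam, ρ))
      (fun lam => PMF.uniformOfFintype (Cmt (S lam)))

/-- One cell of a random tape: a random bit and a random element of each field. -/
abbrev Cell {lam : ℕ} (S : Params lam) : Type := Bool × S.Fq × S.Fqm × S.Fqme

/-- A simulator: from the instance, the two challenges and a random tape with `width` cells it
computes `h_0`, `h_1` and the second response. It has no access to a witness. -/
structure Simulator {lam : ℕ} (S : Params lam) where
  width : ℕ
  run : Prims S → (Inst S × Ch1 S × Leaf S) × (Fin width → Cell S) → Digest S × Digest S × Rsp S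

/-- The simulator uses a random tape and a time which add up to at most `t`. -/
def Simulator.Time {lam : ℕ} {S : Params lam} (sim : Simulator S) (t : ℕ) : Prop :=
  ∃ s : ℕ, Computes S sim.run s ∧ sim.width + s ≤ t

/-- The simulated transcript, for uniformly random challenges. -/
def Simulator.dist {lam : ℕ} {S : Params lam} (sim : Simulator S) (P : Prims S) (M : Inst S) :
    PMF (Transcript S) :=
  (PMF.uniformOfFintype (Ch1 S)).bind fun ch =>
  (PMF.uniformOfFintype (Leaf S)).bind fun i =>
  (PMF.uniformOfFintype (Fin sim.width → Cell S)).map fun tape =>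
    let o := sim.run P ((M, ch, i), tape)
    (o.1, ch, o.2.1, i, o.2.2)

end MinRankPoK

end

/-! Completeness is algebra. The product of X - u over a subspace U is a monic q-polynomial
(`prod_eq_linPoly`), so β really is the coefficient vector of a q-polynomial L killing every e_j.
Shares of α, and shares of v once α is known, add up over disjoint sets of leaves. Their total for v
is -ε ∑ γ_j L(e_j) - (⟨a, β⟩ + c) (`totalV_eq`), which is zero for honest inputs. Conversely, if
some q-polynomial of q-degree r kills all e_j, then dim U ≤ r, so the committed x is a witness.

For soundness, fix a tape of the prover. The accepted pairs (first challenge, hidden leaf) form a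
set A of density s. Each pair carries commitments and messages of all leaves but one. Two accepted
views that disagree on these yield a collision. Two consistent views in the same row (same first
challenge) with different hidden leaves yield a hash collision or force an honest computation with v
= 0 (`totalV_eq_zero`). In the latter case there is a witness, unless the first challenge is a false
positive; false positives have density at most p (`card_falsePositive`).

After an accepted run the extractor makes R trials in the same row and 2R with fresh challenges. If
these succeed with probabilities u and v each, some trial succeeds with probability at least gain(R,
u + 2v), where gain(R, y) = Ry / (1 + Ry). The core is the counting inequality `gain_le_sum`: with t
= s - ε > 0, the average over all pairs of this bound, restricted to A, is at least t · gain(R, t).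
If almost all of A agrees with one assignment of messages, row trials do most of the work. If no
assignment fits that well, inconsistencies are frequent and fresh trials find them. The constants
are sharp enough to lose exactly ε, which consists of one hidden leaf per row and the false-positive
rows.

The function t · gain(R, t) is convex, so a tangent line carries the bound from single tapes to the
average acceptance probability. A potential argument (`Extractor.expectedCalls_le`, `restart_le`)
turns it into an expected number of calls, and R = ⌊1/ε̃⌋ gives the claimed constant
(`calls_bound`). Running times are bounded by building explicit straight-line programs.

For zero-knowledge, both digests are functions of the challenges and the response
(`honestTranscript_eq`), so only the response has to be simulated. It is a function of the sibling
path of the hidden leaf and of that leaf's seed and commitment tape. Hybrids replace the tree along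
the path, the leaf generator, the hidden commitment and the hidden share by uniform values
(`indist_rsp`). A uniform hidden share masks the witness through a bijection, so the simulator
simply draws a uniform response. A further hybrid handles polynomially many samples. -/

open scoped ENNReal

noncomputable section

namespace MinRankPoK

open Polynomial

/-! ### Linearized polynomials -/

section Linearized

variable (K : Type*) {L : Type*} [Field K] [Fintype K] [Field L] [Algebra K L]

/-- The `K`-linear map `e ↦ e ^ (q ^ l)`. -/
def frobLin (L : Type*) [CommRing L] [Algebra K L] (l : ℕ) : L →ₗ[K] L :=
  ((FiniteField.frobeniusAlgHom K L) ^ l).toLinearMap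

theorem frobLin_apply (L : Type*) [CommRing L] [Algebra K L] (l : ℕ) (e : L) :
    frobLin K L l e = e ^ Fintype.card K ^ l := by
  simp [frobLin, AlgHom.coe_pow, FiniteField.coe_frobeniusAlgHom, pow_iterate]

/-- The `K`-linear map `e ↦ e ^ (q ^ r) + ∑_{l < r} b_l e ^ (q ^ l)`. -/
def linMap {r : ℕ} (b : Fin r → L) : L →ₗ[K] L :=
  frobLin K L r + ∑ l, (LinearMap.mulLeft K (b l)).comp (frobLin K L l)

theorem linMap_apply {r : ℕ} (b : Fin r → L) (e : L) :
    linMap K b e = e ^ Fintype.card K ^ r + ∑ l, b l * e ^ Fintype.card K ^ (l : ℕ) := by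
  simp [linMap, frobLin_apply]

/-- The polynomial `X ^ (q ^ r) + ∑_{l < r} b_l X ^ (q ^ l)`. -/
def linPoly {r : ℕ} (b : Fin r → L) : L[X] :=
  X ^ Fintype.card K ^ r + ∑ l, C (b l) * X ^ Fintype.card K ^ (l : ℕ)

theorem eval_linPoly {r : ℕ} (b : Fin r → L) (e : L) :
    (linPoly K b).eval e = linMap K b e := by
  simp [linPoly, linMap_apply, eval_finsetSum]

theorem degree_sum_lt {r : ℕ} (b : Fin r → L) :
    (∑ l, C (b l) * X ^ Fintype.card K ^ (l : ℕ)).degree <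
      ((Fintype.card K ^ r : ℕ) : WithBot ℕ) := by
  have hq : 1 < Fintype.card K := Fintype.one_lt_card
  refine (degree_sum_le _ _).trans_lt ?_
  rw [Finset.sup_lt_iff (by exact_mod_cast WithBot.bot_lt_coe _)]
  intro l _
  refine (degree_C_mul_X_pow_le _ _).trans_lt ?_
  exact_mod_cast Nat.pow_lt_pow_right hq l.2

theorem monic_linPoly {r : ℕ} (b : Fin r → L) : (linPoly K b).Monic :=
  monic_X_pow_add (degree_sum_lt K b)

theorem degree_linPoly {r : ℕ} (b : Fin r → L) :
    (linPoly K b).degree = ((Fintype.card K ^ r : ℕ) : WithBot ℕ) := by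
  rw [linPoly, degree_add_eq_left_of_degree_lt] <;> simp
  exact_mod_cast degree_sum_lt K b

theorem coeff_linPoly {r : ℕ} (b : Fin r → L) (l : Fin r) :
    (linPoly K b).coeff (Fintype.card K ^ (l : ℕ)) = b l := by
  have hq : 1 < Fintype.card K := Fintype.one_lt_card
  have h1 : Fintype.card K ^ (l : ℕ) ≠ Fintype.card K ^ r :=
    (Nat.pow_lt_pow_right hq l.2).ne
  simp only [linPoly, coeff_add, coeff_X_pow, finsetSum_coeff, coeff_C_mul]
  rw [if_neg h1, Finset.sum_eq_single l]
  · simp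
  · intro i _ hi
    have : Fintype.card K ^ (l : ℕ) ≠ Fintype.card K ^ (i : ℕ) := fun h =>
      hi (Fin.ext (Nat.pow_right_injective hq h).symm)
    simp [this]
  · simp

variable [Fintype L]

open Classical in
/-- The kernel of a linearized polynomial of `q`-degree `r` has dimension at most `r`. -/
theorem finrank_le_of_le_ker {r : ℕ} (b : Fin r → L) (U : Submodule K L)
    (hU : ∀ e ∈ U, linMap K b e = 0) : Module.finrank K U ≤ r := by
  have hq : 1 < Fintype.card K := Fintype.one_lt_card
  have h0 : linPoly K b ≠ 0 := (monic_linPoly K b).ne_zero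
  have hsub : (Finset.univ.filter fun u => u ∈ U) ⊆ (linPoly K b).roots.toFinset := by
    intro u hu
    simp only [Finset.mem_filter, Finset.mem_univ, true_and] at hu
    simp [h0, eval_linPoly, hU u hu]
  have hcard := (Finset.card_le_card hsub).trans (Multiset.toFinset_card_le _)
  have hdeg := card_roots' (linPoly K b)
  rw [natDegree_eq_of_degree_eq_some (degree_linPoly K b)] at hdeg
  have h1 : (Finset.univ.filter fun u => u ∈ U).card = Fintype.card K ^ Module.finrank K U := by
    rw [← Module.card_eq_pow_finrank (K := K) (V := U), Fintype.card_subtype]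
  rw [h1] at hcard
  exact (Nat.pow_le_pow_iff_right hq).1 (hcard.trans hdeg)

/-- Every subspace of dimension `d` is annihilated by a linearized polynomial of `q`-degree `d`. -/
theorem exists_linMap_eq_zero (U : Submodule K L) :
    ∃ b : Fin (Module.finrank K U) → L, ∀ e ∈ U, linMap K b e = 0 := by
  set d := Module.finrank K U with hd
  have hq : 1 < Fintype.card K := Fintype.one_lt_card
  let v : Module.Basis (Fin d) K U := Module.finBasis K U
  -- The Moore matrix of a basis of U. Once it is injective it is surjective, and the coefficients b
  -- solve the system whose right-hand side is given by the leading terms.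
  let Φ : (Fin d → L) →ₗ[L] (Fin d → L) :=
    { toFun := fun b i => ∑ l, b l * (v i : L) ^ Fintype.card K ^ (l : ℕ)
      map_add' := fun b c => by ext i; simp [add_mul, Finset.sum_add_distrib]
      map_smul' := fun a b => by ext i; simp [Finset.mul_sum, mul_assoc] }
  have hext : ∀ ψ : L →ₗ[K] L, (∀ i, ψ (v i) = 0) → ∀ e ∈ U, ψ e = 0 := by
    intro ψ h e he
    have : ψ.comp U.subtype = 0 := v.ext fun i => by simpa using h i
    simpa using LinearMap.congr_fun this ⟨e, he⟩
  have hinj : Function.Injective Φ := by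
    rw [← LinearMap.ker_eq_bot, LinearMap.ker_eq_bot']
    intro b hb
    set p : L[X] := ∑ l, C (b l) * X ^ Fintype.card K ^ (l : ℕ) with hp
    have hpU : ∀ e ∈ U, p.eval e = 0 := by
      intro e he
      have := hext (∑ l, (LinearMap.mulLeft K (b l)).comp (frobLin K L l)) (fun i => by
        simpa [Φ, frobLin_apply] using congrFun hb i) e he
      simpa [hp, eval_finsetSum, frobLin_apply] using this
    -- A kernel vector gives a polynomial of degree below q^d that vanishes at all q^d elements of
    -- U.
    have hp0 : p = 0 := by
      classical
      refine eq_zero_of_degree_lt_of_eval_finset_eq_zero (Finset.univ.filter fun u => u ∈ U) ?_ ?_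
      · rw [← Fintype.card_subtype]
        have : Fintype.card {u // u ∈ U} = Fintype.card K ^ d :=
          Module.card_eq_pow_finrank (K := K) (V := U)
        rw [this]
        exact degree_sum_lt K b
      · intro e he
        exact hpU e (by simpa using he)
    funext l
    have := coeff_linPoly K b l
    rw [linPoly, ← hp, hp0, add_zero, coeff_X_pow,
      if_neg (Nat.pow_lt_pow_right hq l.2).ne] at this
    exact this.symm
  obtain ⟨b, hb⟩ := (LinearMap.injective_iff_surjective.1 hinj)
    fun i => -((v i : L) ^ Fintype.card K ^ d)
  refine ⟨b, hext _ fun i => ?_⟩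
  have := congrFun hb i
  rw [linMap_apply]
  simp only [Φ, LinearMap.coe_mk, AddHom.coe_mk] at this
  rw [this, add_neg_cancel]

-- Both sides are monic of degree |U| and vanish on U, so their difference has more zeros than its
-- degree allows.
open Classical in
theorem prod_eq_linPoly (U : Submodule K L) :
    ∃ b : Fin (Module.finrank K U) → L,
      ∏ u ∈ Finset.univ.filter (fun u => u ∈ U), (X - C u) = linPoly K b := by
  obtain ⟨b, hb⟩ := exists_linMap_eq_zero K U
  refine ⟨b, ?_⟩
  have hc : (Finset.univ.filter fun u => u ∈ U).card = Fintype.card K ^ Module.finrank K U := by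
    rw [← Module.card_eq_pow_finrank (K := K) (V := U), Fintype.card_subtype]
  refine eq_of_degree_sub_lt_of_eval_finset_eq (Finset.univ.filter fun u => u ∈ U) ?_ ?_
  · have hm : (∏ u ∈ Finset.univ.filter (fun u => u ∈ U), (X - C u)).Monic :=
      monic_prod_of_monic _ _ fun u _ => monic_X_sub_C u
    have hdeg : (∏ u ∈ Finset.univ.filter (fun u => u ∈ U), (X - C u)).degree =
        ((Fintype.card K ^ Module.finrank K U : ℕ) : WithBot ℕ) := by
      rw [degree_prod]; simp [hc]
    refine (degree_sub_lt_left ?_ hm.ne_zero ?_).trans_eq ?_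
    · rw [hdeg, degree_linPoly]
    · rw [hm.leadingCoeff, (monic_linPoly K b).leadingCoeff]
    · rw [hdeg, hc]
  · intro e he
    have he' : e ∈ U := by simpa using he
    rw [eval_linPoly, hb e he', eval_prod]
    exact Finset.prod_eq_zero he (by simp)

/-- Raising to the power q^s is additive on L[X] as well, so it shifts all q-exponents by s; the
lowest s coefficients become zero. This covers witnesses of rank below r. The ring in `frobLin` is
kept general for this use on polynomials. -/
theorem linPoly_pow {d : ℕ} (b : Fin d → L) (s r : ℕ) (h : d + s = r) :
    ∃ c : Fin r → L, linPoly K b ^ Fintype.card K ^ s = linPoly K c := by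
  subst h
  refine ⟨fun l => if hl : s ≤ l then b ⟨l - s, by omega⟩ ^ Fintype.card K ^ s else 0, ?_⟩
  rw [← frobLin_apply, linPoly, map_add, map_sum, linPoly]
  simp only [frobLin_apply, mul_pow, ← pow_mul, ← pow_add, ← C_pow]
  congr 1
  rw [← Fin.sum_congr' _ (Nat.add_comm s d), Fin.sum_univ_add]
  have h0 : ∀ l : Fin s, ¬ s ≤ (l : ℕ) := fun l => by omega
  simp [h0, add_comm]

end Linearized

end MinRankPoK

end

open scoped ENNReal

noncomputable section

namespace MinRankPoK

/-! ### The multiparty computation -/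

section MPC

variable {lam : ℕ} {S : Params lam}

theorem column_add (E E' : Fin S.m → Fin S.n → S.Fq) (j : Fin S.n) :
    column (S := S) (fun a b => E a b + E' a b) j = column E j + column E' j := by
  simp [column, add_smul, Finset.sum_add_distrib]

/-- The affine term M_0 causes no trouble because the first leaf lies in at most one of two disjoint
sets. All further additivity statements rest on this and on additivity of Frobenius. -/
theorem shareCol_union (M : Inst S) {A B : Finset (Leaf S)} (h : Disjoint A B)
    (x y : Fin S.k → S.Fq) (j : Fin S.n) :
    shareCol M (A ∪ B) (x + y) j = shareCol M A x j + shareCol M B y j := by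
  unfold shareCol
  rw [← column_add]
  congr 1
  funext a b
  have : (if firstLeaf S ∈ A ∪ B then M 0 a b else 0) =
      (if firstLeaf S ∈ A then M 0 a b else 0) + (if firstLeaf S ∈ B then M 0 a b else 0) := by
    by_cases hA : firstLeaf S ∈ A
    · have hB : firstLeaf S ∉ B := Finset.disjoint_left.1 h hA
      simp [hA, hB]
    · simp [hA]
  rw [this]
  simp only [Pi.add_apply, add_mul, Finset.sum_add_distrib]
  ring

theorem shareCol_univ (M : Inst S) (x : Fin S.k → S.Fq) (j : Fin S.n) :
    shareCol M Finset.univ x j = column (matE M x) j := by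
  simp [shareCol, matE]
  rfl

theorem shareW_union (M : Inst S) (ch : Ch1 S) {A B : Finset (Leaf S)} (h : Disjoint A B)
    (x y : Fin S.k → S.Fq) (l : ℕ) :
    shareW M ch (A ∪ B) (x + y) l = shareW M ch A x l + shareW M ch B y l := by
  unfold shareW
  rw [← Finset.sum_add_distrib]
  refine Finset.sum_congr rfl fun j _ => ?_
  rw [shareCol_union M h]
  have := frobLin_apply S.Fq S.Fqm l
  unfold Params.q
  rw [← this, ← this, ← this, map_add, map_add, mul_add]

theorem shareAlpha_union (M : Inst S) (ch : Ch1 S) {A B : Finset (Leaf S)} (h : Disjoint A B)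
    (s t : Share S) :
    shareAlpha M ch (A ∪ B) (s + t) = shareAlpha M ch A s + shareAlpha M ch B t := by
  funext l
  simp only [shareAlpha, Prod.fst_add, Prod.snd_add, shareW_union M ch h, Pi.add_apply]
  ring

theorem shareV_union (M : Inst S) (ch : Ch1 S) {A B : Finset (Leaf S)} (h : Disjoint A B)
    (s t : Share S) (al : Fin S.r → S.Fqme) :
    shareV M ch (A ∪ B) (s + t) al = shareV M ch A s al + shareV M ch B t al := by
  simp only [shareV, Prod.fst_add, Prod.snd_add, shareW_union M ch h, Pi.add_apply, map_add,
    mul_add, Finset.sum_add_distrib]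
  ring

theorem disjoint_mainParty (d : Fin S.D) (b : Bool) :
    Disjoint (mainParty S d b) (mainParty S d !b) := by
  rw [Finset.disjoint_left]
  intro i hi hi'
  simp only [mainParty, Finset.mem_filter] at hi hi'
  rw [hi.2] at hi'
  simp at hi'

theorem mainParty_union (d : Fin S.D) (b : Bool) :
    mainParty S d b ∪ mainParty S d (!b) = Finset.univ := by
  ext i
  cases h : i d <;> cases b <;> simp [mainParty, h]

theorem aggregate_union (sh : Leaf S → Share S) {A B : Finset (Leaf S)} (h : Disjoint A B) :
    aggregate sh (A ∪ B) = aggregate sh A + aggregate sh B :=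
  Finset.sum_union h

/-- The plain value of `v` on given inputs. -/
def totalV (M : Inst S) (ch : Ch1 S) (s : Share S) : S.Fqme :=
  shareV M ch Finset.univ s (shareAlpha M ch Finset.univ s)

/-- The two main parties of any dimension partition the leaves, so the total cannot depend on the
dimension. -/
theorem shareAlpha_mainParty (M : Inst S) (ch : Ch1 S) (sh : Leaf S → Share S) (d : Fin S.D)
    (b : Bool) :
    shareAlpha M ch (mainParty S d b) (aggregate sh (mainParty S d b)) +
      shareAlpha M ch (mainParty S d !b) (aggregate sh (mainParty S d !b)) =
    shareAlpha M ch Finset.univ (aggregate sh Finset.univ) := by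
  rw [← mainParty_union d b, aggregate_union sh (disjoint_mainParty d b),
    shareAlpha_union M ch (disjoint_mainParty d b)]

theorem shareV_mainParty (M : Inst S) (ch : Ch1 S) (sh : Leaf S → Share S) (d : Fin S.D)
    (b : Bool) (al : Fin S.r → S.Fqme) :
    shareV M ch (mainParty S d b) (aggregate sh (mainParty S d b)) al +
      shareV M ch (mainParty S d !b) (aggregate sh (mainParty S d !b)) al =
    shareV M ch Finset.univ (aggregate sh Finset.univ) al := by
  rw [← mainParty_union d b, aggregate_union sh (disjoint_mainParty d b),
    shareV_union M ch (disjoint_mainParty d b)]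

theorem sum_bool_eq {α : Type*} [AddCommMonoid α] (f : Bool → α) (b : Bool) :
    f false + f true = f b + f !b := by
  cases b <;> simp [add_comm]

/-- The value of `α` obtained by the verifier in dimension `d`. -/
theorem checkDim_v (M : Inst S) (ch : Ch1 S) (i : Leaf S) (al : Fin S.r → S.Fqme)
    (sh : Leaf S → Share S) (d : Fin S.D) :
    (checkDim M ch i al sh d false).2 + (checkDim M ch i al sh d true).2 = 0 := by
  rw [sum_bool_eq (fun b => (checkDim M ch i al sh d b).2) (i d)]
  simp [checkDim]

/-- The main party without the hidden leaf is computed entirely by the verifier. Relative to the α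
that was broadcast, its shares are therefore honest even against a cheating prover. -/
theorem checkDim_other (M : Inst S) (ch : Ch1 S) (i : Leaf S) (al : Fin S.r → S.Fqme)
    (sh : Leaf S → Share S) (d : Fin S.D) (b : Bool) (hb : b = !(i d)) :
    checkDim M ch i al sh d b =
      (shareAlpha M ch (mainParty S d b) (aggregate sh (mainParty S d b)),
        shareV M ch (mainParty S d b) (aggregate sh (mainParty S d b))
          ((checkDim M ch i al sh d false).1 + (checkDim M ch i al sh d true).1)) := by
  rw [sum_bool_eq (fun b => (checkDim M ch i al sh d b).1) (i d)]
  subst hb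
  simp [checkDim]

/-- The share of the hidden leaf is never read, so the dummy value recomputed there may be replaced
by any other. -/
theorem checkDim_congr (M : Inst S) (ch : Ch1 S) (i : Leaf S) (al : Fin S.r → S.Fqme)
    {sh sh' : Leaf S → Share S} (h : ∀ j, j ≠ i → sh j = sh' j) (d : Fin S.D) :
    checkDim M ch i al sh d = checkDim M ch i al sh' d := by
  have h1 : aggregate sh ((mainParty S d (i d)).erase i) =
      aggregate sh' ((mainParty S d (i d)).erase i) :=
    Finset.sum_congr rfl fun j hj => h j (Finset.ne_of_mem_erase hj)
  have h2 : aggregate sh (mainParty S d !(i d)) = aggregate sh' (mainParty S d !(i d)) :=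
    Finset.sum_congr rfl fun j hj => h j fun hji => by
      subst hji
      simp [mainParty] at hj
  simp only [checkDim, h1, h2]

/-- The verifier recomputes the honest broadcast from the honest shares. -/
theorem checkDim_honest (M : Inst S) (ch : Ch1 S) (i : Leaf S) (sh : Leaf S → Share S)
    (hv : totalV M ch (aggregate sh Finset.univ) = 0) (d : Fin S.D) :
    checkDim M ch i (shareAlpha M ch {i} (sh i)) sh d = execDim M ch sh d := by
  have hmem : i ∈ mainParty S d (i d) := by simp [mainParty]
  have hpart : (mainParty S d (i d)).erase i ∪ {i} = mainParty S d (i d) := by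
    rw [Finset.union_comm, ← Finset.insert_eq, Finset.insert_erase hmem]
  have hdis : Disjoint ((mainParty S d (i d)).erase i) {i} := by simp
  have hal : shareAlpha M ch ((mainParty S d (i d)).erase i)
        (aggregate sh ((mainParty S d (i d)).erase i)) + shareAlpha M ch {i} (sh i) =
      shareAlpha M ch (mainParty S d (i d)) (aggregate sh (mainParty S d (i d))) := by
    conv_rhs => rw [← hpart, aggregate_union sh hdis, shareAlpha_union M ch hdis]
    simp [aggregate]
  have hsum := shareAlpha_mainParty M ch sh d (i d)
  have hV := shareV_mainParty M ch sh d (i d)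
    (shareAlpha M ch Finset.univ (aggregate sh Finset.univ))
  rw [show shareV M ch Finset.univ _ _ = 0 from hv] at hV
  have hex : shareAlpha M ch (mainParty S d false) (aggregate sh (mainParty S d false)) +
      shareAlpha M ch (mainParty S d true) (aggregate sh (mainParty S d true)) =
      shareAlpha M ch Finset.univ (aggregate sh Finset.univ) := shareAlpha_mainParty M ch sh d false
  funext b
  unfold checkDim execDim
  simp only [hal, hsum, hex]
  split_ifs with h
  · subst h
    -- The shares of v sum to zero in the honest execution, so the share forced by the verifier is
    -- the honest one.
    rw [← eq_neg_iff_add_eq_zero] at hV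
    rw [hV]
    simp
  · have : b = !(i d) := by cases b <;> cases hh : i d <;> simp_all
    rw [this]

theorem execDim_alpha (M : Inst S) (ch : Ch1 S) (sh : Leaf S → Share S) (d : Fin S.D) :
    (execDim M ch sh d false).1 + (execDim M ch sh d true).1 =
      shareAlpha M ch Finset.univ (aggregate sh Finset.univ) :=
  shareAlpha_mainParty M ch sh d false

/-- If the broadcast recomputed without the leaf `i` coincides with the one recomputed without
another leaf `i'`, then the computation was executed honestly, and its result is zero. -/
theorem totalV_eq_zero (M : Inst S) (ch : Ch1 S) {i i' : Leaf S} (hi : i ≠ i')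
    (al al' : Fin S.r → S.Fqme) (sh : Leaf S → Share S)
    (h : ∀ d, checkDim M ch i al sh d = checkDim M ch i' al' sh d) :
    totalV M ch (aggregate sh Finset.univ) = 0 := by
  -- In a dimension that separates the two leaves, each view checks exactly the main party that the
  -- other cannot check. Together they vouch for both.
  obtain ⟨d, hd⟩ : ∃ d, i d ≠ i' d := by
    by_contra hcon
    push Not at hcon
    exact hi (funext hcon)
  have hb : i d = !(i' d) := by cases h1 : i d <;> cases h2 : i' d <;> simp_all
  set b := i d with hbdef
  have e1 := checkDim_other M ch i al sh d (!b) rfl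
  have e2 := checkDim_other M ch i' al' sh d b hb
  rw [← h d] at e2
  set br := checkDim M ch i al sh d with hbr
  have hv : (br false).2 + (br true).2 = 0 := checkDim_v M ch i al sh d
  have ha : (br false).1 + (br true).1 =
      shareAlpha M ch Finset.univ (aggregate sh Finset.univ) := by
    rw [sum_bool_eq (fun b => (br b).1) b, ← shareAlpha_mainParty M ch sh d b]
    exact congrArg₂ _ (congrArg Prod.fst e2) (congrArg Prod.fst e1)
  rw [ha] at e1 e2
  rw [sum_bool_eq (fun b => (br b).2) b] at hv
  simp only [e1, e2] at hv
  rw [shareV_mainParty] at hv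
  exact hv

/-- The extracted polynomial annihilates all `e_j`. -/
def Certified (M : Inst S) (s : Share S) : Prop :=
  ∀ j, linMap S.Fq s.2.1 (column (matE M s.1) j) = 0

/-- The part ε⟨w, β⟩ of ⟨α, β⟩ joins with -εz to give L evaluated at the e_j. What remains does not
involve the challenge, and this makes the false positives countable. -/
theorem totalV_eq (M : Inst S) (ch : Ch1 S) (s : Share S) :
    totalV M ch s =
      -(ch.2 * ∑ j, ch.1 j * algebraMap S.Fqm S.Fqme
        (linMap S.Fq s.2.1 (column (matE M s.1) j))) -
      ((∑ l, s.2.2.1 l * algebraMap S.Fqm S.Fqme (s.2.1 l)) + s.2.2.2) := by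
  have hW : ∀ l, shareW M ch Finset.univ s.1 l =
      ∑ j, ch.1 j * algebraMap S.Fqm S.Fqme (column (matE M s.1) j ^ S.q ^ l) := fun l => by
    simp only [shareW, shareCol_univ]
  have hlin : ∑ j, ch.1 j * algebraMap S.Fqm S.Fqme
        (linMap S.Fq s.2.1 (column (matE M s.1) j)) =
      shareW M ch Finset.univ s.1 S.r +
        ∑ l : Fin S.r, shareW M ch Finset.univ s.1 l * algebraMap S.Fqm S.Fqme (s.2.1 l) := by
    simp only [hW, linMap_apply, map_add, map_sum, map_mul, mul_add, Finset.sum_add_distrib,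
      Finset.sum_mul, Finset.mul_sum]
    congr 1
    rw [Finset.sum_comm]
    refine Finset.sum_congr rfl fun l _ => Finset.sum_congr rfl fun j _ => ?_
    rw [Params.q]
    ring
  rw [hlin]
  simp only [totalV, shareV, shareAlpha, add_mul, Finset.sum_add_distrib, mul_add, mul_assoc,
    ← Finset.mul_sum]
  ring

/-- The basis of 𝔽_{q^m} identifies the column space of E with U. -/
theorem rank_matE (M : Inst S) (x : Fin S.k → S.Fq) :
    (matE M x).rank = Module.finrank S.Fq (suppU M x) := by
  rw [Matrix.rank_eq_finrank_span_cols]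
  let e := S.basis.equivFun.symm
  have h : suppU M x =
      (Submodule.span S.Fq (Set.range (matE M x).col)).map (e : (Fin S.m → S.Fq) →ₗ[S.Fq] S.Fqm) := by
    rw [Submodule.map_span, ← Set.range_comp, suppU]
    congr 2
    funext j
    change _ = S.basis.equivFun.symm ((matE M x).col j)
    rw [Module.Basis.equivFun_symm_apply]
    rfl
  rw [h]
  exact (LinearEquiv.finrank_map_eq e _).symm

theorem isSolution_of_certified {M : Inst S} {s : Share S} (h : Certified M s) :
    IsSolution M s.1 := by
  rw [IsSolution, rank_matE]
  refine finrank_le_of_le_ker S.Fq s.2.1 _ fun e he => ?_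
  have : suppU M s.1 ≤ LinearMap.ker (linMap S.Fq s.2.1) := by
    rw [suppU, Submodule.span_le]
    rintro _ ⟨j, rfl⟩
    exact h j
  exact this he

open Classical in
theorem linMap_beta {M : Inst S} {x : Fin S.k → S.Fq} (h : IsSolution M x) (j : Fin S.n) :
    linMap S.Fq (beta M x) (column (matE M x) j) = 0 := by
  rw [IsSolution, rank_matE] at h
  obtain ⟨b, hb⟩ := prod_eq_linPoly S.Fq (suppU M x)
  obtain ⟨c, hc⟩ := linPoly_pow S.Fq b (S.r - Module.finrank S.Fq (suppU M x)) S.r (by omega)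
  have hann : annihilator M x = linPoly S.Fq c := by
    rw [annihilator, hb, Params.q, hc]
  have hbeta : beta M x = c := by
    funext l
    rw [beta, hann, Params.q, coeff_linPoly]
  rw [hbeta, ← eval_linPoly, ← hc, ← hb, Polynomial.eval_pow, Polynomial.eval_prod]
  have hmem : column (matE M x) j ∈ suppU M x := Submodule.subset_span ⟨j, rfl⟩
  rw [Finset.prod_eq_zero (Finset.mem_filter.2 ⟨Finset.mem_univ _, hmem⟩) (by simp), zero_pow]
  exact pow_ne_zero _ Fintype.card_ne_zero

theorem card_Fqme : Fintype.card S.Fqme = S.q ^ (S.m * S.η) := by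
  have h1 : Fintype.card S.Fqm = S.q ^ S.m := by
    rw [Params.q, Module.card_fintype S.basis, Fintype.card_fin]
  rw [Module.card_fintype S.basisExt, Fintype.card_fin, h1, pow_mul]

open Classical in
/-- The false positive probability. -/
theorem card_falsePositive (M : Inst S) (s : Share S) (h : ¬ Certified M s) :
    ((Finset.univ.filter fun ch : Ch1 S => totalV M ch s = 0).card : ℝ) ≤
      falsePositive S * Fintype.card (Ch1 S) := by
  obtain ⟨j0, hj0⟩ := not_forall.1 h
  set t : Fin S.n → S.Fqme := fun j => algebraMap S.Fqm S.Fqme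
    (linMap S.Fq s.2.1 (column (matE M s.1) j)) with ht
  have ht0 : t j0 ≠ 0 := fun h0 => hj0 (by simpa [ht] using h0)
  set κ := (∑ l, s.2.2.1 l * algebraMap S.Fqm S.Fqme (s.2.1 l)) + s.2.2.2 with hκ
  set g : (Fin S.n → S.Fqme) → S.Fqme := fun γ => ∑ j, γ j * t j with hg
  set Q := Fintype.card S.Fqme with hQ
  set Z := (Finset.univ.filter fun γ => g γ = 0).card with hZ
  -- The zeros of the nonzero linear form g have pairwise disjoint translates along the coordinate
  -- j0, since g changes there by a nonzero multiple. Hence there are at most Q^(n-1) of them.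
  have hZle : Q * Z ≤ Q ^ S.n := by
    have hinj : Set.InjOn (fun p : S.Fqme × (Fin S.n → S.Fqme) => p.2 + Pi.single j0 p.1)
        ((Finset.univ ×ˢ Finset.univ.filter fun γ => g γ = 0 :
          Finset (S.Fqme × (Fin S.n → S.Fqme))) : Set (S.Fqme × (Fin S.n → S.Fqme))) := by
      rintro ⟨a, γ⟩ h1 ⟨a', γ'⟩ h2 heq
      simp only [Finset.coe_product, Set.mem_prod, Finset.coe_filter, Set.mem_ofPred_eq,
        Finset.mem_univ, true_and] at h1 h2
      have hgs : ∀ (a : S.Fqme) (γ : Fin S.n → S.Fqme),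
          g (γ + Pi.single j0 a) = g γ + a * t j0 := by
        intro a γ
        simp only [hg, Pi.add_apply, add_mul, Finset.sum_add_distrib]
        congr 1
        rw [Finset.sum_eq_single j0] <;> simp +contextual
      have := congrArg g heq
      simp only [hgs, h1.2, h2.2, zero_add] at this
      have ha : a = a' := mul_right_cancel₀ ht0 this
      subst ha
      simpa using heq
    have := Finset.card_le_univ (Finset.image
      (fun p : S.Fqme × (Fin S.n → S.Fqme) => p.2 + Pi.single j0 p.1)
      (Finset.univ ×ˢ Finset.univ.filter fun γ => g γ = 0))
    rw [Finset.card_image_of_injOn hinj, Finset.card_product] at this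
    simpa [hQ, hZ] using this
  -- The condition reads ε · g(γ) = -κ. If g(γ) = 0 possibly every ε qualifies, otherwise exactly
  -- one candidate does.
  have hcount : (Finset.univ.filter fun ch : Ch1 S => totalV M ch s = 0).card ≤
      ∑ γ : Fin S.n → S.Fqme, if g γ = 0 then Q else 1 := by
    have heq : ∀ γ e, totalV M (γ, e) s = 0 ↔ e * g γ = -κ := fun γ e => by
      rw [totalV_eq, sub_eq_zero, neg_eq_iff_eq_neg]
    rw [← Finset.univ_product_univ, Finset.card_filter, Finset.sum_product]
    refine Finset.sum_le_sum fun γ _ => ?_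
    rw [← Finset.card_filter]
    split_ifs with h0
    · exact (Finset.card_le_univ _)
    · rw [Finset.card_le_one]
      intro a ha b hb
      simp only [Finset.mem_filter, Finset.mem_univ, true_and, heq] at ha hb
      exact mul_right_cancel₀ h0 (ha.trans hb.symm)
  have hsum : ∑ γ : Fin S.n → S.Fqme, (if g γ = 0 then Q else 1) + Z = Q * Z + Q ^ S.n := by
    rw [Finset.sum_ite, Finset.sum_const, Finset.sum_const, smul_eq_mul, smul_eq_mul, mul_one,
      add_assoc, add_comm (Finset.card _) Z, hZ, mul_comm Q]
    congr 1
    have := Finset.card_filter_add_card_filter_not (s := (Finset.univ : Finset (Fin S.n → S.Fqme)))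
      (fun γ => g γ = 0)
    rw [this]
    simp [hQ]
  have hQ1 : 1 < Q := Fintype.one_lt_card
  have hq : (S.q : ℝ) ^ (S.m * S.η) = Q := by rw [hQ, card_Fqme]; push_cast; rfl
  have hcard : Fintype.card (Ch1 S) = Q ^ S.n * Q := by
    simp [Fintype.card_prod, hQ]
  have hQR : (1 : ℝ) < Q := by exact_mod_cast hQ1
  rw [falsePositive, mul_comm 2 (S.m * S.η), pow_mul _ (S.m * S.η) 2, hq, hcard]
  have c1 : ((Finset.univ.filter fun ch : Ch1 S => totalV M ch s = 0).card : ℝ) + Z ≤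
      Q * Z + Q ^ S.n := by
    exact_mod_cast (Nat.add_le_add_right hcount Z).trans hsum.le
  have c2 : (Q : ℝ) * Z ≤ Q ^ S.n := by exact_mod_cast hZle
  push_cast
  -- The count is at most Z(Q - 1) + Q^n, and inserting Z ≤ Q^(n-1) gives exactly this value.
  have c3 : (2 / (Q : ℝ) - 1 / Q ^ 2) * (Q ^ S.n * Q) = 2 * Q ^ S.n - Q ^ S.n / Q := by
    field_simp
  rw [c3]
  have c4 : (Z : ℝ) * (Q - 1) ≤ Q ^ S.n - Q ^ S.n / Q := by
    have : (Z : ℝ) ≤ Q ^ S.n / Q := by rw [le_div_iff₀ (by linarith)]; linarith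
    calc (Z : ℝ) * (Q - 1) ≤ (Q ^ S.n / Q) * (Q - 1) := by
          apply mul_le_mul_of_nonneg_right this; linarith
      _ = _ := by field_simp
  linarith

theorem falsePositive_nonneg (S : Params lam) : 0 ≤ falsePositive S ∧ falsePositive S ≤ 1 := by
  have h : (1 : ℝ) ≤ (S.q : ℝ) ^ (S.m * S.η) := by
    have : 1 < Fintype.card S.Fqme := Fintype.one_lt_card
    rw [card_Fqme] at this
    exact_mod_cast this.le
  have e : falsePositive S = 1 - (1 - 1 / (S.q : ℝ) ^ (S.m * S.η)) ^ 2 := by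
    rw [falsePositive, mul_comm 2 (S.m * S.η), pow_mul _ (S.m * S.η) 2]
    ring
  have h1 : 1 / (S.q : ℝ) ^ (S.m * S.η) ≤ 1 := by
    rw [div_le_one (by linarith)]; exact h
  have h2 : 0 ≤ 1 / (S.q : ℝ) ^ (S.m * S.η) := by positivity
  rw [e]
  constructor <;> nlinarith

end MPC

end MinRankPoK

end

open scoped ENNReal

noncomputable section

namespace MinRankPoK

/-! ### The verifier -/

section Tree

variable {lam : ℕ}

/-- At the first level where j departs from i, the walk to j passes through the sibling recorded on
the path. -/
theorem recover_siblings (G : Seed lam → Seed lam × Seed lam) :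
    ∀ (d : ℕ) (i j : Fin d → Bool) (s : Seed lam), j ≠ i →
      recover G d i (siblings G d i s) j = walk G d j s
  | 0, i, j, s, h => absurd (Subsingleton.elim j i) h
  | d + 1, i, j, s, h => by
    rw [recover, siblings, walk]
    split_ifs with h0
    · rw [Fin.tail_cons, h0]
      refine recover_siblings G d _ _ _ fun ht => h ?_
      rw [← Fin.cons_self_tail j, ← Fin.cons_self_tail i, h0, ht]
    · rw [Fin.cons_zero]
      have : (!(i 0)) = j 0 := by cases h1 : i 0 <;> cases h2 : j 0 <;> simp_all
      rw [this]

end Tree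

/-! ### The verifier as a recomputation from the response, and completeness -/

section Verifier

variable {lam : ℕ} {S : Params lam} (P : Prims S)

/-- The shares determined by a committed state. -/
def msgShare : Msg S → Share S
  | Sum.inl s => P.prgShare s
  | Sum.inr (s, aux) => (aux.1, aux.2.1, P.prgLast s, aux.2.2)

theorem msgShare_leafState (seed : Seed lam) (aux : Aux S) (j : Leaf S) :
    msgShare P (leafState seed aux j) = leafShare P seed aux j := by
  unfold leafState leafShare
  split_ifs <;> rfl

/-- The seed and the commitment tape of the leaf `j` recomputed by the verifier. -/
def vSeed (i : Leaf S) (path : Fin S.D → Seed lam) (j : Leaf S) : Seed lam × Rho S :=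
  P.prgLeaf (recover P.prgNode S.D i path j)

/-- The opening of the leaf `j` recomputed by the verifier. -/
def vOpen (i : Leaf S) (rsp : Rsp S) (j : Leaf S) : Msg S × Rho S :=
  (leafState (vSeed P i rsp.2.2.1 j).1 rsp.2.2.2 j, (vSeed P i rsp.2.2.1 j).2)

/-- The commitments recomputed by the verifier. -/
def vCmt (i : Leaf S) (rsp : Rsp S) (j : Leaf S) : Cmt S :=
  if j = i then rsp.1 else P.com (vOpen P i rsp j)

/-- The shares of the leaf `j` recomputed by the verifier. -/
def vShare (i : Leaf S) (rsp : Rsp S) (j : Leaf S) : Share S :=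
  leafShare P (vSeed P i rsp.2.2.1 j).1 rsp.2.2.2 j

/-- The broadcast recomputed by the verifier. -/
def vBroadcast (M : Inst S) (ch : Ch1 S) (i : Leaf S) (rsp : Rsp S) : Fin S.D → Broadcast S :=
  checkDim M ch i rsp.2.1 (vShare P i rsp)

def vDigests (M : Inst S) (ch : Ch1 S) (i : Leaf S) (rsp : Rsp S) : Fin S.D → Digest S :=
  fun d => P.hash (Sum.inr (Sum.inl (vBroadcast P M ch i rsp d)))

/-- The transcript with the digests recomputed by the verifier. -/
def recompute (M : Inst S) (ch : Ch1 S) (i : Leaf S) (rsp : Rsp S) : Transcript S :=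
  (P.hash (Sum.inl (vCmt P i rsp)), ch, P.hash (Sum.inr (Sum.inr (vDigests P M ch i rsp))), i, rsp)

/-- The test v = 0 is void as an explicit condition, because the verifier chooses the missing share
to satisfy it. Its force lies in the digest h_1. -/
theorem accepts_iff (M : Inst S) (h0 : Digest S) (ch : Ch1 S) (h1 : Digest S) (i : Leaf S)
    (rsp : Rsp S) :
    Accepts P M (h0, ch, h1, i, rsp) ↔
      h0 = P.hash (Sum.inl (vCmt P i rsp)) ∧
      (∀ d d', (vBroadcast P M ch i rsp d false).1 + (vBroadcast P M ch i rsp d true).1 =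
        (vBroadcast P M ch i rsp d' false).1 + (vBroadcast P M ch i rsp d' true).1) ∧
      h1 = P.hash (Sum.inr (Sum.inr (vDigests P M ch i rsp))) := by
  obtain ⟨c, al, path, aux⟩ := rsp
  constructor
  · rintro ⟨h, -, h', h''⟩
    exact ⟨h, h', h''⟩
  · rintro ⟨h, h', h''⟩
    exact ⟨h, fun d => checkDim_v _ _ _ _ _ _, h', h''⟩

/-- The second response of the honest prover. -/
def honestRsp (M : Inst S) (x : Fin S.k → S.Fq) (root : Seed lam) (ch : Ch1 S) (i : Leaf S) :
    Rsp S :=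
  (honestTranscript P M x root ch i).2.2.2.2

/-- The last leaf complements the other shares of x, β and c, while a is whatever the seeds produce.
Only the relation c = -⟨a, β⟩ matters later. -/
theorem aggregate_honest (M : Inst S) (x : Fin S.k → S.Fq) (root : Seed lam) :
    ∃ a : Fin S.r → S.Fqme,
      aggregate (fun j => leafShare P (leafSeed P root j).1 (honestAux P M x root) j)
        Finset.univ = (x, beta M x, a,
          -(∑ l, a l * algebraMap S.Fqm S.Fqme (beta M x l))) := by
  set rest := ∑ i ∈ Finset.univ.erase (lastLeaf S), P.prgShare (leafSeed P root i).1 with hrest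
  refine ⟨rest.2.2.1 + P.prgLast (leafSeed P root (lastLeaf S)).1, ?_⟩
  have : aggregate (fun j => leafShare P (leafSeed P root j).1 (honestAux P M x root) j)
      Finset.univ = rest + leafShare P (leafSeed P root (lastLeaf S)).1 (honestAux P M x root)
        (lastLeaf S) := by
    rw [aggregate, ← Finset.sum_erase_add _ _ (Finset.mem_univ (lastLeaf S)), hrest]
    congr 1
    refine Finset.sum_congr rfl fun j hj => ?_
    simp [leafShare, Finset.ne_of_mem_erase hj]
  rw [this]
  simp only [leafShare, if_true, honestAux, ← hrest]
  refine Prod.ext ?_ (Prod.ext ?_ (Prod.ext ?_ ?_)) <;> simp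

theorem totalV_honest {M : Inst S} {x : Fin S.k → S.Fq} (h : IsSolution M x) (root : Seed lam)
    (ch : Ch1 S) :
    totalV M ch (aggregate (fun j => leafShare P (leafSeed P root j).1 (honestAux P M x root) j)
      Finset.univ) = 0 := by
  obtain ⟨a, ha⟩ := aggregate_honest P M x root
  rw [ha, totalV_eq]
  simp [linMap_beta h]

theorem vSeed_honest (M : Inst S) (x : Fin S.k → S.Fq) (root : Seed lam) (ch : Ch1 S)
    (i j : Leaf S) (hj : j ≠ i) :
    vSeed P i (honestRsp P M x root ch i).2.2.1 j = leafSeed P root j := by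
  simp only [vSeed, honestRsp, honestTranscript, leafSeed]
  rw [recover_siblings _ _ _ _ _ hj]

theorem vShare_honest (M : Inst S) (x : Fin S.k → S.Fq) (root : Seed lam) (ch : Ch1 S)
    (i j : Leaf S) (hj : j ≠ i) :
    vShare P i (honestRsp P M x root ch i) j =
      leafShare P (leafSeed P root j).1 (honestAux P M x root) j := by
  rw [vShare, vSeed_honest P M x root ch i j hj]
  unfold leafShare
  split_ifs with h
  · have : i ≠ lastLeaf S := fun h' => hj (h.trans h'.symm)
    simp [honestRsp, honestTranscript, this]
  · rfl

/-- Since v vanishes, the forced share of the hidden leaf is the true one, so both digests can be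
computed from the response without the witness. This serves completeness and also reduces
zero-knowledge to the response. -/
theorem honestTranscript_eq {M : Inst S} {x : Fin S.k → S.Fq} (h : IsSolution M x)
    (root : Seed lam) (ch : Ch1 S) (i : Leaf S) :
    honestTranscript P M x root ch i = recompute P M ch i (honestRsp P M x root ch i) := by
  have hc : vCmt P i (honestRsp P M x root ch i) = fun j =>
      P.com (leafState (leafSeed P root j).1 (honestAux P M x root) j, (leafSeed P root j).2) := by
    funext j
    unfold vCmt
    split_ifs with hj
    · subst hj
      rfl
    · rw [vOpen, vSeed_honest P M x root ch i j hj]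
      congr 2
      unfold leafState
      split_ifs with hl
      · have : i ≠ lastLeaf S := fun h' => hj (hl.trans h'.symm)
        simp [honestRsp, honestTranscript, this]
      · rfl
  have hb : vBroadcast P M ch i (honestRsp P M x root ch i) = execDim M ch fun j =>
      leafShare P (leafSeed P root j).1 (honestAux P M x root) j := by
    funext d
    rw [vBroadcast, checkDim_congr M ch i _ (fun j hj => vShare_honest P M x root ch i j hj)]
    exact checkDim_honest M ch i _ (totalV_honest P h root ch) d
  unfold recompute
  rw [hc]
  unfold vDigests
  rw [hb]
  rfl

theorem accepts_honest {M : Inst S} {x : Fin S.k → S.Fq} (h : IsSolution M x)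
    (root : Seed lam) (ch : Ch1 S) (i : Leaf S) :
    Accepts P M (honestTranscript P M x root ch i) := by
  rw [honestTranscript_eq P h, recompute, accepts_iff]
  refine ⟨rfl, fun d d' => ?_, rfl⟩
  have hb : ∀ d, vBroadcast P M ch i (honestRsp P M x root ch i) d = execDim M ch (fun j =>
      leafShare P (leafSeed P root j).1 (honestAux P M x root) j) d := fun d => by
    rw [vBroadcast, checkDim_congr M ch i _ (fun j hj => vShare_honest P M x root ch i j hj)]
    exact checkDim_honest M ch i _ (totalV_honest P h root ch) d
  rw [hb, hb, execDim_alpha, execDim_alpha]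

theorem completeness {M : Inst S} {x : Fin S.k → S.Fq} (h : IsSolution M x) :
    (realDist P M x).toOuterMeasure {T | Accepts P M T} = 1 := by
  rw [PMF.toOuterMeasure_apply_eq_one_iff]
  intro T hT
  simp only [realDist, PMF.mem_support_bind_iff, PMF.mem_support_map_iff] at hT
  obtain ⟨root, -, ch, -, i, -, rfl⟩ := hT
  exact accepts_honest P h root ch i

end Verifier

end MinRankPoK

end

open scoped ENNReal

noncomputable section

namespace MinRankPoK

/-! ### Accepting sets and inconsistent views

For a fixed tape of the prover, every accepted pair of a challenge and a hidden leaf comes with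
commitments and with opened messages of all leaves but the hidden one. -/

section Views

/-- A lower bound for the success probability of independent trials of total rate `x`. -/
def gain (R x : ℝ) : ℝ := R * x / (1 + R * x)

theorem gain_nonneg {R x : ℝ} (hR : 0 ≤ R) (hx : 0 ≤ x) : 0 ≤ gain R x := by
  unfold gain; positivity

/-- Concavity of the gain on the chord from 0 to t, combined with monotonicity. -/
theorem gain_mul_le {R x t θ : ℝ} (hR : 0 ≤ R) (ht : 0 ≤ t) (hx : 0 ≤ x) (hθ : θ ≤ 1)
    (h : θ * t ≤ x) : θ * gain R t ≤ gain R x := by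
  rcases le_total θ 0 with h0 | h0
  · exact (mul_nonpos_of_nonpos_of_nonneg h0 (gain_nonneg hR ht)).trans (gain_nonneg hR hx)
  · unfold gain
    rw [← mul_div_assoc, div_le_div_iff₀ (by positivity) (by positivity)]
    have h1 : 0 ≤ R * x := by positivity
    have h2 : 0 ≤ R * t := by positivity
    have h3 : θ * (R * t) ≤ R * x := by nlinarith
    have h4 : 0 ≤ (1 - θ) * ((R * t) * (R * x)) :=
      mul_nonneg (by linarith) (mul_nonneg h2 h1)
    nlinarith

theorem gain_mono {R x t : ℝ} (hR : 0 ≤ R) (ht : 0 ≤ t) (h : t ≤ x) : gain R t ≤ gain R x := by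
  simpa using gain_mul_le hR ht (ht.trans h) le_rfl (by simpa using h)

/-- The right side, as a function of w, vanishes at w = t - z, and the left side is its tangent
there. The difference is an explicit nonnegative multiple of a square. Being linear in w, the
tangent can be summed over rows of different lengths. -/
theorem gain_tangent {R w z t : ℝ} (hR : 0 ≤ R) (hw : 0 ≤ w) (hz : 0 ≤ z) (hzt : z ≤ t) :
    (t - z) * R / (1 + R * t) ^ 2 * (w - (t - z)) ≤ w * (gain R (w + z) - gain R t) := by
  have ht : 0 ≤ t := hz.trans hzt
  have h1 : 0 < 1 + R * t := by positivity
  have h2 : 0 < 1 + R * (w + z) := by positivity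
  have e : w * (gain R (w + z) - gain R t) - (t - z) * R / (1 + R * t) ^ 2 * (w - (t - z)) =
      R * (w - (t - z)) ^ 2 * (1 + R * z) / ((1 + R * t) ^ 2 * (1 + R * (w + z))) := by
    unfold gain
    field_simp
    ring
  have : 0 ≤ R * (w - (t - z)) ^ 2 * (1 + R * z) / ((1 + R * t) ^ 2 * (1 + R * (w + z))) := by
    positivity
  linarith

variable {C I δ μ : Type*}

/-- Two views disagree on the commitments or on a leaf opened by both. -/
def Incons (D : C × I → δ) (msg : C × I → I → μ) (T T' : C × I) : Prop :=
  D T ≠ D T' ∨ ∃ j, j ≠ T.2 ∧ j ≠ T'.2 ∧ msg T j ≠ msg T' j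

/-- A view agrees with an assignment of messages to all leaves. -/
def ConsWith (D : C × I → δ) (msg : C × I → I → μ) (d : δ) (sh : I → μ) (T : C × I) : Prop :=
  D T = d ∧ ∀ j, j ≠ T.2 → msg T j = sh j

variable [Fintype C] [Fintype I]

open Classical in
/-- The fraction of all pairs which are accepted and inconsistent with `T`. -/
def inconsDensity (A : Finset (C × I)) (D : C × I → δ) (msg : C × I → I → μ) (T : C × I) : ℝ :=
  ((A.filter (Incons D msg T)).card : ℝ) / (Fintype.card C * Fintype.card I)

theorem inconsDensity_nonneg (A : Finset (C × I)) (D : C × I → δ) (msg : C × I → I → μ)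
    (T : C × I) : 0 ≤ inconsDensity A D msg T := by
  unfold inconsDensity; positivity

open Classical in
theorem card_column_le (A : Finset (C × I)) (j : I) :
    (A.filter fun T => T.2 = j).card ≤ Fintype.card C := by
  have : Set.InjOn Prod.fst ((A.filter fun T => T.2 = j : Finset (C × I)) : Set (C × I)) := by
    rintro ⟨a, b⟩ h1 ⟨a', b'⟩ h2 h
    simp only [Finset.coe_filter, Set.mem_ofPred_eq] at h1 h2
    exact Prod.ext h (h1.2.trans h2.2.symm)
  rw [← Finset.card_image_of_injOn this]
  exact Finset.card_le_univ _

open Classical in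
theorem sum_fiberwise_row (A : Finset (C × I)) (g : C × I → ℝ) :
    ∑ T ∈ A, g T = ∑ ch, ∑ i ∈ Finset.univ.filter (fun i => (ch, i) ∈ A), g (ch, i) := by
  simp_rw [Finset.sum_filter]
  rw [← Fintype.sum_prod_type (f := fun T : C × I => if T ∈ A then g T else 0),
    ← Finset.sum_filter]
  simp

variable [Nonempty C] [Nonempty I] (A : Finset (C × I)) (D : C × I → δ) (msg : C × I → I → μ)

set_option maxHeartbeats 1000000 in
open Classical in
/-- The case that a large part of the accepting set agrees with one assignment. -/
theorem gain_le_of_large {R s p t : ℝ} (hR : 0 ≤ R) (hp0 : 0 ≤ p)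
    (hs : (A.card : ℝ) = s * (Fintype.card C * Fintype.card I))
    (ht : t = s - (1 / (Fintype.card I : ℝ) + p * (1 - 1 / (Fintype.card I : ℝ)))) (htpos : 0 < t)
    (d : δ) (sh : I → μ) (F : Finset C) (hF : (F.card : ℝ) ≤ p * Fintype.card C)
    (u : C × I → ℝ) (hu0 : ∀ T, 0 ≤ u T)
    (hu : ∀ T ∈ A, ConsWith D msg d sh T → T.1 ∉ F →
      (((Finset.univ.filter fun i => (T.1, i) ∈ A ∧ ConsWith D msg d sh (T.1, i)).card : ℝ) - 1) /
        Fintype.card I ≤ u T)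
    (hK : (s - t / 2) * (Fintype.card C * Fintype.card I) <
      (A.filter (ConsWith D msg d sh)).card) :
    ((Fintype.card C : ℝ) * Fintype.card I) * (t * gain R t) ≤
      (∑ T ∈ A, gain R (u T + 2 * inconsDensity A D msg T) : ℝ) := by
  set c : ℝ := (Fintype.card C : ℝ) with hc
  set N : ℝ := (Fintype.card I : ℝ) with hN
  have hcpos : 0 < c := by rw [hc]; exact_mod_cast Fintype.card_pos
  have hNpos : 1 ≤ N := by rw [hN]; exact_mod_cast Fintype.card_pos
  have hcN : 0 < c * N := by positivity
  set v := inconsDensity A D msg with hv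
  have hv0 : ∀ T, 0 ≤ v T := inconsDensity_nonneg A D msg
  set K := A.filter (ConsWith D msg d sh) with hKdef
  set k : ℝ := K.card / (c * N) with hk
  have hKk : (K.card : ℝ) = k * (c * N) := by rw [hk]; field_simp
  set z := s - k with hz
  have hz0 : 0 ≤ z := by
    have : (K.card : ℝ) ≤ A.card := by exact_mod_cast Finset.card_filter_le _ _
    rw [hs, hKk] at this
    have := le_of_mul_le_mul_right this hcN
    linarith
  have hzt : z < t / 2 := by
    rw [hKk] at hK
    have := lt_of_mul_lt_mul_right hK hcN.le
    linarith
  have hN1 : 0 ≤ 1 - 1 / N := by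
    rw [sub_nonneg, div_le_one (by linarith)]; exact hNpos
  have hk1 : t - z ≤ k - 1 / N := by
    rw [ht, hz]; nlinarith [mul_nonneg hp0 hN1]
  -- two consistent views with different hidden leaves
  have hpair : ∀ T ∈ K, ∀ T' ∈ K, T.2 ≠ T'.2 → z ≤ v T + v T' := by
    intro T hT T' hT' hne
    obtain ⟨-, hTd, hTm⟩ := Finset.mem_filter.1 hT
    obtain ⟨-, hTd', hTm'⟩ := Finset.mem_filter.1 hT'
    -- Every leaf is opened by T or by T', so a view consistent with both agrees with the assignment
    -- on all leaves that it opens.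
    have hsub : A \ K ⊆ A.filter (Incons D msg T) ∪ A.filter (Incons D msg T') := by
      intro X hX
      obtain ⟨hXA, hXK⟩ := Finset.mem_sdiff.1 hX
      by_contra hcon
      simp only [Finset.mem_union, Finset.mem_filter, hXA, true_and, not_or] at hcon
      obtain ⟨h1, h2⟩ := hcon
      simp only [Incons, not_or, not_not, not_exists, not_and] at h1 h2
      refine hXK (Finset.mem_filter.2 ⟨hXA, h1.1.symm.trans hTd, fun j hj => ?_⟩)
      by_cases hjT : j = T.2
      · have hjT' : j ≠ T'.2 := fun h => hne (hjT.symm.trans h)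
        rw [← h2.2 j hjT' hj, hTm' j hjT']
      · rw [← h1.2 j hjT hj, hTm j hjT]
    have hcard := (Finset.card_le_card hsub).trans (Finset.card_union_le _ _)
    have h3 : (A \ K).card + K.card = A.card :=
      Finset.card_sdiff_add_card_eq_card (Finset.filter_subset _ _)
    have h4 : (A.card : ℝ) ≤ (A.filter (Incons D msg T)).card +
        (A.filter (Incons D msg T')).card + K.card := by exact_mod_cast (by omega)
    rw [hs, hKk] at h4
    simp only [hv, inconsDensity, ← hc, ← hN]
    rw [← add_div, le_div_iff₀ hcN, hz]
    linarith
  -- Two views of K with v below z/2 must hide the same leaf; c0 is that leaf. It costs each row at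
  -- most one view.
  obtain ⟨c0, hc0⟩ : ∃ c0 : I, ∀ T ∈ K, T.2 ≠ c0 → z ≤ 2 * v T := by
    by_cases h : ∃ T ∈ K, 2 * v T < z
    · obtain ⟨T, hT, hlt⟩ := h
      refine ⟨T.2, fun T' hT' hne => ?_⟩
      have := hpair T' hT' T hT hne
      linarith
    · push Not at h
      exact ⟨Classical.arbitrary I, fun T hT _ => h T hT⟩
  -- A view outside K differs from the assignment in the commitments or at some leaf j. It is
  -- therefore inconsistent with all of K, except perhaps the views hiding j. This leaves v ≥ k -
  -- 1/N ≥ t - z > t/2.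
  have hout : ∀ T ∈ A, T ∉ K → t ≤ 2 * v T := by
    intro T hTA hTK
    have hge : (K.card : ℝ) - c ≤ (A.filter (Incons D msg T)).card := by
      have : ∃ j, ∀ X ∈ K, X.2 ≠ j → Incons D msg T X := by
        by_contra hcon
        push Not at hcon
        refine hTK (Finset.mem_filter.2 ⟨hTA, ?_, fun j hj => ?_⟩)
        · obtain ⟨X, hX, -, h⟩ := hcon (Classical.arbitrary I)
          simp only [Incons, not_or, not_not] at h
          exact h.1.trans (Finset.mem_filter.1 hX).2.1
        · obtain ⟨X, hX, hXj, h⟩ := hcon j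
          simp only [Incons, not_or, not_not, not_exists, not_and] at h
          rw [h.2 j hj hXj.symm, (Finset.mem_filter.1 hX).2.2 j hXj.symm]
      obtain ⟨j, hj⟩ := this
      have hsub : K ⊆ A.filter (Incons D msg T) ∪ K.filter (fun X => X.2 = j) := by
        intro X hX
        by_cases hXj : X.2 = j
        · exact Finset.mem_union_right _ (Finset.mem_filter.2 ⟨hX, hXj⟩)
        · exact Finset.mem_union_left _ (Finset.mem_filter.2
            ⟨(Finset.mem_filter.1 hX).1, hj X hX hXj⟩)
      have h1 := (Finset.card_le_card hsub).trans (Finset.card_union_le _ _)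
      have h2 := card_column_le K j
      rw [sub_le_iff_le_add, hc]
      exact_mod_cast h1.trans (Nat.add_le_add_left h2 _)
    have : k - 1 / N ≤ v T := by
      simp only [hv, inconsDensity, ← hc, ← hN]
      rw [le_div_iff₀ hcN]
      calc (k - 1 / N) * (c * N) = k * (c * N) - c := by field_simp
        _ ≤ _ := by rw [← hKk]; exact hge
    linarith
  -- rows
  let a : C → ℝ := fun ch => (Finset.univ.filter fun i => (ch, i) ∈ K).card
  let n : C → ℝ := fun ch => (Finset.univ.filter fun i => (ch, i) ∈ A).card
  -- In a row outside F, all views of K but possibly the one hiding c0 have gain at least gain(w +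
  -- z): w comes from row trials and z from fresh ones. Accepted views outside K have gain at least
  -- gain(t) by `hout`.
  have hat : ∀ ch ∉ F, (t - z) * R / (1 + R * t) ^ 2 * (max (a ch - 1) 0 - N * (t - z)) +
      (n ch - 1) * gain R t ≤ ∑ i ∈ Finset.univ.filter (fun i => (ch, i) ∈ A),
        gain R (u (ch, i) + 2 * v (ch, i)) := by
    intro ch hch
    set w := max (a ch - 1) 0 / N with hw
    have hw0 : 0 ≤ w := by positivity
    have hNw : max (a ch - 1) 0 = N * w := by rw [hw]; field_simp
    have hsplit : ∑ i ∈ Finset.univ.filter (fun i => (ch, i) ∈ A),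
        gain R (u (ch, i) + 2 * v (ch, i)) =
        ∑ i ∈ Finset.univ.filter (fun i => (ch, i) ∈ K), gain R (u (ch, i) + 2 * v (ch, i)) +
        ∑ i ∈ Finset.univ.filter (fun i => (ch, i) ∈ A ∧ (ch, i) ∉ K),
          gain R (u (ch, i) + 2 * v (ch, i)) := by
      rw [← Finset.sum_filter_add_sum_filter_not _ (fun i => (ch, i) ∈ K), Finset.filter_filter,
        Finset.filter_filter]
      congr 2
      ext i
      simp only [Finset.mem_filter, Finset.mem_univ, true_and, and_iff_right_iff_imp]
      exact fun h => (Finset.mem_filter.1 h).1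
    have hcount : ((Finset.univ.filter fun i => (ch, i) ∈ A ∧ (ch, i) ∉ K).card : ℝ) =
        n ch - a ch := by
      have h := Finset.card_filter_add_card_filter_not
        (s := Finset.univ.filter fun i => (ch, i) ∈ A) (fun i => (ch, i) ∈ K)
      rw [Finset.filter_filter, Finset.filter_filter] at h
      have h' : (Finset.univ.filter fun i => (ch, i) ∈ A ∧ (ch, i) ∈ K) =
          Finset.univ.filter fun i => (ch, i) ∈ K := by
        ext i
        simp only [Finset.mem_filter, Finset.mem_univ, true_and, and_iff_right_iff_imp]
        exact fun h => (Finset.mem_filter.1 h).1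
      rw [h'] at h
      rw [eq_sub_iff_add_eq']
      have h2 : ((Finset.univ.filter fun i => (ch, i) ∈ K).card : ℝ) +
          (Finset.univ.filter fun i => (ch, i) ∈ A ∧ (ch, i) ∉ K).card =
          (Finset.univ.filter fun i => (ch, i) ∈ A).card := by exact_mod_cast h
      exact h2
    have hX : (n ch - a ch) * gain R t ≤
        ∑ i ∈ Finset.univ.filter (fun i => (ch, i) ∈ A ∧ (ch, i) ∉ K),
          gain R (u (ch, i) + 2 * v (ch, i)) := by
      rw [← hcount, ← nsmul_eq_mul]
      refine Finset.card_nsmul_le_sum _ _ _ fun i hi => ?_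
      simp only [Finset.mem_filter, Finset.mem_univ, true_and] at hi
      refine gain_mono hR htpos.le ?_
      have := hout _ hi.1 hi.2
      have := hu0 (ch, i)
      linarith
    have hKs : N * w * gain R (w + z) ≤
        ∑ i ∈ Finset.univ.filter (fun i => (ch, i) ∈ K), gain R (u (ch, i) + 2 * v (ch, i)) := by
      have h1 : max (a ch - 1) 0 ≤
          ((Finset.univ.filter fun i => (ch, i) ∈ K).erase c0).card := by
        refine max_le ?_ (Nat.cast_nonneg _)
        have := Finset.pred_card_le_card_erase (s := Finset.univ.filter fun i => (ch, i) ∈ K)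
          (a := c0)
        have h' : (Finset.univ.filter fun i => (ch, i) ∈ K).card ≤
            ((Finset.univ.filter fun i => (ch, i) ∈ K).erase c0).card + 1 := by omega
        have h2 : ((Finset.univ.filter fun i => (ch, i) ∈ K).card : ℝ) ≤
            ((Finset.univ.filter fun i => (ch, i) ∈ K).erase c0).card + 1 := by exact_mod_cast h'
        exact sub_le_iff_le_add.2 h2
      calc N * w * gain R (w + z)
          ≤ ((Finset.univ.filter fun i => (ch, i) ∈ K).erase c0).card * gain R (w + z) := by
            rw [← hNw]
            exact mul_le_mul_of_nonneg_right h1 (gain_nonneg hR (by positivity))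
        _ ≤ ∑ i ∈ (Finset.univ.filter fun i => (ch, i) ∈ K).erase c0,
            gain R (u (ch, i) + 2 * v (ch, i)) := by
            rw [← nsmul_eq_mul]
            refine Finset.card_nsmul_le_sum _ _ _ fun i hi => ?_
            obtain ⟨hi0, hi⟩ := Finset.mem_erase.1 hi
            simp only [Finset.mem_filter, Finset.mem_univ, true_and] at hi
            refine gain_mono hR (by positivity) ?_
            have e1 := hc0 (ch, i) hi hi0
            have hiA := Finset.mem_filter.1 hi
            have e2 := hu (ch, i) hiA.1 hiA.2 hch
            have e3 : (Finset.univ.filter fun i' => (ch, i') ∈ A ∧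
                ConsWith D msg d sh (ch, i')) = Finset.univ.filter fun i' => (ch, i') ∈ K := by
              ext i'; simp [hKdef]
            rw [e3] at e2
            have e4 : w ≤ u (ch, i) := by
              rw [div_le_iff₀ (by linarith)] at e2
              rw [hw, div_le_iff₀ (by linarith)]
              exact max_le e2 (mul_nonneg (hu0 _) (by linarith))
            linarith
        _ ≤ _ := Finset.sum_le_sum_of_subset_of_nonneg (Finset.erase_subset _ _)
            fun i _ _ => gain_nonneg hR (by have := hu0 (ch, i); have := hv0 (ch, i); linarith)
    rw [hsplit]
    have htan := gain_tangent hR hw0 hz0 (by linarith : z ≤ t)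
    have hle : a ch - 1 ≤ N * w := hNw ▸ le_max_left _ _
    have hg := gain_nonneg hR htpos.le
    rw [hNw]
    have h5 : (n ch - 1) * gain R t ≤ (n ch - a ch) * gain R t + N * w * gain R t := by
      rw [← add_mul]
      exact mul_le_mul_of_nonneg_right (by linarith) hg
    have h6 := mul_le_mul_of_nonneg_left htan (by linarith : 0 ≤ N)
    have h7 : N * ((t - z) * R / (1 + R * t) ^ 2 * (w - (t - z))) =
      (t - z) * R / (1 + R * t) ^ 2 * (N * w - N * (t - z)) := by ring
    have h8 : N * (w * (gain R (w + z) - gain R t)) =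
      N * w * gain R (w + z) - N * w * gain R t := by ring
    linarith
  have hrow0 : ∀ ch, 0 ≤ ∑ i ∈ Finset.univ.filter (fun i => (ch, i) ∈ A),
      gain R (u (ch, i) + 2 * v (ch, i)) := fun ch => Finset.sum_nonneg fun i _ =>
    gain_nonneg hR (by have := hu0 (ch, i); have := hv0 (ch, i); linarith)
  have hFc : (Finset.univ.filter fun ch => ch ∉ F).card + F.card = Fintype.card C := by
    have := Finset.card_filter_add_card_filter_not (s := (Finset.univ : Finset C)) (fun ch => ch ∉ F)
    simpa using this
  have hFcR : ((Finset.univ.filter fun ch => ch ∉ F).card : ℝ) = c - F.card := by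
    rw [eq_sub_iff_add_eq, hc]; exact_mod_cast hFc
  -- One pair is given up in each row outside F and at most N in each row of F. The total loss,
  -- relative to all pairs, is exactly the soundness error. It is applied to A and to K, which leave
  -- the densities t and t - z.
  have hsumrow : ∀ (B : Finset (C × I)), (B.card : ℝ) - c - (N - 1) * (p * c) ≤
      ∑ ch ∈ Finset.univ.filter (fun ch => ch ∉ F),
        (((Finset.univ.filter fun i => (ch, i) ∈ B).card : ℝ) - 1) := by
    intro B
    have h1 : (B.card : ℝ) = ∑ ch, ((Finset.univ.filter fun i => (ch, i) ∈ B).card : ℝ) := by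
      have := sum_fiberwise_row B (fun _ => (1 : ℝ))
      simpa using this
    rw [Finset.sum_sub_distrib, Finset.sum_const, nsmul_eq_mul, mul_one, hFcR]
    rw [← Finset.sum_filter_add_sum_filter_not _ (fun ch => ch ∉ F)] at h1
    have h2 : ∑ ch ∈ Finset.univ.filter (fun ch => ¬ ch ∉ F),
        ((Finset.univ.filter fun i => (ch, i) ∈ B).card : ℝ) ≤ F.card * N := by
      have : (Finset.univ.filter fun ch => ¬ ch ∉ F) = F := by ext; simp
      rw [this, ← nsmul_eq_mul]
      refine Finset.sum_le_card_nsmul _ _ _ fun ch _ => ?_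
      rw [hN]; exact_mod_cast Finset.card_le_univ _
    have h3 := mul_le_mul_of_nonneg_left hF (by linarith : 0 ≤ N - 1)
    have h4 : (N - 1) * (F.card : ℝ) = F.card * N - F.card := by ring
    linarith
  have hγ : 0 ≤ (t - z) * R / (1 + R * t) ^ 2 :=
    div_nonneg (mul_nonneg (by linarith) hR) (by positivity)
  have hεN : c + (N - 1) * (p * c) = c * N * (s - t) := by
    rw [ht]; field_simp; ring
  calc c * N * (t * gain R t)
      ≤ (t - z) * R / (1 + R * t) ^ 2 * (∑ ch ∈ Finset.univ.filter (fun ch => ch ∉ F),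
          max (a ch - 1) 0 - c * (N * (t - z))) +
        (∑ ch ∈ Finset.univ.filter (fun ch => ch ∉ F), (n ch - 1)) * gain R t := by
        have e1 := hsumrow K
        have e2 := hsumrow A
        have e3 : ∑ ch ∈ Finset.univ.filter (fun ch => ch ∉ F), (a ch - 1) ≤
            ∑ ch ∈ Finset.univ.filter (fun ch => ch ∉ F), max (a ch - 1) 0 :=
          Finset.sum_le_sum fun ch _ => le_max_left _ _
        -- On average over the rows w is at least t - z, the point of tangency, so the linear term
        -- is nonnegative and can be dropped.
        have e4 : 0 ≤ ∑ ch ∈ Finset.univ.filter (fun ch => ch ∉ F), max (a ch - 1) 0 -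
            c * (N * (t - z)) := by
          have : c * (N * (t - z)) = K.card - c - (N - 1) * (p * c) := by
            rw [sub_sub, hεN, hKk, hz]; ring
          rw [this]
          linarith
        have e5 : c * N * t ≤ ∑ ch ∈ Finset.univ.filter (fun ch => ch ∉ F), (n ch - 1) := by
          refine le_trans (le_of_eq ?_) e2
          rw [sub_sub, hεN, hs]; ring
        have e6 := mul_le_mul_of_nonneg_right e5 (gain_nonneg hR htpos.le)
        have e7 := mul_nonneg hγ e4
        linarith
    _ ≤ ∑ ch ∈ Finset.univ.filter (fun ch => ch ∉ F),
          ((t - z) * R / (1 + R * t) ^ 2 * (max (a ch - 1) 0 - N * (t - z)) +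
            (n ch - 1) * gain R t) := by
        rw [Finset.sum_add_distrib, ← Finset.sum_mul, ← Finset.mul_sum,
          Finset.sum_sub_distrib (fun ch => max (a ch - 1) 0)]
        refine add_le_add (mul_le_mul_of_nonneg_left (sub_le_sub_left ?_ _) hγ) le_rfl
        rw [Finset.sum_const, nsmul_eq_mul, hFcR]
        refine mul_le_mul_of_nonneg_right (by linarith [Nat.cast_nonneg (α := ℝ) F.card]) ?_
        exact mul_nonneg (by linarith) (by linarith)
    _ ≤ ∑ ch ∈ Finset.univ.filter (fun ch => ch ∉ F),
          ∑ i ∈ Finset.univ.filter (fun i => (ch, i) ∈ A),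
            gain R (u (ch, i) + 2 * v (ch, i)) :=
        Finset.sum_le_sum fun ch hch => hat ch (Finset.mem_filter.1 hch).2
    _ ≤ ∑ ch, ∑ i ∈ Finset.univ.filter (fun i => (ch, i) ∈ A),
            gain R (u (ch, i) + 2 * v (ch, i)) :=
        Finset.sum_le_sum_of_subset_of_nonneg (Finset.subset_univ _) fun ch _ _ => hrow0 ch
    _ = _ := (sum_fiberwise_row A fun T => gain R (u T + 2 * v T)).symm

end Views

end MinRankPoK

end

open scoped ENNReal

noncomputable section

namespace MinRankPoK

/-! ### Widespread inconsistency, and the combined counting inequality -/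

section Views

variable {C I δ μ : Type*} [Fintype C] [Fintype I] [Nonempty C] [Nonempty I]
  (A : Finset (C × I)) (D : C × I → δ) (msg : C × I → I → μ)

set_option maxHeartbeats 1000000 in
open Classical in
/-- The case that no assignment agrees with a large part of the accepting set. -/
theorem gain_le_of_small {R s t : ℝ} (hR : 0 ≤ R)
    (hs : (A.card : ℝ) = s * (Fintype.card C * Fintype.card I))
    (ht : t ≤ s - 1 / (Fintype.card I : ℝ)) (htpos : 0 < t)
    (hK : ∀ d sh, ((A.filter (ConsWith D msg d sh)).card : ℝ) ≤
      (s - t / 2) * (Fintype.card C * Fintype.card I)) :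
    ((Fintype.card C : ℝ) * Fintype.card I) * (t * gain R t) ≤
      (∑ T ∈ A, gain R (2 * inconsDensity A D msg T) : ℝ) := by
  set c : ℝ := (Fintype.card C : ℝ) with hc
  set N : ℝ := (Fintype.card I : ℝ) with hN
  have hcpos : 0 < c := by rw [hc]; exact_mod_cast Fintype.card_pos
  have hNpos : 1 ≤ N := by rw [hN]; exact_mod_cast Fintype.card_pos
  have hcN : 0 < c * N := by positivity
  set v := inconsDensity A D msg with hv
  have hv0 : ∀ T, 0 ≤ v T := inconsDensity_nonneg A D msg
  have hvc : ∀ T, ((A.filter (Incons D msg T)).card : ℝ) = v T * (c * N) := fun T => by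
    simp only [hv, inconsDensity, ← hc, ← hN]
    field_simp
  have hg := gain_nonneg hR htpos.le
  have hN0 : 0 < 1 / N := by positivity
  have hAne : A.Nonempty := by
    rw [← Finset.card_pos]
    have : (0 : ℝ) < A.card := by rw [hs]; exact mul_pos (by linarith) hcN
    exact_mod_cast this
  -- A least inconsistent view serves as reference. If even T0 has v ≥ t/2, then fresh trials alone
  -- suffice everywhere.
  obtain ⟨T0, hT0, hmin⟩ := A.exists_min_image v hAne
  set v0 := v T0 with hv0def
  rcases le_or_gt (t / 2) v0 with hbig | hsmall
  · have : (A.card : ℝ) * gain R t ≤ ∑ T ∈ A, gain R (2 * v T) := by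
      rw [← nsmul_eq_mul]
      refine Finset.card_nsmul_le_sum _ _ _ fun T hT => gain_mono hR htpos.le ?_
      have := hmin T hT
      linarith
    refine le_trans ?_ this
    rw [hs, ← mul_assoc, mul_comm (c * N) t]
    exact mul_le_mul_of_nonneg_right
      (mul_le_mul_of_nonneg_right (by linarith) hcN.le) hg
  -- views which disagree with `T0` exactly on the leaf `i`
  let L : I → Finset (C × I) := fun i => A.filter fun X => X.2 ≠ i ∧ D X = D T0 ∧
    msg X i ≠ msg T0 i ∧ ∀ j, j ≠ i → j ≠ T0.2 → j ≠ X.2 → msg X j = msg T0 j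
  -- For leaves opened by T0 these sets are disjoint, and all their members are inconsistent with
  -- T0.
  have hLsum : ∑ i ∈ Finset.univ.erase T0.2, ((L i).card : ℝ) ≤ v0 * (c * N) := by
    rw [hv0def, ← hvc]
    have hdis : ∀ i ∈ Finset.univ.erase T0.2, ∀ i' ∈ Finset.univ.erase T0.2, i ≠ i' →
        Disjoint (L i) (L i') := by
      intro i hi i' hi' hne
      rw [Finset.disjoint_left]
      intro X hX hX'
      obtain ⟨-, h1, -, h3, -⟩ := Finset.mem_filter.1 hX
      obtain ⟨-, -, -, -, h4⟩ := Finset.mem_filter.1 hX'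
      exact h3 (h4 i hne (Finset.ne_of_mem_erase hi) h1.symm)
    have : ((Finset.univ.erase T0.2).biUnion L).card ≤ (A.filter (Incons D msg T0)).card := by
      refine Finset.card_le_card fun X hX => ?_
      obtain ⟨i, hi, hX⟩ := Finset.mem_biUnion.1 hX
      obtain ⟨hXA, h1, -, h3, -⟩ := Finset.mem_filter.1 hX
      exact Finset.mem_filter.2
        ⟨hXA, Or.inr ⟨i, Finset.ne_of_mem_erase hi, h1.symm, h3.symm⟩⟩
    rw [Finset.card_biUnion hdis] at this
    exact_mod_cast this
  let ell : I → ℝ := fun i => (L i).card / (c * N)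
  have hell0 : ∀ i, 0 ≤ ell i := fun i => by positivity
  have hellsum : ∑ i ∈ Finset.univ.erase T0.2, ell i ≤ v0 := by
    simp only [ell]
    rw [← Finset.sum_div, div_le_iff₀ hcN]
    exact hLsum
  -- A view consistent with both T0 and T has to hide the leaf on which they disagree. Such views
  -- have density at most 1/N, so v0 + v(T) ≥ s - 1/N ≥ t, where v0 < t/2.
  have hinc : ∀ T ∈ A, Incons D msg T0 T → t / 2 ≤ v T := by
    intro T hT hI
    have hex : ∃ j, ∀ X ∈ A, ¬ Incons D msg T0 X → ¬ Incons D msg T X → X.2 = j := by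
      rcases hI with hD | ⟨j, hj0, hj, hne⟩
      · refine ⟨Classical.arbitrary I, fun X _ h1 h2 => ?_⟩
        simp only [Incons, not_or, not_not] at h1 h2
        exact absurd (h1.1.trans h2.1.symm) hD
      · refine ⟨j, fun X _ h1 h2 => ?_⟩
        by_contra hX
        simp only [Incons, not_or, not_not, not_exists, not_and] at h1 h2
        exact hne ((h1.2 j hj0 (Ne.symm hX)).trans (h2.2 j hj (Ne.symm hX)).symm)
    obtain ⟨j, hj⟩ := hex
    have hsub : A ⊆ (A.filter (Incons D msg T0) ∪ A.filter (Incons D msg T)) ∪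
        A.filter fun X => X.2 = j := by
      intro X hX
      by_contra hcon
      simp only [Finset.mem_union, Finset.mem_filter, hX, true_and, not_or] at hcon
      exact hcon.2 (hj X hX hcon.1.1 hcon.1.2)
    have h1 := (Finset.card_le_card hsub).trans ((Finset.card_union_le _ _).trans
      (Nat.add_le_add (Finset.card_union_le _ _) (card_column_le A j)))
    have h2 : (A.card : ℝ) ≤ (A.filter (Incons D msg T0)).card +
        (A.filter (Incons D msg T)).card + c := by rw [hc]; exact_mod_cast h1
    rw [hs, hvc, hvc] at h2
    have h3 : (s - 1 / N - v0) * (c * N) ≤ v T * (c * N) := by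
      have : (s - 1 / N - v0) * (c * N) = s * (c * N) - c - v0 * (c * N) := by field_simp
      rw [this]
      linarith
    have := le_of_mul_le_mul_right h3 hcN
    linarith
  have hcons : ∀ T ∈ A, ¬ Incons D msg T0 T → T.2 ≠ T0.2 → t / 2 - ell T.2 ≤ v T := by
    intro T hT hI hne
    simp only [Incons, not_or, not_not, not_exists, not_and] at hI
    -- T completed at its hidden leaf by the message in T0. A view consistent with T agrees with
    -- this assignment or belongs to L of that leaf; by hypothesis at most density s - t/2 does the
    -- former.
    set sh : I → μ := fun j => if j = T.2 then msg T0 j else msg T j with hsh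
    have hsub : A ⊆ (A.filter (Incons D msg T) ∪ A.filter (ConsWith D msg (D T) sh)) ∪ L T.2 := by
      intro X hX
      by_contra hcon
      simp only [Finset.mem_union, hX, Finset.mem_filter, true_and, not_or] at hcon
      obtain ⟨⟨h1, h2⟩, h3⟩ := hcon
      simp only [Incons, not_or, not_not, not_exists, not_and] at h1
      have h4 : ∀ j, j ≠ T.2 → j ≠ X.2 → msg X j = msg T j := fun j hj hjX =>
        (h1.2 j hj hjX).symm
      by_cases h5 : X.2 ≠ T.2 ∧ msg X T.2 ≠ msg T0 T.2
      · refine h3 (Finset.mem_filter.2 ⟨hX, h5.1, h1.1.symm.trans hI.1.symm, h5.2, ?_⟩)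
        intro j hj hj0 hjX
        rw [h4 j hj hjX, hI.2 j hj0 hj]
      · refine h2 ⟨h1.1.symm, fun j hjX => ?_⟩
        by_cases hj : j = T.2
        · subst hj
          simp only [hsh, if_true]
          by_contra h6
          exact h5 ⟨Ne.symm hjX, h6⟩
        · simp only [hsh, if_neg hj]
          exact h4 j hj hjX
    have h1 := (Finset.card_le_card hsub).trans ((Finset.card_union_le _ _).trans
      (Nat.add_le_add_right (Finset.card_union_le _ _) _))
    have h2 : (A.card : ℝ) ≤ (A.filter (Incons D msg T)).card +
        (A.filter (ConsWith D msg (D T) sh)).card + (L T.2).card := by exact_mod_cast h1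
    have h3 := hK (D T) sh
    have h4 : ((L T.2).card : ℝ) = ell T.2 * (c * N) := by simp only [ell]; field_simp
    rw [hs, hvc, h4] at h2
    refine le_of_mul_le_mul_right ?_ hcN
    linarith
  -- The relative shortfall of 2v below t among views hiding leaf i. These sum to at most one
  -- because the ℓ_i sum to at most v0, so the total loss is one column of pairs. Its density 1/N is
  -- covered by s - t.
  let loss : I → ℝ := fun i => if i = T0.2 then 1 - 2 * v0 / t else 2 * ell i / t
  have hloss0 : ∀ i, 0 ≤ loss i := fun i => by
    simp only [loss]
    split_ifs
    · rw [sub_nonneg, div_le_one htpos]; linarith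
    · have := hell0 i; positivity
  have hlosssum : ∑ i, loss i ≤ 1 := by
    rw [← Finset.sum_erase_add _ _ (Finset.mem_univ T0.2)]
    have : ∑ i ∈ Finset.univ.erase T0.2, loss i =
        2 / t * ∑ i ∈ Finset.univ.erase T0.2, ell i := by
      rw [Finset.mul_sum]
      refine Finset.sum_congr rfl fun i hi => ?_
      simp only [loss, if_neg (Finset.ne_of_mem_erase hi)]
      ring
    rw [this]
    simp only [loss, if_true]
    have := mul_le_mul_of_nonneg_left hellsum (by positivity : 0 ≤ 2 / t)
    have e : 2 / t * v0 = 2 * v0 / t := by ring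
    linarith
  have hpoint : ∀ T ∈ A, (1 - loss T.2) * gain R t ≤ gain R (2 * v T) := by
    intro T hT
    refine gain_mul_le hR htpos.le (by have := hv0 T; linarith) (by linarith [hloss0 T.2]) ?_
    by_cases hI : Incons D msg T0 T
    · have h1 := hinc T hT hI
      have h2 : (1 - loss T.2) * t ≤ 1 * t :=
        mul_le_mul_of_nonneg_right (by linarith [hloss0 T.2]) htpos.le
      linarith
    · by_cases h0 : T.2 = T0.2
      · simp only [loss, if_pos h0]
        have := hmin T hT
        have e : (1 - (1 - 2 * v0 / t)) * t = 2 * v0 := by field_simp; ring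
        linarith
      · simp only [loss, if_neg h0]
        have := hcons T hT hI h0
        have e : (1 - 2 * ell T.2 / t) * t = t - 2 * ell T.2 := by field_simp
        linarith
  calc c * N * (t * gain R t) ≤ ((A.card : ℝ) - c) * gain R t := by
        rw [hs, ← mul_assoc]
        refine mul_le_mul_of_nonneg_right ?_ hg
        have := mul_le_mul_of_nonneg_left ht hcN.le
        have e : c * N * (s - 1 / N) = s * (c * N) - c := by field_simp
        linarith
    _ ≤ ∑ T ∈ A, (1 - loss T.2) * gain R t := by
        rw [← Finset.sum_mul, Finset.sum_sub_distrib, Finset.sum_const, nsmul_eq_mul, mul_one]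
        refine mul_le_mul_of_nonneg_right (sub_le_sub_left ?_ _) hg
        calc ∑ T ∈ A, loss T.2 ≤ ∑ T : C × I, loss T.2 :=
              Finset.sum_le_sum_of_subset_of_nonneg (Finset.subset_univ _) fun T _ _ => hloss0 _
          _ = c * ∑ i, loss i := by
              rw [Fintype.sum_prod_type]
              simp [hc]
          _ ≤ c := by nlinarith
    _ ≤ _ := Finset.sum_le_sum hpoint

open Classical in
/-- The average success probability of the trials after an accepting run. -/
theorem gain_le_sum {R s p t : ℝ} (hR : 0 ≤ R) (hp0 : 0 ≤ p)
    (hs : (A.card : ℝ) = s * (Fintype.card C * Fintype.card I))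
    (ht : t = s - (1 / (Fintype.card I : ℝ) + p * (1 - 1 / (Fintype.card I : ℝ)))) (htpos : 0 < t)
    (F : δ → (I → μ) → Finset C) (hF : ∀ d sh, ((F d sh).card : ℝ) ≤ p * Fintype.card C)
    (u v : C × I → ℝ) (hu0 : ∀ T, 0 ≤ u T) (hv : ∀ T ∈ A, inconsDensity A D msg T ≤ v T)
    (hu : ∀ T ∈ A, ∀ d sh, ConsWith D msg d sh T → T.1 ∉ F d sh →
      (((Finset.univ.filter fun i => (T.1, i) ∈ A ∧ ConsWith D msg d sh (T.1, i)).card : ℝ) - 1) /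
        Fintype.card I ≤ u T) :
    ((Fintype.card C : ℝ) * Fintype.card I) * (t * gain R t) ≤
      (∑ T ∈ A, gain R (u T + 2 * v T) : ℝ) := by
  by_cases hK : ∃ d sh, (s - t / 2) * (Fintype.card C * Fintype.card I) <
      (A.filter (ConsWith D msg d sh)).card
  · obtain ⟨d, sh, hK⟩ := hK
    refine (gain_le_of_large A D msg hR hp0 hs ht htpos d sh (F d sh) (hF d sh) u hu0
      (fun T hT => hu T hT d sh) hK).trans (Finset.sum_le_sum fun T hT => gain_mono hR ?_ ?_)
    · have := inconsDensity_nonneg A D msg T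
      have := hu0 T
      linarith
    · have := hv T hT
      linarith
  · push Not at hK
    have hN : (1 : ℝ) ≤ Fintype.card I := by exact_mod_cast Fintype.card_pos
    have hN1 : 0 ≤ 1 - 1 / (Fintype.card I : ℝ) := by
      rw [sub_nonneg, div_le_one (by linarith)]; exact hN
    refine (gain_le_of_small A D msg hR hs ?_ htpos hK).trans
      (Finset.sum_le_sum fun T hT => gain_mono hR ?_ ?_)
    · rw [ht]
      have := mul_nonneg hp0 hN1
      linarith
    · have := inconsDensity_nonneg A D msg T
      linarith
    · have := hv T hT
      have := hu0 T
      linarith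

end Views

end MinRankPoK

end

open scoped ENNReal

noncomputable section

namespace MinRankPoK

/-! ### Polynomial-time programs -/

section Size

variable {lam : ℕ} (S : Params lam)

theorem Params.N_pos : 1 ≤ S.N := Nat.one_le_two_pow

theorem Params.m_pos : 1 ≤ S.m := by
  have : Nonempty (Fin S.m) := S.basis.index_nonempty
  exact Fin.pos_iff_nonempty.2 this

theorem Params.eta_pos : 1 ≤ S.η := by
  have : Nonempty (Fin S.η) := S.basisExt.index_nonempty
  exact Fin.pos_iff_nonempty.2 this

theorem Params.clog_pos : 1 ≤ Nat.clog 2 S.q :=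
  Nat.clog_pos (by norm_num) Fintype.one_lt_card

theorem Params.four_le_size : 4 ≤ S.size := by
  have := S.N_pos
  have := S.m_pos
  have := S.eta_pos
  have := S.clog_pos
  unfold Params.size
  omega

theorem Params.D_le_size : S.D ≤ S.size := by
  have : S.D < 2 ^ S.D := Nat.lt_two_pow_self
  unfold Params.size Params.N
  omega

theorem Params.card_leaf : Fintype.card (Leaf S) = S.N := by
  simp [Leaf, Params.N]

/-- Types with at most `size` elements. -/
class Small (S : Params lam) (ι : Type) [Fintype ι] : Prop where
  card_le : Fintype.card ι ≤ S.size

instance : Small S (Leaf S) := ⟨by rw [S.card_leaf]; unfold Params.size; omega⟩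
instance : Small S (Fin S.D) := ⟨by simpa using S.D_le_size⟩
instance : Small S (Fin S.m) := ⟨by simp only [Fintype.card_fin]; unfold Params.size; omega⟩
instance : Small S (Fin S.n) := ⟨by simp only [Fintype.card_fin]; unfold Params.size; omega⟩
instance : Small S (Fin S.k) := ⟨by simp only [Fintype.card_fin]; unfold Params.size; omega⟩
instance : Small S (Fin S.r) := ⟨by simp only [Fintype.card_fin]; unfold Params.size; omega⟩
instance : Small S (Fin S.η) := ⟨by simp only [Fintype.card_fin]; unfold Params.size; omega⟩
instance : Small S (Fin lam) := ⟨by simp only [Fintype.card_fin]; unfold Params.size; omega⟩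
instance : Small S (Fin S.lenCmt) := ⟨by simp only [Fintype.card_fin]; unfold Params.size; omega⟩
instance : Small S Bool := ⟨by simpa using (by norm_num : 2 ≤ 4).trans S.four_le_size⟩

end Size

/-! ### Cost calculus for straight-line programs -/

section Programs

variable {lam : ℕ} {S : Params lam}

/-- `f` is computed by a program of size at most `c`. -/
def CostLE (S : Params lam) {α β : Type} (f : Prims S → α → β) (c : ℕ) : Prop :=
  ∃ s ≤ c, Computes S f s

/-- `f` is computed by a program of size at most `size ^ e`. -/
def PC (S : Params lam) (e : ℕ) {α β : Type} (f : Prims S → α → β) : Prop :=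
  CostLE S f (S.size ^ e)

theorem CostLE.mono {α β : Type} {f : Prims S → α → β} {c d : ℕ} (h : CostLE S f c) (hcd : c ≤ d) :
    CostLE S f d :=
  let ⟨s, hs, hf⟩ := h
  ⟨s, hs.trans hcd, hf⟩

theorem CostLE.comp {α β γ : Type} {f : Prims S → α → β} {g : Prims S → β → γ} {c d : ℕ}
    (hf : CostLE S f c) (hg : CostLE S g d) : CostLE S (fun P a => g P (f P a)) (c + d) :=
  let ⟨_, hs, hf⟩ := hf
  let ⟨_, ht, hg⟩ := hg
  ⟨_, Nat.add_le_add hs ht, hf.comp hg⟩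

theorem CostLE.pair {α β γ : Type} {f : Prims S → α → β} {g : Prims S → α → γ} {c d : ℕ}
    (hf : CostLE S f c) (hg : CostLE S g d) : CostLE S (fun P a => (f P a, g P a)) (c + d + 1) :=
  let ⟨_, hs, hf⟩ := hf
  let ⟨_, ht, hg⟩ := hg
  ⟨_, Nat.add_le_add_right (Nat.add_le_add hs ht) 1, hf.pair hg⟩

theorem CostLE.ite {α β : Type} {c : Prims S → α → Prop} [∀ P a, Decidable (c P a)]
    {f g : Prims S → α → β} {s t u : ℕ} (hc : CostLE S (fun P a => decide (c P a)) s)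
    (hf : CostLE S f t) (hg : CostLE S g u) :
    CostLE S (fun P a => if c P a then f P a else g P a) (s + t + u + 1) := by
  obtain ⟨s', hs, hc⟩ := hc
  obtain ⟨t', ht, hf⟩ := hf
  obtain ⟨u', hu, hg⟩ := hg
  refine ⟨s' + t' + u' + 1, by omega, ?_⟩
  convert Computes.cond hc hf hg using 3
  simp

theorem CostLE.of_computes {α β : Type} {f : Prims S → α → β} {c : ℕ} (h : Computes S f c) :
    CostLE S f c := ⟨c, le_rfl, h⟩

theorem size_pow_pos (S : Params lam) (e : ℕ) : 1 ≤ S.size ^ e :=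
  Nat.one_le_pow _ _ (by have := S.four_le_size; omega)

/-- Because the size is at least 4, one more unit in the exponent pays for the constant factor in
combining up to three programs. Costs can thus be tracked by a single exponent. -/
theorem four_mul_pow_le (S : Params lam) (e : ℕ) : 4 * S.size ^ e ≤ S.size ^ (e + 1) := by
  rw [pow_succ, mul_comm]
  exact Nat.mul_le_mul_left _ S.four_le_size

namespace PC

variable {α β γ : Type} {e e₁ e₂ e₃ : ℕ}

theorem mono {f : Prims S → α → β} {e' : ℕ} (h : PC S e f) (he : e ≤ e') : PC S e' f :=
  CostLE.mono h (Nat.pow_le_pow_right (by have := S.four_le_size; omega) he)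

theorem of_one {f : Prims S → α → β} (h : Computes S f 1) : PC S 0 f :=
  (CostLE.of_computes h).mono (size_pow_pos S 0)

theorem var : PC S 0 (fun _ (a : α) => a) :=
  (CostLE.of_computes Computes.id).mono (Nat.zero_le _)

theorem const (b : β) : PC S 0 (fun _ (_ : α) => b) := of_one (Computes.const b)

theorem comp {f : Prims S → α → β} {g : Prims S → β → γ} (hf : PC S e₁ f) (hg : PC S e₂ g) :
    PC S (max e₁ e₂ + 1) (fun P a => g P (f P a)) := by
  have h1 := hf.mono (le_max_left e₁ e₂)
  have h2 := hg.mono (le_max_right e₁ e₂)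
  exact (CostLE.comp h1 h2).mono (by have := four_mul_pow_le S (max e₁ e₂); omega)

/-- Precompose an operation of unit cost. -/
theorem op {f : Prims S → α → β} {g : Prims S → β → γ} (hg : Computes S g 1) (hf : PC S e f) :
    PC S (e + 1) (fun P a => g P (f P a)) := (hf.comp (of_one hg)).mono (by omega)

theorem pair {f : Prims S → α → β} {g : Prims S → α → γ} (hf : PC S e₁ f) (hg : PC S e₂ g) :
    PC S (max e₁ e₂ + 1) (fun P a => (f P a, g P a)) := by
  have h1 := hf.mono (le_max_left e₁ e₂)
  have h2 := hg.mono (le_max_right e₁ e₂)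
  exact (CostLE.pair h1 h2).mono (by
    have := four_mul_pow_le S (max e₁ e₂)
    have := size_pow_pos S (max e₁ e₂)
    omega)

theorem fst {f : Prims S → α → β × γ} (hf : PC S e f) : PC S (e + 1) (fun P a => (f P a).1) :=
  op (g := fun _ b => b.1) Computes.fst hf

theorem snd {f : Prims S → α → β × γ} (hf : PC S e f) : PC S (e + 1) (fun P a => (f P a).2) :=
  op (g := fun _ b => b.2) Computes.snd hf

theorem proj {ι : Type} {f : Prims S → α → ι → β} (hf : PC S e f) (i : ι) :
    PC S (e + 1) (fun P a => f P a i) :=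
  op (g := fun _ (b : ι → β) => b i) (Computes.proj i) hf

theorem inl {f : Prims S → α → β} (hf : PC S e f) :
    PC S (e + 1) (fun P a => (Sum.inl (f P a) : β ⊕ γ)) :=
  op (g := fun _ b => (Sum.inl b : β ⊕ γ)) Computes.inl hf

theorem inr {f : Prims S → α → γ} (hf : PC S e f) :
    PC S (e + 1) (fun P a => (Sum.inr (f P a) : β ⊕ γ)) :=
  op (g := fun _ b => (Sum.inr b : β ⊕ γ)) Computes.inr hf

theorem ite {c : Prims S → α → Prop} {_ : ∀ P a, Decidable (c P a)} {f g : Prims S → α → β}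
    (hc : PC S e₁ (fun P a => decide (c P a))) (hf : PC S e₂ f) (hg : PC S e₃ g) :
    PC S (max e₁ (max e₂ e₃) + 1) (fun P a => if c P a then f P a else g P a) := by
  have h1 := hc.mono (le_max_left e₁ (max e₂ e₃))
  have h2 := hf.mono ((le_max_left e₂ e₃).trans (le_max_right e₁ (max e₂ e₃)))
  have h3 := hg.mono ((le_max_right e₂ e₃).trans (le_max_right e₁ (max e₂ e₃)))
  exact (CostLE.ite h1 h2 h3).mono (by
    have := four_mul_pow_le S (max e₁ (max e₂ e₃))
    have := size_pow_pos S (max e₁ (max e₂ e₃))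
    omega)

/-- One unit of the exponent pays for the number of entries, the other for the overhead. -/
theorem tuple {ι : Type} [Fintype ι] [Small S ι] {f : ι → Prims S → α → β}
    (hf : ∀ i, PC S e (f i)) : PC S (e + 2) (fun P a i => f i P a) := by
  choose s hs hf using hf
  refine (CostLE.of_computes (Computes.tuple hf)).mono ?_
  have h1 : ∑ i, s i ≤ S.size * S.size ^ e := by
    calc ∑ i, s i ≤ ∑ _i : ι, S.size ^ e := Finset.sum_le_sum fun i _ => hs i
      _ = Fintype.card ι * S.size ^ e := by simp
      _ ≤ _ := Nat.mul_le_mul_right _ Small.card_le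
  have h2 : 4 * S.size ^ (e + 1) ≤ S.size ^ (e + 2) := four_mul_pow_le S (e + 1)
  have h3 := size_pow_pos S (e + 1)
  have h4 : S.size * S.size ^ e = S.size ^ (e + 1) := by rw [pow_succ, mul_comm]
  omega

theorem foldr {ι : Type} {op : β → β → β} (hop : PC S e (fun _ (a : β × β) => op a.1 a.2))
    (b : β) {f : ι → Prims S → α → β} (hf : ∀ i, PC S e (f i)) (l : List ι)
    (hl : l.length ≤ S.size) :
    PC S (e + 2) (fun P a => (l.map fun i => f i P a).foldr op b) := by
  have key : ∀ l : List ι, CostLE S (fun P a => (l.map fun i => f i P a).foldr op b)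
      (l.length * (3 * S.size ^ e) + 1) := by
    intro l
    induction l with
    | nil => exact CostLE.of_computes (Computes.const b) |>.mono (by simp)
    | cons i l ih =>
      have h1 : CostLE S (f i) (S.size ^ e) := hf i
      have h2 : CostLE S (fun _ (a : β × β) => op a.1 a.2) (S.size ^ e) := hop
      refine ((CostLE.pair h1 ih).comp h2).mono ?_
      have := size_pow_pos S e
      simp only [List.length_cons, Nat.add_mul]
      omega
  refine (key l).mono ?_
  have h2 : 4 * S.size ^ (e + 1) ≤ S.size ^ (e + 2) := four_mul_pow_le S (e + 1)
  have h3 := size_pow_pos S (e + 1)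
  have h4 : S.size ^ (e + 1) = S.size * S.size ^ e := by rw [pow_succ, mul_comm]
  have h5 : l.length * (3 * S.size ^ e) ≤ S.size * (3 * S.size ^ e) := Nat.mul_le_mul_right _ hl
  have h6 : S.size * (3 * S.size ^ e) = 3 * S.size ^ (e + 1) := by rw [h4]; ring
  omega

theorem sum {ι : Type} [Fintype ι] [Small S ι] [AddCommMonoid β]
    (hadd : PC S e₁ (fun _ (a : β × β) => a.1 + a.2)) {f : ι → Prims S → α → β}
    (hf : ∀ i, PC S e₂ (f i)) : PC S (max e₁ e₂ + 2) (fun P a => ∑ i, f i P a) := by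
  have := foldr (hadd.mono (le_max_left e₁ e₂)) 0 (fun i => (hf i).mono (le_max_right e₁ e₂))
    (Finset.univ : Finset ι).toList (by rw [Finset.length_toList]; exact Small.card_le)
  have e1 : ∀ (P : Prims S) (a : α), ∑ i, f i P a =
      ((Finset.univ : Finset ι).toList.map fun i => f i P a).foldr (fun x y => x + y) 0 :=
    fun P a => (Finset.sum_map_toList _ _).symm
  simp only [e1]
  exact this

/-! Boolean operations -/

theorem neg {p : Prims S → α → Prop} {_ : ∀ P a, Decidable (p P a)}
    (hp : PC S e (fun P a => decide (p P a))) : PC S (e + 1) (fun P a => decide (¬ p P a)) := by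
  have := (ite hp (const (β := Bool) false) (const (β := Bool) true)).mono (e' := e + 1) (by omega)
  convert this using 4 with P a
  by_cases h : p P a <;> simp [h]

theorem conj {p q : Prims S → α → Prop} {_ : ∀ P a, Decidable (p P a)}
    {_ : ∀ P a, Decidable (q P a)}
    (hp : PC S e₁ (fun P a => decide (p P a))) (hq : PC S e₂ (fun P a => decide (q P a))) :
    PC S (max e₁ e₂ + 1) (fun P a => decide (p P a ∧ q P a)) := by
  have := (ite hp hq (const (β := Bool) false)).mono (e' := max e₁ e₂ + 1) (by omega)
  convert this using 4 with P a
  by_cases h : p P a <;> simp [h]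

theorem andb : PC S 2 (fun _ (a : Bool × Bool) => a.1 && a.2) := by
  have h1 : PC S 0 (fun _ (a : Bool × Bool) => decide (a.1 = true)) := by
    simpa using of_one Computes.fst
  have h2 : PC S 0 (fun _ (a : Bool × Bool) => a.2) := of_one Computes.snd
  have := (ite h1 h2 (const false)).mono (e' := 2) (by omega)
  convert this using 3 with P a
  cases a.1 <;> simp

theorem all {ι : Type} [Fintype ι] [Small S ι] {p : ι → Prims S → α → Prop}
    {_ : ∀ i P a, Decidable (p i P a)} [∀ P a, Decidable (∀ i, p i P a)]
    (hp : ∀ i, PC S e (fun P a => decide (p i P a))) :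
    PC S (max e 2 + 2) (fun P a => decide (∀ i, p i P a)) := by
  have := foldr (andb.mono (le_max_right e 2)) true (fun i => (hp i).mono (le_max_left e 2))
    (Finset.univ : Finset ι).toList
    (by rw [Finset.length_toList]; exact Small.card_le)
  convert this using 3 with P a
  rw [Bool.eq_iff_iff, decide_eq_true_iff]
  have e1 : ∀ l : List ι, (l.map fun i => decide (p i P a)).foldr (fun x y => x && y) true = true ↔
      ∀ i ∈ l, p i P a := by
    intro l
    induction l with
    | nil => simp
    | cons i l ih => simp [ih]
  rw [e1]
  simp

/-- Replace a decidable proposition by an equivalent one. -/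
theorem congr_dec {p q : Prims S → α → Prop} {_ : ∀ P a, Decidable (p P a)}
    {_ : ∀ P a, Decidable (q P a)} (h : PC S e (fun P a => decide (p P a)))
    (hpq : ∀ P a, q P a ↔ p P a) : PC S e (fun P a => decide (q P a)) := by
  convert h using 3 with P a
  rw [decide_eq_decide]
  exact hpq P a

/-! Equality tests -/

open Classical in
/-- There is an equality test for `β`. -/
def EqTest (S : Params lam) (e : ℕ) (β : Type) : Prop :=
  PC S e (fun _ (a : β × β) => decide (a.1 = a.2))

theorem EqTest.mono {e' : ℕ} (h : EqTest S e β) (he : e ≤ e') : EqTest S e' β := PC.mono h he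

theorem eqd (h : EqTest S e₁ β) {f g : Prims S → α → β} [∀ P a, Decidable (f P a = g P a)]
    (hf : PC S e₂ f) (hg : PC S e₃ g) :
    PC S (max e₁ (max e₂ e₃) + 2) (fun P a => decide (f P a = g P a)) := by
  have := ((hf.pair hg).comp h).mono (e' := max e₁ (max e₂ e₃) + 2) (by omega)
  exact this.congr_dec fun _ _ => Iff.rfl

theorem EqTest.of_inj {i : β → γ} (hi : Function.Injective i) (hc : PC S e₁ (fun _ b => i b))
    (h : EqTest S e₂ γ) : EqTest S (max e₁ e₂ + 3) β := by
  classical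
  have := (eqd h ((of_one Computes.fst).comp hc) ((of_one Computes.snd).comp hc)).mono
    (e' := max e₁ e₂ + 3) (by omega)
  unfold EqTest
  convert this using 3 with P a
  simp [hi.eq_iff]

theorem eqTest_bits {w : ℕ} (hw : w ≤ S.size) : EqTest S 2 (Fin w → Bool) := by
  have : PC S 2 _ := (CostLE.of_computes (Computes.eqBits (S := S) w)).mono (d := S.size ^ 2)
    (by have := four_mul_pow_le S 1
        have := S.four_le_size
        rw [pow_one] at *
        norm_num at *
        omega)
  exact PC.congr_dec this fun _ _ => Iff.rfl

theorem eqTest_bool : EqTest S 2 Bool := by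
  have h1 : PC S 0 (fun _ (a : Bool × Bool) => decide (a.1 = true)) := by
    simpa using of_one Computes.fst
  have h2 : PC S 0 (fun _ (a : Bool × Bool) => decide (a.2 = true)) := by
    simpa using of_one Computes.snd
  have h3 : PC S 0 (fun _ (a : Bool × Bool) => a.2) := of_one Computes.snd
  have := (ite h1 h3 (neg h2)).mono (e' := 2) (by omega)
  unfold EqTest
  convert this using 3 with P a
  rcases a with ⟨_ | _, _ | _⟩ <;> simp

theorem EqTest.prod (h : EqTest S e₁ β) (h' : EqTest S e₂ γ) :
    EqTest S (max e₁ e₂ + 5) (β × γ) := by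
  classical
  have i1 : PC S 0 (fun _ (a : (β × γ) × (β × γ)) => a.1) := of_one Computes.fst
  have i2 : PC S 0 (fun _ (a : (β × γ) × (β × γ)) => a.2) := of_one Computes.snd
  refine ((eqd h i1.fst i2.fst).conj (eqd h' i1.snd i2.snd)).congr_dec ?_ |>.mono (by omega)
  intro P a
  exact Prod.ext_iff

theorem EqTest.pi {ι : Type} [Fintype ι] [Small S ι] (h : EqTest S e β) :
    EqTest S (e + 6) (ι → β) := by
  classical
  have i1 : PC S 0 (fun _ (a : (ι → β) × (ι → β)) => a.1) := of_one Computes.fst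
  have i2 : PC S 0 (fun _ (a : (ι → β) × (ι → β)) => a.2) := of_one Computes.snd
  refine (all fun i => eqd h (i1.proj i) (i2.proj i)).congr_dec ?_ |>.mono (by omega)
  intro P a
  exact funext_iff

/-- The cost model compares bit strings only, so equality in the three fields descends through
coordinates to the binary encoding of 𝔽_q. -/
theorem eqTest_Fq : EqTest S 5 S.Fq := by
  have h : EqTest S 2 (Fin (Nat.clog 2 (Fintype.card S.Fq)) → Bool) := eqTest_bits
    (by unfold Params.size Params.q; omega)
  exact (EqTest.of_inj S.bits_injective (of_one Computes.encFq) h).mono (by omega)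

theorem eqTest_Fqm : EqTest S 14 S.Fqm :=
  (EqTest.of_inj (i := fun b i => S.basis.repr b i)
    (fun a b hab => S.basis.repr.injective (Finsupp.ext fun i => congrFun hab i))
    (tuple fun i => of_one (Computes.coordFqm i)) (EqTest.pi eqTest_Fq)).mono (by omega)

theorem eqTest_Fqme : EqTest S 23 S.Fqme :=
  (EqTest.of_inj (i := fun b i => S.basisExt.repr b i)
    (fun a b hab => S.basisExt.repr.injective (Finsupp.ext fun i => congrFun hab i))
    (tuple fun i => of_one (Computes.coordFqme i)) (EqTest.pi eqTest_Fqm)).mono (by omega)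

/-! Arithmetic -/

theorem addq {f g : Prims S → α → S.Fq} (hf : PC S e₁ f) (hg : PC S e₂ g) :
    PC S (max e₁ e₂ + 2) (fun P a => f P a + g P a) := op Computes.addFq (hf.pair hg)

theorem mulq {f g : Prims S → α → S.Fq} (hf : PC S e₁ f) (hg : PC S e₂ g) :
    PC S (max e₁ e₂ + 2) (fun P a => f P a * g P a) := op Computes.mulFq (hf.pair hg)

theorem addm {f g : Prims S → α → S.Fqm} (hf : PC S e₁ f) (hg : PC S e₂ g) :
    PC S (max e₁ e₂ + 2) (fun P a => f P a + g P a) := op Computes.addFqm (hf.pair hg)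

theorem mulm {f g : Prims S → α → S.Fqm} (hf : PC S e₁ f) (hg : PC S e₂ g) :
    PC S (max e₁ e₂ + 2) (fun P a => f P a * g P a) := op Computes.mulFqm (hf.pair hg)

theorem adde {f g : Prims S → α → S.Fqme} (hf : PC S e₁ f) (hg : PC S e₂ g) :
    PC S (max e₁ e₂ + 2) (fun P a => f P a + g P a) := op Computes.addFqme (hf.pair hg)

theorem mule {f g : Prims S → α → S.Fqme} (hf : PC S e₁ f) (hg : PC S e₂ g) :
    PC S (max e₁ e₂ + 2) (fun P a => f P a * g P a) := op Computes.mulFqme (hf.pair hg)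

theorem embm {f : Prims S → α → S.Fq} (hf : PC S e f) :
    PC S (e + 1) (fun P a => algebraMap S.Fq S.Fqm (f P a)) := op Computes.embFqm hf

theorem embe {f : Prims S → α → S.Fqm} (hf : PC S e f) :
    PC S (e + 1) (fun P a => algebraMap S.Fqm S.Fqme (f P a)) := op Computes.embFqme hf

/-- Negation is not a basic operation; it is multiplication by the constant -1. -/
theorem negq {f : Prims S → α → S.Fq} (hf : PC S e f) : PC S (e + 2) (fun P a => -f P a) := by
  have := ((const (-1 : S.Fq)).mulq hf).mono (e' := e + 2) (by omega)
  simpa using this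

theorem negm {f : Prims S → α → S.Fqm} (hf : PC S e f) : PC S (e + 2) (fun P a => -f P a) := by
  have := ((const (-1 : S.Fqm)).mulm hf).mono (e' := e + 2) (by omega)
  simpa using this

theorem nege {f : Prims S → α → S.Fqme} (hf : PC S e f) : PC S (e + 2) (fun P a => -f P a) := by
  have := ((const (-1 : S.Fqme)).mule hf).mono (e' := e + 2) (by omega)
  simpa using this

theorem sube {f g : Prims S → α → S.Fqme} (hf : PC S e₁ f) (hg : PC S e₂ g) :
    PC S (max e₁ e₂ + 4) (fun P a => f P a - g P a) := by
  have := (hf.adde hg.nege).mono (e' := max e₁ e₂ + 4) (by omega)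
  simpa only [sub_eq_add_neg] using this

theorem subm {f g : Prims S → α → S.Fqm} (hf : PC S e₁ f) (hg : PC S e₂ g) :
    PC S (max e₁ e₂ + 4) (fun P a => f P a - g P a) := by
  have := (hf.addm hg.negm).mono (e' := max e₁ e₂ + 4) (by omega)
  simpa only [sub_eq_add_neg] using this

theorem subq {f g : Prims S → α → S.Fq} (hf : PC S e₁ f) (hg : PC S e₂ g) :
    PC S (max e₁ e₂ + 4) (fun P a => f P a - g P a) := by
  have := (hf.addq hg.negq).mono (e' := max e₁ e₂ + 4) (by omega)
  simpa only [sub_eq_add_neg] using this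

theorem sumq {ι : Type} [Fintype ι] [Small S ι] {f : ι → Prims S → α → S.Fq}
    (hf : ∀ i, PC S e (f i)) : PC S (e + 2) (fun P a => ∑ i, f i P a) :=
  (sum (of_one Computes.addFq) hf).mono (by omega)

theorem summ {ι : Type} [Fintype ι] [Small S ι] {f : ι → Prims S → α → S.Fqm}
    (hf : ∀ i, PC S e (f i)) : PC S (e + 2) (fun P a => ∑ i, f i P a) :=
  (sum (of_one Computes.addFqm) hf).mono (by omega)

theorem sume {ι : Type} [Fintype ι] [Small S ι] {f : ι → Prims S → α → S.Fqme}
    (hf : ∀ i, PC S e (f i)) : PC S (e + 2) (fun P a => ∑ i, f i P a) :=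
  (sum (of_one Computes.addFqme) hf).mono (by omega)

theorem frob {f : Prims S → α → S.Fqm} (hf : PC S e f) (l : ℕ) (hl : l ≤ S.size) :
    PC S (e + 2) (fun P a => f P a ^ S.q ^ l) := by
  have key : ∀ l : ℕ, CostLE S (fun P a => f P a ^ S.q ^ l) (S.size ^ e + l) := by
    intro l
    induction l with
    | zero => simpa only [pow_zero, pow_one, Nat.add_zero] using show CostLE S f (S.size ^ e) from hf
    | succ l ih =>
      have := ih.comp (CostLE.of_computes (Computes.frobFqm (S := S)))
      simpa only [← pow_mul, ← pow_succ, ← Nat.add_assoc] using this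
  refine (key l).mono ?_
  have h1 : 4 * S.size ^ (e + 1) ≤ S.size ^ (e + 2) := four_mul_pow_le S (e + 1)
  have h2 := four_mul_pow_le S e
  have h3 : S.size ^ (e + 1) = S.size * S.size ^ e := by rw [pow_succ, mul_comm]
  have h4 : S.size ≤ S.size * S.size ^ e := Nat.le_mul_of_pos_right _ (size_pow_pos S e)
  omega

/-- Sums over a set of leaves which depends on the input. -/
theorem agg {ι : Type} [Fintype ι] [DecidableEq ι] [Small S ι] [AddCommMonoid β]
    (hadd : PC S e₁ (fun _ (a : β × β) => a.1 + a.2)) {A : Prims S → α → Finset ι}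
    (hA : ∀ i, PC S e₂ (fun P a => decide (i ∈ A P a))) {f : ι → Prims S → α → β}
    (hf : ∀ i, PC S e₃ (f i)) :
    PC S (max e₁ (max e₂ e₃) + 3) (fun P a => ∑ i ∈ A P a, f i P a) := by
  have := (sum hadd fun i => ite (hA i) (hf i) (const 0)).mono
    (e' := max e₁ (max e₂ e₃) + 3) (by omega)
  convert this using 3 with P a
  rw [← Finset.sum_filter]
  simp

theorem add_pi {ι : Type} [Fintype ι] [Small S ι] [Add β]
    (hadd : PC S e (fun _ (a : β × β) => a.1 + a.2)) :
    PC S (e + 6) (fun _ (a : (ι → β) × (ι → β)) => a.1 + a.2) := by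
  have i1 : PC S 0 (fun _ (a : (ι → β) × (ι → β)) => a.1) := of_one Computes.fst
  have i2 : PC S 0 (fun _ (a : (ι → β) × (ι → β)) => a.2) := of_one Computes.snd
  exact (tuple fun i => ((i1.proj i).pair (i2.proj i)).comp hadd).mono (by omega)

theorem add_prod [Add β] [Add γ] (h : PC S e₁ (fun _ (a : β × β) => a.1 + a.2))
    (h' : PC S e₂ (fun _ (a : γ × γ) => a.1 + a.2)) :
    PC S (max e₁ e₂ + 4) (fun _ (a : (β × γ) × (β × γ)) => a.1 + a.2) := by
  have i1 : PC S 0 (fun _ (a : (β × γ) × (β × γ)) => a.1) := of_one Computes.fst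
  have i2 : PC S 0 (fun _ (a : (β × γ) × (β × γ)) => a.2) := of_one Computes.snd
  exact (((i1.fst.pair i2.fst).comp h).pair ((i1.snd.pair i2.snd).comp h')).mono (by omega)

theorem add_share : PC S 20 (fun _ (a : Share S × Share S) => a.1 + a.2) :=
  (add_prod (add_pi (of_one Computes.addFq)) (add_prod (add_pi (of_one Computes.addFqm))
    (add_prod (add_pi (of_one Computes.addFqme)) (of_one Computes.addFqme)))).mono (by omega)

end PC

end Programs

end MinRankPoK

end

open scoped ENNReal

noncomputable section

namespace MinRankPoK

/-! ### Programs for the operations of the protocol -/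

namespace PC

variable {lam : ℕ} {S : Params lam} {α : Type} {e : ℕ}

theorem column {E : Prims S → α → Fin S.m → Fin S.n → S.Fq} (j : Fin S.n)
    (hE : ∀ b, PC S e (fun P a => E P a b j)) :
    PC S (e + 6) (fun P a => MinRankPoK.column (E P a) j) := by
  have := (summ fun b => (hE b).embm.mulm (const (S.basis b))).mono (e' := e + 6) (by omega)
  simpa only [MinRankPoK.column, Algebra.smul_def] using this

theorem shareCol {M : Prims S → α → Inst S} {A : Prims S → α → Finset (Leaf S)}
    {x : Prims S → α → Fin S.k → S.Fq} (hM : PC S e M)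
    (hA : ∀ l, PC S e (fun P a => decide (l ∈ A P a))) (hx : PC S e x) (j : Fin S.n) :
    PC S (e + 20) (fun P a => MinRankPoK.shareCol (M P a) (A P a) (x P a) j) :=
  (column (E := fun P a b j => (if firstLeaf S ∈ A P a then M P a 0 b j else 0) +
      ∑ i, x P a i * M P a i.succ b j) j fun b =>
    ((hA (firstLeaf S)).ite (((hM.proj 0).proj b).proj j) (const 0)).addq
      (sumq fun i => (hx.proj i).mulq (((hM.proj i.succ).proj b).proj j))).mono (by omega)

theorem shareW {M : Prims S → α → Inst S} {ch : Prims S → α → Ch1 S}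
    {A : Prims S → α → Finset (Leaf S)} {x : Prims S → α → Fin S.k → S.Fq} (hM : PC S e M)
    (hch : PC S e ch) (hA : ∀ l, PC S e (fun P a => decide (l ∈ A P a))) (hx : PC S e x)
    (l : ℕ) (hl : l ≤ S.size) :
    PC S (e + 30) (fun P a => MinRankPoK.shareW (M P a) (ch P a) (A P a) (x P a) l) :=
  (sume fun j => (hch.fst.proj j).mule ((shareCol hM hA hx j).frob l hl).embe).mono (by omega)

theorem r_le_size : S.r ≤ S.size := by unfold Params.size; omega

theorem shareAlpha {M : Prims S → α → Inst S} {ch : Prims S → α → Ch1 S}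
    {A : Prims S → α → Finset (Leaf S)} {s : Prims S → α → Share S} (hM : PC S e M)
    (hch : PC S e ch) (hA : ∀ l, PC S e (fun P a => decide (l ∈ A P a))) (hs : PC S e s) :
    PC S (e + 40) (fun P a => MinRankPoK.shareAlpha (M P a) (ch P a) (A P a) (s P a)) :=
  (tuple fun l : Fin S.r => ((hch.snd.mule (shareW (hM.mono (Nat.le_succ e)) (hch.mono (Nat.le_succ e))
    (fun i => (hA i).mono (Nat.le_succ e)) hs.fst l (l.2.le.trans r_le_size))).adde
      (hs.snd.snd.fst.proj l))).mono (by omega)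

theorem shareV {M : Prims S → α → Inst S} {ch : Prims S → α → Ch1 S}
    {A : Prims S → α → Finset (Leaf S)} {s : Prims S → α → Share S}
    {al : Prims S → α → Fin S.r → S.Fqme} (hM : PC S e M) (hch : PC S e ch)
    (hA : ∀ l, PC S e (fun P a => decide (l ∈ A P a))) (hs : PC S e s) (hal : PC S e al) :
    PC S (e + 50) (fun P a => MinRankPoK.shareV (M P a) (ch P a) (A P a) (s P a) (al P a)) :=
  (((hch.snd.mule (shareW (hM.mono (Nat.le_succ e)) (hch.mono (Nat.le_succ e))
    (fun i => (hA i).mono (Nat.le_succ e)) hs.fst S.r r_le_size).nege).sube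
      (sume fun l => (hal.proj l).mule (hs.snd.fst.proj l).embe)).sube hs.snd.snd.snd).mono
    (by omega)

theorem aggregate {A : Prims S → α → Finset (Leaf S)} {sh : Prims S → α → Leaf S → Share S}
    (hA : ∀ l, PC S e (fun P a => decide (l ∈ A P a)))
    (hsh : ∀ l, PC S e (fun P a => sh P a l)) :
    PC S (e + 25) (fun P a => MinRankPoK.aggregate (sh P a) (A P a)) :=
  (agg add_share hA hsh).mono (by omega)

theorem checkDim {M : Prims S → α → Inst S} {ch : Prims S → α → Ch1 S}
    {i : Prims S → α → Leaf S} {al : Prims S → α → Fin S.r → S.Fqme}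
    {sh : Prims S → α → Leaf S → Share S} (hM : PC S e M) (hch : PC S e ch) (hi : PC S e i)
    (hal : PC S e al) (hsh : ∀ l, PC S e (fun P a => sh P a l)) (d : Fin S.D) :
    PC S (e + 200) (fun P a =>
      MinRankPoK.checkDim (M P a) (ch P a) (i P a) (al P a) (sh P a) d) := by
  -- The hidden leaf is an input of the program, so membership in its main party must be tested at
  -- run time. Everything reduces to the bit i d and to equality with i.
  have hib : ∀ b, PC S (e + 10) (fun P a => decide (b = i P a d)) := fun b =>
    (eqd eqTest_bool (const b) (hi.proj d)).mono (by omega)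
  have hpart : ∀ l, PC S (e + 15) (fun P a =>
      decide (l ∈ (mainParty S d (i P a d)).erase (i P a))) := fun l =>
    ((neg (eqd (eqTest_bits S.D_le_size) (const l) hi)).conj (hib (l d))).congr_dec
      (fun P a => by simp [mainParty]) |>.mono (by omega)
  have hother : ∀ l, PC S (e + 15) (fun P a => decide (l ∈ mainParty S d (!(i P a d)))) := fun l =>
    (hib (!(l d))).congr_dec (fun P a => by
      simp only [mainParty, Finset.mem_filter, Finset.mem_univ, true_and]
      cases l d <;> cases i P a d <;> simp) |>.mono (by omega)
  have hsh' : ∀ l, PC S (e + 15) (fun P a => sh P a l) := fun l => (hsh l).mono (by omega)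
  have hap := aggregate hpart hsh'
  have hao := aggregate hother hsh'
  have hM' : PC S (e + 40) M := hM.mono (by omega)
  have hch' : PC S (e + 40) ch := hch.mono (by omega)
  have halp := tuple fun l => adde
    ((shareAlpha hM' hch' (fun l => (hpart l).mono (by omega)) hap).proj l) (hal.proj l)
  have halo := shareAlpha hM' hch' (fun l => (hother l).mono (by omega)) hao
  have hsum := tuple fun l => adde (halp.proj l) (halo.proj l)
  have halpha := hsum.mono (e' := e + 100) (by omega)
  have hM2 : PC S (e + 100) M := hM.mono (by omega)
  have hch2 : PC S (e + 100) ch := hch.mono (by omega)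
  have hvp := shareV hM2 hch2 (fun l => (hpart l).mono (by omega))
    (hap.mono (by omega : _ ≤ e + 100)) halpha
  have hvo := shareV hM2 hch2 (fun l => (hother l).mono (by omega))
    (hao.mono (by omega : _ ≤ e + 100)) halpha
  have := (tuple fun b => (hib b).ite (halp.pair (hvp.adde (hvp.adde hvo).nege))
    (halo.pair hvo)).mono (e' := e + 200) (by omega)
  exact this

theorem walk {α : Type} {e : ℕ} : ∀ (d : ℕ) (i : Fin d → Bool) {f : Prims S → α → Seed lam},
    CostLE S f e → CostLE S (fun P a => MinRankPoK.walk P.prgNode d i (f P a)) (e + 2 * d)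
  | 0, _, _, hf => hf
  | d + 1, i, f, hf => by
    have hc : CostLE S (fun P a => child P.prgNode (f P a) (i 0)) (e + 2) := by
      have h1 := hf.comp (CostLE.of_computes (Computes.prgNode (S := S)))
      cases i 0
      · exact h1.comp (CostLE.of_computes Computes.fst)
      · exact h1.comp (CostLE.of_computes Computes.snd)
    exact (walk d (Fin.tail i) hc).mono (by omega)

/-- The recursion has depth D, and tracking only exponents would add one per level. Costs are
therefore counted additively here and converted to a power once at the end. A conditional includes
the programs of both branches, as the direction of i is an input. -/
theorem recover_cost {α : Type} {e : ℕ} : ∀ (d : ℕ) (j : Fin d → Bool)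
    {i : Fin d → Prims S → α → Bool} {p : Fin d → Prims S → α → Seed lam}
    (_ : ∀ t, CostLE S (i t) e) (_ : ∀ t, CostLE S (p t) e),
    CostLE S (fun P a => MinRankPoK.recover P.prgNode d (fun t => i t P a) (fun t => p t P a) j)
      (d * (2 * e + 2 * d + 10) + 1)
  | 0, _, _, _, _, _ => CostLE.of_computes (Computes.const _) |>.mono (by omega)
  | d + 1, j, i, p, hi, hp => by
    have h1 := recover_cost d (Fin.tail j) (fun t => hi t.succ) (fun t => hp t.succ)
    have h2 := walk d (Fin.tail j) (hp 0)
    have h3 : CostLE S (fun P a => decide (i 0 P a = true)) e := by simpa using hi 0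
    by_cases hj : j 0 = true
    · have := CostLE.ite h3 h1 h2
      refine CostLE.mono (c := e + (d * (2 * e + 2 * d + 10) + 1) + (e + 2 * d) + 1) ?_ (by
        ring_nf; omega)
      convert this using 3 with P a
      rw [recover, hj]
      by_cases h : i 0 P a = true
      · rw [if_pos h, if_pos h.symm]; rfl
      · rw [if_neg h, if_neg (fun h' => h h'.symm)]
    · have := CostLE.ite h3 h2 h1
      refine CostLE.mono (c := e + (e + 2 * d) + (d * (2 * e + 2 * d + 10) + 1) + 1) ?_ (by
        ring_nf; omega)
      convert this using 3 with P a
      have hj' : j 0 = false := by simpa using hj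
      rw [recover, hj']
      by_cases h : i 0 P a = true
      · rw [if_pos h, if_neg (by rw [h]; simp)]
      · rw [if_neg h, if_pos (by simpa using h)]; rfl

theorem recover {i : Prims S → α → Leaf S} {p : Prims S → α → Fin S.D → Seed lam}
    (hi : PC S e i) (hp : PC S e p) (j : Leaf S) :
    PC S (e + 5) (fun P a => MinRankPoK.recover P.prgNode S.D (i P a) (p P a) j) := by
  refine (recover_cost S.D j (fun t => hi.proj t) (fun t => hp.proj t)).mono ?_
  have h1 := S.D_le_size
  have h2 : 4 * S.size ^ (e + 1) ≤ S.size ^ (e + 2) := four_mul_pow_le S (e + 1)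
  have h3 : 4 * S.size ^ (e + 2) ≤ S.size ^ (e + 3) := four_mul_pow_le S (e + 2)
  have h4 : 4 * S.size ^ (e + 3) ≤ S.size ^ (e + 4) := four_mul_pow_le S (e + 3)
  have h5 : 4 * S.size ^ (e + 4) ≤ S.size ^ (e + 5) := four_mul_pow_le S (e + 4)
  have h6 := size_pow_pos S (e + 1)
  have h7 : S.size ≤ S.size ^ (e + 1) := Nat.le_self_pow (by omega) _
  calc S.D * (2 * S.size ^ (e + 1) + 2 * S.D + 10) + 1
      ≤ S.size * (14 * S.size ^ (e + 1)) + S.size ^ (e + 1) :=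
        Nat.add_le_add (Nat.mul_le_mul h1 (by omega)) h6
    _ = 14 * S.size ^ (e + 2) + S.size ^ (e + 1) := by ring
    _ ≤ _ := by omega

theorem vSeed {i : Prims S → α → Leaf S} {p : Prims S → α → Fin S.D → Seed lam}
    (hi : PC S e i) (hp : PC S e p) (j : Leaf S) :
    PC S (e + 6) (fun P a => MinRankPoK.vSeed P (i P a) (p P a) j) :=
  op Computes.prgLeaf (recover hi hp j)

theorem leafShare {s : Prims S → α → Seed lam} {aux : Prims S → α → Aux S} (hs : PC S e s)
    (ha : PC S e aux) (j : Leaf S) :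
    PC S (e + 6) (fun P a => MinRankPoK.leafShare P (s P a) (aux P a) j) := by
  unfold MinRankPoK.leafShare
  by_cases hj : j = lastLeaf S
  · simp only [if_pos hj]
    exact (ha.fst.pair (ha.snd.fst.pair ((op Computes.prgLast hs).pair ha.snd.snd))).mono
      (by omega)
  · simp only [if_neg hj]
    exact (op Computes.prgShare hs).mono (by omega)

theorem leafState {s : Prims S → α → Seed lam} {aux : Prims S → α → Aux S} (hs : PC S e s)
    (ha : PC S e aux) (j : Leaf S) :
    PC S (e + 2) (fun P a => MinRankPoK.leafState (s P a) (aux P a) j) := by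
  unfold MinRankPoK.leafState
  by_cases hj : j = lastLeaf S
  · simp only [if_pos hj]
    exact (hs.pair ha).inr.mono (by omega)
  · simp only [if_neg hj]
    exact hs.inl.mono (by omega)

variable {M : Prims S → α → Inst S} {ch : Prims S → α → Ch1 S} {i : Prims S → α → Leaf S}
  {rsp : Prims S → α → Rsp S}

theorem vOpen (hi : PC S e i) (hr : PC S e rsp) (j : Leaf S) :
    PC S (e + 20) (fun P a => MinRankPoK.vOpen P (i P a) (rsp P a) j) := by
  have h := vSeed (hi.mono (by omega)) hr.snd.snd.fst j
  exact ((leafState h.fst (hr.snd.snd.snd.mono (by omega)) j).pair h.snd).mono (by omega)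

theorem vCmt (hi : PC S e i) (hr : PC S e rsp) :
    PC S (e + 30) (fun P a => MinRankPoK.vCmt P (i P a) (rsp P a)) := by
  have := (tuple fun j => (eqd (eqTest_bits S.D_le_size) (const j) hi).ite hr.fst
    (op Computes.com (vOpen hi hr j))).mono (e' := e + 30) (by omega)
  exact this

theorem vShare (hi : PC S e i) (hr : PC S e rsp) (j : Leaf S) :
    PC S (e + 20) (fun P a => MinRankPoK.vShare P (i P a) (rsp P a) j) := by
  have h := vSeed (hi.mono (by omega)) hr.snd.snd.fst j
  exact (leafShare h.fst (hr.snd.snd.snd.mono (by omega)) j).mono (by omega)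

theorem vBroadcast (hM : PC S e M) (hch : PC S e ch) (hi : PC S e i) (hr : PC S e rsp)
    (d : Fin S.D) :
    PC S (e + 220) (fun P a => MinRankPoK.vBroadcast P (M P a) (ch P a) (i P a) (rsp P a) d) :=
  (checkDim (e := e + 20) (hM.mono (by omega)) (hch.mono (by omega)) (hi.mono (by omega))
    (hr.snd.fst.mono (by omega)) (vShare hi hr) d).mono (by omega)

theorem vDigests (hM : PC S e M) (hch : PC S e ch) (hi : PC S e i) (hr : PC S e rsp) :
    PC S (e + 225) (fun P a => MinRankPoK.vDigests P (M P a) (ch P a) (i P a) (rsp P a)) :=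
  (tuple fun d => op Computes.hash (vBroadcast hM hch hi hr d).inl.inr).mono (by omega)

theorem recompute (hM : PC S e M) (hch : PC S e ch) (hi : PC S e i) (hr : PC S e rsp) :
    PC S (e + 240) (fun P a => MinRankPoK.recompute P (M P a) (ch P a) (i P a) (rsp P a)) :=
  ((op Computes.hash (vCmt hi hr).inl).pair (hch.pair ((op Computes.hash
    (vDigests hM hch hi hr).inr.inr).pair (hi.pair hr)))).mono (by omega)

theorem eqTest_digest : EqTest S 2 (Digest S) := eqTest_bits (by unfold Params.size; omega)

-- By `accepts_iff` the program may skip the test of v and compare α for all pairs of dimensions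
-- together with the two digests.
open Classical in
theorem accepts {T : Prims S → α → Transcript S} (hM : PC S e M) (hT : PC S e T) :
    PC S (e + 280) (fun P a => decide (Accepts P (M P a) (T P a))) := by
  have hch : PC S (e + 5) (fun P a => (T P a).2.1) := hT.snd.fst.mono (by omega)
  have hi : PC S (e + 5) (fun P a => (T P a).2.2.2.1) := hT.snd.snd.snd.fst.mono (by omega)
  have hr : PC S (e + 5) (fun P a => (T P a).2.2.2.2) := hT.snd.snd.snd.snd.mono (by omega)
  have hM' : PC S (e + 5) M := hM.mono (by omega)
  have hb := fun d => vBroadcast hM' hch hi hr d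
  have hal := fun d => tuple fun l =>
    adde (((hb d).proj false).fst.proj l) (((hb d).proj true).fst.proj l)
  refine ((eqd eqTest_digest hT.fst (op Computes.hash (vCmt hi hr).inl)).conj
    ((all fun d => all fun d' => eqd (EqTest.pi eqTest_Fqme) (hal d) (hal d')).conj
      (eqd eqTest_digest hT.snd.snd.fst
        (op Computes.hash (vDigests hM' hch hi hr).inr.inr)))).congr_dec ?_ |>.mono (by omega)
  intro P a
  exact accepts_iff P (M P a) (T P a).1 (T P a).2.1 (T P a).2.2.1 (T P a).2.2.2.1 (T P a).2.2.2.2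

end PC

end MinRankPoK

end

open scoped ENNReal

noncomputable section

namespace MinRankPoK

/-! ### Extraction from two accepted transcripts -/

section Extraction

variable {lam : ℕ} {S : Params lam}

def orElse (a b : Bool × Output S) : Bool × Output S := if a.1 = true then a else b

def firstOf {ι : Type} [Fintype ι] (f : ι → Bool × Output S) : Bool × Output S :=
  ((Finset.univ : Finset ι).toList.map f).foldr orElse (false, Sum.inl 0)

/-- If an output is found then it is valid. -/
def SoundFind (P : Prims S) (M : Inst S) (a : Bool × Output S) : Prop :=
  a.1 = true → ValidOutput P M a.2

theorem orElse_found {a b : Bool × Output S} :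
    (orElse a b).1 = true ↔ a.1 = true ∨ b.1 = true := by
  unfold orElse
  split_ifs with h <;> simp [h]

theorem SoundFind.orElse {P : Prims S} {M : Inst S} {a b : Bool × Output S}
    (ha : SoundFind P M a) (hb : SoundFind P M b) : SoundFind P M (orElse a b) := by
  unfold MinRankPoK.orElse
  split_ifs <;> assumption

theorem firstOf_found {ι : Type} [Fintype ι] {f : ι → Bool × Output S} {i : ι}
    (h : (f i).1 = true) : (firstOf f).1 = true := by
  have key : ∀ l : List ι, i ∈ l → ((l.map f).foldr orElse (false, Sum.inl 0)).1 = true := by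
    intro l
    induction l with
    | nil => simp
    | cons j l ih =>
      intro hi
      rw [List.map_cons, List.foldr_cons, orElse_found]
      rcases List.mem_cons.1 hi with rfl | hi
      · exact Or.inl h
      · exact Or.inr (ih hi)
  exact key _ (by simp)

theorem SoundFind.firstOf {P : Prims S} {M : Inst S} {ι : Type} [Fintype ι]
    {f : ι → Bool × Output S} (h : ∀ i, SoundFind P M (f i)) : SoundFind P M (firstOf f) := by
  unfold MinRankPoK.firstOf
  induction (Finset.univ : Finset ι).toList with
  | nil => exact fun h => by simp at h
  | cons i l ih => exact (h i).orElse ih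

/-- The shares of all leaves: that of the leaf hidden in the first transcript is taken from the
second one. -/
def mergedShare (P : Prims S) (T T' : Transcript S) (j : Leaf S) : Share S :=
  if j = T.2.2.2.1 then vShare P T'.2.2.2.1 T'.2.2.2.2 j else vShare P T.2.2.2.1 T.2.2.2.2 j

open Classical in
/-- The output `o`, found if `c` holds. -/
def cand (c : Prop) (o : Output S) : Bool × Output S := (decide c, o)

theorem cand_found {c : Prop} {o : Output S} : (cand c o).1 = true ↔ c := by simp [cand]

open Classical in
/-- The search for a collision of the commitments, of the digests, or for a witness. -/
def findOutput (P : Prims S) (M : Inst S) (T T' : Transcript S) : Bool × Output S :=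
  if Accepts P M T ∧ Accepts P M T' ∧ T.1 = T'.1 then
    orElse
      (cand (¬ vCmt P T.2.2.2.1 T.2.2.2.2 = vCmt P T'.2.2.2.1 T'.2.2.2.2)
        (Sum.inr (Sum.inr (Sum.inl (vCmt P T.2.2.2.1 T.2.2.2.2),
          Sum.inl (vCmt P T'.2.2.2.1 T'.2.2.2.2)))))
    (orElse
      (firstOf fun j : Leaf S =>
        (cand (((¬ j = T.2.2.2.1) ∧ ¬ j = T'.2.2.2.1) ∧
            vCmt P T.2.2.2.1 T.2.2.2.2 = vCmt P T'.2.2.2.1 T'.2.2.2.2 ∧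
            ¬ (vOpen P T.2.2.2.1 T.2.2.2.2 j).1 = (vOpen P T'.2.2.2.1 T'.2.2.2.2 j).1)
          (Sum.inr (Sum.inl (vOpen P T.2.2.2.1 T.2.2.2.2 j, vOpen P T'.2.2.2.1 T'.2.2.2.2 j)))))
    (orElse
      (cand (T.2.2.1 = T'.2.2.1 ∧
          ¬ vDigests P M T.2.1 T.2.2.2.1 T.2.2.2.2 = vDigests P M T'.2.1 T'.2.2.2.1 T'.2.2.2.2)
        (Sum.inr (Sum.inr (Sum.inr (Sum.inr (vDigests P M T.2.1 T.2.2.2.1 T.2.2.2.2)),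
          Sum.inr (Sum.inr (vDigests P M T'.2.1 T'.2.2.2.1 T'.2.2.2.2))))))
    (orElse
      (firstOf fun d : Fin S.D =>
        (cand (vDigests P M T.2.1 T.2.2.2.1 T.2.2.2.2 = vDigests P M T'.2.1 T'.2.2.2.1 T'.2.2.2.2 ∧
            ¬ vBroadcast P M T.2.1 T.2.2.2.1 T.2.2.2.2 d =
              vBroadcast P M T'.2.1 T'.2.2.2.1 T'.2.2.2.2 d)
          (Sum.inr (Sum.inr (Sum.inr (Sum.inl (vBroadcast P M T.2.1 T.2.2.2.1 T.2.2.2.2 d)),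
            Sum.inr (Sum.inl (vBroadcast P M T'.2.1 T'.2.2.2.1 T'.2.2.2.2 d)))))))
      (cand (Certified M (aggregate (mergedShare P T T') Finset.univ))
        (Sum.inl (aggregate (mergedShare P T T') Finset.univ).1)))))
  else (false, Sum.inl 0)

theorem accepts_digests {P : Prims S} {M : Inst S} {T : Transcript S} (h : Accepts P M T) :
    T.1 = P.hash (Sum.inl (vCmt P T.2.2.2.1 T.2.2.2.2)) ∧
      T.2.2.1 = P.hash (Sum.inr (Sum.inr (vDigests P M T.2.1 T.2.2.2.1 T.2.2.2.2))) := by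
  obtain ⟨h0, ch, h1, i, rsp⟩ := T
  obtain ⟨a, -, b⟩ := (accepts_iff P M h0 ch h1 i rsp).1 h
  exact ⟨a, b⟩

/-- The guard of each candidate, together with acceptance, is what makes it valid. For openings,
equality of the commitment vectors at a leaf recomputed in both views makes the two commitments
collide. -/
theorem soundFind_findOutput (P : Prims S) (M : Inst S) (T T' : Transcript S) :
    SoundFind P M (findOutput P M T T') := by
  unfold findOutput
  split_ifs with hacc
  swap
  · exact fun h => by simp at h
  obtain ⟨hT, hT', h0⟩ := hacc
  have hd := accepts_digests hT
  have hd' := accepts_digests hT'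
  refine SoundFind.orElse (fun h => ?_) (SoundFind.orElse (SoundFind.firstOf fun j h => ?_)
    (SoundFind.orElse (fun h => ?_) (SoundFind.orElse (SoundFind.firstOf fun d h => ?_)
      fun h => ?_)))
  · rw [cand_found] at h
    exact ⟨fun he => h (Sum.inl_injective he), by rw [← hd.1, ← hd'.1, h0]⟩
  · rw [cand_found] at h
    obtain ⟨⟨hj, hj'⟩, hc, hm⟩ := h
    refine ⟨hm, ?_⟩
    have := congrFun hc j
    simpa only [vCmt, if_neg hj, if_neg hj'] using this
  · rw [cand_found] at h
    exact ⟨fun he => h.2 (Sum.inr_injective (Sum.inr_injective he)), by rw [← hd.2, ← hd'.2, h.1]⟩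
  · rw [cand_found] at h
    exact ⟨fun he => h.2 (Sum.inl_injective (Sum.inr_injective he)), congrFun h.1 d⟩
  · rw [cand_found] at h
    exact isSolution_of_certified h

variable {P : Prims S} {M : Inst S} {T T' : Transcript S}

/-- Transcripts whose commitments or openings disagree yield a collision. -/
theorem findOutput_of_incons (hT : Accepts P M T) (hT' : Accepts P M T') (h0 : T.1 = T'.1)
    (h : vCmt P T.2.2.2.1 T.2.2.2.2 ≠ vCmt P T'.2.2.2.1 T'.2.2.2.2 ∨
      ∃ j, j ≠ T.2.2.2.1 ∧ j ≠ T'.2.2.2.1 ∧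
        (vOpen P T.2.2.2.1 T.2.2.2.2 j).1 ≠ (vOpen P T'.2.2.2.1 T'.2.2.2.2 j).1) :
    (findOutput P M T T').1 = true := by
  unfold findOutput
  rw [if_pos ⟨hT, hT', h0⟩, orElse_found, orElse_found]
  by_cases hc : vCmt P T.2.2.2.1 T.2.2.2.2 = vCmt P T'.2.2.2.1 T'.2.2.2.2
  · obtain ⟨j, hj, hj', hm⟩ := h.resolve_left (not_not.2 hc)
    exact Or.inr (Or.inl (firstOf_found (i := j) (cand_found.2 ⟨⟨hj, hj'⟩, hc, hm⟩)))
  · exact Or.inl (cand_found.2 hc)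

/-- Equal h_1 means that the broadcasts coincide unless the hash function collides. Coinciding
broadcasts with different hidden leaves force v = 0 on the committed shares, by `totalV_eq_zero`.
The hypothesis `hF` says that the first challenge is not a false positive for these shares. -/
theorem findOutput_of_row (hT : Accepts P M T) (hT' : Accepts P M T') (h0 : T.1 = T'.1)
    (hch : T.2.1 = T'.2.1) (h1 : T.2.2.1 = T'.2.2.1) (hi : T.2.2.2.1 ≠ T'.2.2.2.1)
    (sh : Leaf S → Msg S) (hsh : ∀ j, j ≠ T.2.2.2.1 → (vOpen P T.2.2.2.1 T.2.2.2.2 j).1 = sh j)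
    (hsh' : ∀ j, j ≠ T'.2.2.2.1 → (vOpen P T'.2.2.2.1 T'.2.2.2.2 j).1 = sh j)
    (hF : totalV M T.2.1 (aggregate (fun j => msgShare P (sh j)) Finset.univ) = 0 →
      Certified M (aggregate (fun j => msgShare P (sh j)) Finset.univ)) :
    (findOutput P M T T').1 = true := by
  unfold findOutput
  rw [if_pos ⟨hT, hT', h0⟩]
  simp only [orElse_found]
  by_cases hd : vDigests P M T.2.1 T.2.2.2.1 T.2.2.2.2 = vDigests P M T'.2.1 T'.2.2.2.1 T'.2.2.2.2
  swap
  · exact Or.inr (Or.inr (Or.inl (cand_found.2 ⟨h1, hd⟩)))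
  by_cases hb : ∀ d, vBroadcast P M T.2.1 T.2.2.2.1 T.2.2.2.2 d =
      vBroadcast P M T'.2.1 T'.2.2.2.1 T'.2.2.2.2 d
  swap
  · obtain ⟨d, hb⟩ := not_forall.1 hb
    exact Or.inr (Or.inr (Or.inr (Or.inl (firstOf_found (i := d) (cand_found.2 ⟨hd, hb⟩)))))
  have e1 : ∀ j, j ≠ T.2.2.2.1 → vShare P T.2.2.2.1 T.2.2.2.2 j = msgShare P (sh j) :=
    fun j hj => by rw [← hsh j hj, vOpen, msgShare_leafState, vShare]
  have e2 : ∀ j, j ≠ T'.2.2.2.1 → vShare P T'.2.2.2.1 T'.2.2.2.2 j = msgShare P (sh j) :=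
    fun j hj => by rw [← hsh' j hj, vOpen, msgShare_leafState, vShare]
  have em : mergedShare P T T' = fun j => msgShare P (sh j) := by
    funext j
    unfold mergedShare
    split_ifs with hj
    · exact e2 j (hj ▸ hi)
    · exact e1 j hj
  refine Or.inr (Or.inr (Or.inr (Or.inr ?_)))
  rw [cand_found, em]
  refine hF (totalV_eq_zero M T.2.1 hi T.2.2.2.2.2.1 T'.2.2.2.2.2.1 _ fun d => ?_)
  have := hb d
  rw [vBroadcast, vBroadcast, ← hch, checkDim_congr M T.2.1 T.2.2.2.1 _ e1,
    checkDim_congr M T.2.1 T'.2.2.2.1 _ e2] at this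
  exact this

end Extraction

/-! ### Cost of the search for an output -/

namespace PC

variable {lam : ℕ} {S : Params lam} {α : Type} {e : ℕ}

theorem orElse {f g : Prims S → α → Bool × Output S} (hf : PC S e f) (hg : PC S e g) :
    PC S (e + 3) (fun P a => MinRankPoK.orElse (f P a) (g P a)) := by
  have h : PC S (e + 1) (fun P a => decide ((f P a).1 = true)) := by simpa using hf.fst
  exact (ite h hf hg).mono (by omega)

theorem firstOf {ι : Type} [Fintype ι] [Small S ι] {f : Prims S → α → ι → Bool × Output S}
    (hf : ∀ i, PC S e (fun P a => f P a i)) :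
    PC S (e + 6) (fun P a => MinRankPoK.firstOf (f P a)) :=
  (foldr (e := e + 4) (op := MinRankPoK.orElse)
    ((orElse (e := 1) ((of_one Computes.fst).mono (by omega))
      ((of_one Computes.snd).mono (by omega))).mono (by omega)) (false, Sum.inl 0)
    (fun i => (hf i).mono (by omega)) (Finset.univ : Finset ι).toList
    (by rw [Finset.length_toList]; exact Small.card_le)).mono (by omega)

theorem linMap {b : Prims S → α → Fin S.r → S.Fqm} {x : Prims S → α → S.Fqm} (hb : PC S e b)
    (hx : PC S e x) : PC S (e + 10) (fun P a => MinRankPoK.linMap S.Fq (b P a) (x P a)) := by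
  have := ((hx.frob S.r r_le_size).addm (summ fun l : Fin S.r => (hb.proj l).mulm
    (hx.frob l (l.2.le.trans r_le_size)))).mono (e' := e + 10) (by omega)
  simp only [linMap_apply]
  exact this

open Classical in
theorem certified {M : Prims S → α → Inst S} {s : Prims S → α → Share S} (hM : PC S e M)
    (hs : PC S e s) : PC S (e + 60) (fun P a => decide (Certified (M P a) (s P a))) := by
  refine (PC.congr_dec (PC.mono (e' := e + 60) (all (e := e + 50) fun j => ((eqd eqTest_Fqm (linMap (e := e + 20) (hs.snd.fst.mono (by omega))
    ((column (E := fun P a => matE (M P a) (s P a).1) (e := e + 10) j fun b => ?_).mono (by omega)))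
    (const 0)).mono (by omega))) (by omega)) fun _ _ => Iff.rfl)
  simp only [matE, Matrix.of_apply]
  exact ((((hM.proj 0).proj b).proj j).addq
    (sumq fun i => (hs.fst.proj i).mulq (((hM.proj i.succ).proj b).proj j))).mono (by omega)

theorem cand {c : Prims S → α → Prop} {_ : ∀ P a, Decidable (c P a)} {o : Prims S → α → Output S}
    (hc : PC S e (fun P a => decide (c P a))) (ho : PC S e o) :
    PC S (e + 1) (fun P a => MinRankPoK.cand (c P a) (o P a)) :=
  ((hc.congr_dec fun _ _ => Iff.rfl).pair ho).mono (by omega)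

variable {M : Prims S → α → Inst S} {T T' : Prims S → α → Transcript S}

theorem mergedShare (hT : PC S e T) (hT' : PC S e T') (j : Leaf S) :
    PC S (e + 40) (fun P a => MinRankPoK.mergedShare P (T P a) (T' P a) j) :=
  ((eqd (eqTest_bits S.D_le_size) (const j) hT.snd.snd.snd.fst).ite
    (vShare (e := e + 10) (hT'.snd.snd.snd.fst.mono (by omega))
      (hT'.snd.snd.snd.snd.mono (by omega)) j)
    (vShare (e := e + 10) (hT.snd.snd.snd.fst.mono (by omega))
      (hT.snd.snd.snd.snd.mono (by omega)) j)).mono (by omega)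

set_option maxHeartbeats 1000000 in
open Classical in
theorem findOutput (hM : PC S e M) (hT : PC S e T) (hT' : PC S e T') :
    PC S (e + 500) (fun P a => MinRankPoK.findOutput P (M P a) (T P a) (T' P a)) := by
  have hM1 : PC S (e + 10) M := hM.mono (by omega)
  have hc : PC S (e + 10) (fun P a => (T P a).2.1) := hT.snd.fst.mono (by omega)
  have hc' : PC S (e + 10) (fun P a => (T' P a).2.1) := hT'.snd.fst.mono (by omega)
  have hi : PC S (e + 10) (fun P a => (T P a).2.2.2.1) := hT.snd.snd.snd.fst.mono (by omega)
  have hi' : PC S (e + 10) (fun P a => (T' P a).2.2.2.1) := hT'.snd.snd.snd.fst.mono (by omega)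
  have hr : PC S (e + 10) (fun P a => (T P a).2.2.2.2) := hT.snd.snd.snd.snd.mono (by omega)
  have hr' : PC S (e + 10) (fun P a => (T' P a).2.2.2.2) := hT'.snd.snd.snd.snd.mono (by omega)
  have hC := vCmt hi hr
  have hC' := vCmt hi' hr'
  have hH := vDigests hM1 hc hi hr
  have hH' := vDigests hM1 hc' hi' hr'
  have hCe := eqd (EqTest.pi (ι := Leaf S) (eqTest_bits (S := S) (w := S.lenCmt)
    (by unfold Params.size; omega))) hC hC'
  have hHe := eqd (EqTest.pi (ι := Fin S.D) (eqTest_digest (S := S))) hH hH'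
  -- Programs have no case distinction on sum types. The leaf j is fixed while the program is
  -- written, so the kind of message is known and only its components are compared.
  have hm : ∀ j, PC S (e + 100) (fun P a => decide
      ((MinRankPoK.vOpen P (T P a).2.2.2.1 (T P a).2.2.2.2 j).1 =
        (MinRankPoK.vOpen P (T' P a).2.2.2.1 (T' P a).2.2.2.2 j).1)) := fun j => by
    have h1 := eqd (eqTest_bits (S := S) (w := lam) (by unfold Params.size; omega))
      (vSeed (e := e + 20) (hi.mono (by omega)) (hr.snd.snd.fst.mono (by omega)) j).fst
      (vSeed (e := e + 20) (hi'.mono (by omega)) (hr'.snd.snd.fst.mono (by omega)) j).fst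
    by_cases hj : j = lastLeaf S
    · have h2 := eqd (EqTest.prod (EqTest.pi (ι := Fin S.k) (eqTest_Fq (S := S)))
        (EqTest.prod (EqTest.pi (ι := Fin S.r) eqTest_Fqm) eqTest_Fqme))
        hr.snd.snd.snd hr'.snd.snd.snd
      refine ((h1.conj h2).congr_dec fun P a => ?_).mono (by omega)
      simp only [MinRankPoK.vOpen, MinRankPoK.leafState, if_pos hj, Sum.inr.injEq, Prod.mk.injEq]
    · refine (h1.congr_dec fun P a => ?_).mono (by omega)
      simp only [MinRankPoK.vOpen, MinRankPoK.leafState, if_neg hj, Sum.inl.injEq]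
  have hb := vBroadcast hM1 hc hi hr
  have hb' := vBroadcast hM1 hc' hi' hr'
  have hbe := fun d => eqd (EqTest.pi (ι := Bool) (EqTest.prod (EqTest.pi (ι := Fin S.r)
    (eqTest_Fqme (S := S))) (eqTest_Fqme (S := S)))) (hb d) (hb' d)
  have hag := aggregate (e := e + 50) (A := fun _ _ => Finset.univ) (sh := fun P a =>
    MinRankPoK.mergedShare P (T P a) (T' P a)) (fun l => by simpa using (const true).mono (by omega))
    (fun l => (mergedShare hT hT' l).mono (by omega))
  have k1 := cand (e := e + 400) (hCe.neg.mono (by omega))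
    ((hC.inl.pair hC'.inl).inr.inr.mono (by omega))
  have k2 := fun j => cand (e := e + 400)
    ((((eqd (eqTest_bits S.D_le_size) (const j) hi).neg.conj
      (eqd (eqTest_bits S.D_le_size) (const j) hi').neg).conj (hCe.conj (hm j).neg)).mono (by omega))
    (((vOpen hi hr j).pair (vOpen hi' hr' j)).inl.inr.mono (by omega))
  have k3 := cand (e := e + 400)
    (((eqd (eqTest_digest (S := S)) hT.snd.snd.fst hT'.snd.snd.fst).conj hHe.neg).mono (by omega))
    ((hH.inr.inr.pair hH'.inr.inr).inr.inr.mono (by omega))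
  have k4 := fun d => cand (e := e + 400) ((hHe.conj (hbe d).neg).mono (by omega))
    ((((hb d).inl.inr).pair ((hb' d).inl.inr)).inr.inr.mono (by omega))
  have k5 := cand (e := e + 400) ((certified (e := e + 100) (hM.mono (by omega))
    (hag.mono (by omega))).mono (by omega))
    (hag.fst.inl.mono (by omega))
  have hg := (accepts hM hT).conj ((accepts hM hT').conj
    (eqd (eqTest_digest (S := S)) hT.fst hT'.fst))
  have h4 := orElse (e := e + 410) ((firstOf k4).mono (by omega)) (k5.mono (by omega))
  have h3 := orElse (e := e + 420) (k3.mono (by omega)) (h4.mono (by omega))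
  have h2 := orElse (e := e + 430) ((firstOf k2).mono (by omega)) (h3.mono (by omega))
  have h1 := orElse (e := e + 440) (k1.mono (by omega)) (h2.mono (by omega))
  have := (hg.ite h1 (const (false, (Sum.inl 0 : Output S)))).mono (e' := e + 500) (by omega)
  convert this using 3 with P a
  unfold MinRankPoK.findOutput
  congr

end PC

/-! ### The extractor -/

section Extractor

variable {lam : ℕ}

open Classical in
/-- In the state `(c, T)` with `c = 0` the extractor starts the prover afresh. Otherwise `T` is an
accepted transcript for the current tape, and the `c`-th trial looks for a second one: the first `R`
trials keep the first challenge, the next `2 R` trials choose both challenges afresh. -/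
def rewinder (S : Params lam) (R : ℕ) : Extractor S where
  State := ℕ × Transcript S
  init := (0, fun _ => false, (0, 0), fun _ => false, fun _ => false, fun _ => false, 0, fun _ _ => false, 0)
  query := fun _ a =>
    if a.1.2.1 < 1 then (true, a.2)
    else if a.1.2.1 < R + 1 then (false, (a.1.2.2.2.1, a.2.2)) else (false, a.2)
  update := fun P a =>
    if a.1.2.1 < 1 then
      if Accepts P a.1.1 a.2 then Sum.inl (1, a.2) else Sum.inl (0, a.1.2.2)
    else if (findOutput P a.1.1 a.1.2.2 a.2).1 = true then
      Sum.inr (findOutput P a.1.1 a.1.2.2 a.2).2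
    else if a.1.2.1 < 3 * R then Sum.inl (a.1.2.1 + 1, a.1.2.2) else Sum.inl (0, a.1.2.2)

/-- The number R enters only through constants in comparisons of counters, at unit cost, so the
bound is uniform in R and hence in the success probability. -/
theorem rewinder_stepTime : ∃ C : ℕ, ∀ (lam : ℕ) (S : Params lam) (R : ℕ),
    (rewinder S R).StepTime (C * S.size ^ C) := by
  refine ⟨600, fun lam S R => ?_⟩
  have lt' : ∀ {α : Type} {e : ℕ} {f : Prims S → α → ℕ} (b : ℕ), PC S e f →
      PC S (e + 3) (fun P a => decide (f P a < b)) := fun b hf =>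
    (PC.op (g := fun _ (a : ℕ × ℕ) => decide (a.1 < a.2)) Computes.lt
      (hf.pair (PC.const b))).mono (by omega)
  have hq : PC S 500 (rewinder S R).query := by
    have v : PC S 0 (fun _ (a : (Inst S × ℕ × Transcript S) × (Ch1 S × Leaf S)) => a) := PC.var
    exact ((lt' 1 v.fst.snd.fst).ite ((PC.const true).pair v.snd)
      ((lt' (R + 1) v.fst.snd.fst).ite ((PC.const false).pair
        (v.fst.snd.snd.snd.fst.pair v.snd.snd)) ((PC.const false).pair v.snd))).mono (by omega)
  have hu : PC S 550 (rewinder S R).update := by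
    have v : PC S 0 (fun _ (a : (Inst S × ℕ × Transcript S) × Transcript S) => a) := PC.var
    have hf := PC.findOutput (e := 10) (v.fst.fst.mono (by omega)) (v.fst.snd.snd.mono (by omega))
      (v.snd.mono (by omega))
    have hb : PC S 511 (fun P (a : (Inst S × ℕ × Transcript S) × Transcript S) =>
      decide ((findOutput P a.1.1 a.1.2.2 a.2).1 = true)) := by simpa using hf.fst
    exact ((lt' 1 v.fst.snd.fst).ite
      ((PC.accepts (e := 10) (v.fst.fst.mono (by omega)) (v.snd.mono (by omega))).ite
        ((PC.const 1).pair v.snd).inl ((PC.const 0).pair v.fst.snd.snd).inl)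
      (hb.ite hf.snd.inr ((lt' (3 * R) v.fst.snd.fst).ite
        ((PC.op Computes.succ v.fst.snd.fst).pair v.fst.snd.snd).inl
        ((PC.const 0).pair v.fst.snd.snd).inl))).mono (by omega)
  obtain ⟨s₁, h1, hq⟩ := hq.mono (show 500 ≤ 600 by norm_num)
  obtain ⟨s₂, h2, hu⟩ := hu.mono (show 550 ≤ 600 by norm_num)
  refine ⟨s₁, s₂, hq, hu, ?_⟩
  generalize S.size ^ 600 = c at h1 h2 ⊢
  omega

theorem rewinder_update_valid {S : Params lam} (R : ℕ) (P : Prims S)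
    (a : (Inst S × ℕ × Transcript S) × Transcript S) (o : Output S)
    (h : (rewinder S R).update P a = Sum.inr o) : ValidOutput P a.1.1 o := by
  simp only [rewinder] at h
  split_ifs at h with h1 h2 h3
  obtain rfl := Sum.inr_injective h
  exact soundFind_findOutput P _ _ _ h3

/-- An output, once produced, stays. Its validity is thus that of the single update that produced
it, whatever the transcript was. -/
theorem Extractor.run_valid {S : Params lam} (E : Extractor S) (P : Prims S) (M : Inst S)
    (Pt : CheatingProver S)
    (hE : ∀ a o, E.update P a = Sum.inr o → ValidOutput P a.1.1 o) (t : ℕ) (o : Output S)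
    (h : Sum.inr o ∈ (E.run P M Pt t).support) : ValidOutput P M o := by
  induction t with
  | zero => simp [Extractor.run] at h
  | succ t ih =>
    rw [Extractor.run, PMF.mem_support_bind_iff] at h
    obtain ⟨c, hc, h⟩ := h
    rcases c with c | o'
    · replace h : Sum.inr o ∈ (E.step P M Pt c).support := h
      rw [Extractor.step, PMF.mem_support_bind_iff] at h
      obtain ⟨coins, -, h⟩ := h
      rw [PMF.mem_support_map_iff] at h
      obtain ⟨τ, -, h⟩ := h
      generalize hu : E.update P _ = y at h
      rcases y with st | o'
      · exact absurd h Sum.inl_ne_inr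
      · obtain rfl := Sum.inr_injective h
        have := hE _ _ hu
        exact this
    · simp only [PMF.support_pure, Set.mem_singleton_iff, Sum.inr.injEq] at h
      subst h
      exact ih hc

end Extractor

end MinRankPoK

end

open scoped ENNReal

noncomputable section

namespace MinRankPoK

/-! ### Expectations -/

section Expect

variable {α β : Type}

/-- The expectation of a nonnegative function. -/
def expect (μ : PMF α) (f : α → ℝ≥0∞) : ℝ≥0∞ := ∑' a, μ a * f a

theorem expect_pure (a : α) (f : α → ℝ≥0∞) : expect (PMF.pure a) f = f a := by
  classical
  unfold expect
  rw [tsum_eq_single a fun b hb => by simp [PMF.pure_apply, hb]]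
  simp

theorem expect_bind (μ : PMF α) (k : α → PMF β) (f : β → ℝ≥0∞) :
    expect (μ.bind k) f = expect μ fun a => expect (k a) f := by
  unfold expect
  simp_rw [PMF.bind_apply, ← ENNReal.tsum_mul_right, ← ENNReal.tsum_mul_left]
  rw [ENNReal.tsum_comm]
  simp_rw [mul_assoc]

theorem expect_map (μ : PMF α) (g : α → β) (f : β → ℝ≥0∞) :
    expect (μ.map g) f = expect μ fun a => f (g a) := by
  rw [← PMF.bind_pure_comp, expect_bind]
  simp [expect_pure]

theorem expect_mono (μ : PMF α) {f g : α → ℝ≥0∞} (h : ∀ a, f a ≤ g a) :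
    expect μ f ≤ expect μ g :=
  ENNReal.tsum_le_tsum fun a => mul_le_mul_right (h a) _

theorem expect_add (μ : PMF α) (f g : α → ℝ≥0∞) :
    (expect μ fun a => f a + g a) = expect μ f + expect μ g := by
  unfold expect
  rw [← ENNReal.tsum_add]
  simp_rw [mul_add]

theorem expect_const (μ : PMF α) (c : ℝ≥0∞) : (expect μ fun _ => c) = c := by
  unfold expect
  rw [ENNReal.tsum_mul_right, μ.tsum_coe, one_mul]

theorem expect_mul_left (μ : PMF α) (c : ℝ≥0∞) (f : α → ℝ≥0∞) :
    (expect μ fun a => c * f a) = c * expect μ f := by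
  unfold expect
  rw [← ENNReal.tsum_mul_left]
  simp_rw [mul_left_comm]

open Classical in
theorem toOuterMeasure_eq_expect (μ : PMF α) (s : Set α) :
    μ.toOuterMeasure s = expect μ fun a => if a ∈ s then 1 else 0 := by
  unfold expect
  rw [PMF.toOuterMeasure_apply]
  simp [Set.indicator_apply]

theorem expect_uniform [Fintype α] [Nonempty α] (f : α → ℝ) (hf : ∀ a, 0 ≤ f a) :
    (expect (PMF.uniformOfFintype α) fun a => ENNReal.ofReal (f a)) =
      ENNReal.ofReal ((∑ a, f a) / Fintype.card α) := by
  unfold expect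
  have hc : (0 : ℝ) < Fintype.card α := by exact_mod_cast Fintype.card_pos
  rw [tsum_fintype, ENNReal.ofReal_div_of_pos hc, ENNReal.ofReal_sum_of_nonneg fun a _ => hf a,
    ENNReal.div_eq_inv_mul, Finset.mul_sum, ENNReal.ofReal_natCast]
  simp

end Expect

/-! ### Expected number of calls -/

section Calls

variable {lam : ℕ} {S : Params lam} (E : Extractor S) (P : Prims S) (M : Inst S)
  (Pt : CheatingProver S)

/-- A potential which decreases by at least one in each step bounds the expected number of calls. -/
theorem Extractor.expectedCalls_le (V : Option Pt.Tape × E.State → ℝ≥0∞)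
    (hV : ∀ c, 1 + expect (E.step P M Pt c) (Sum.elim V fun _ => 0) ≤ V c) :
    E.expectedCalls P M Pt ≤ V (none, E.init) := by
  -- Expected calls so far plus expected remaining potential never increase. Once an output is
  -- reached the potential is zero and no calls are counted.
  have key : ∀ n : ℕ, ∑ t ∈ Finset.range n, (E.run P M Pt t).toOuterMeasure (Set.range Sum.inl) +
      expect (E.run P M Pt n) (Sum.elim V fun _ => 0) ≤ V (none, E.init) := by
    intro n
    induction n with
    | zero => simp [Extractor.run, expect_pure]
    | succ n ih =>
      refine le_trans ?_ ih
      rw [Finset.sum_range_succ, add_assoc]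
      refine add_le_add_right ?_ _
      rw [toOuterMeasure_eq_expect, Extractor.run, expect_bind, ← expect_add]
      refine expect_mono _ fun c => ?_
      rcases c with c | o
      · simpa using hV c
      · simp [expect_pure]
  unfold Extractor.expectedCalls
  rw [ENNReal.tsum_eq_iSup_nat]
  exact iSup_le fun n => le_self_add.trans (key n)

theorem Extractor.expect_step (c : Option Pt.Tape × E.State) (V : Option Pt.Tape × E.State → ℝ≥0∞) :
    expect (E.step P M Pt c) (Sum.elim V fun _ => 0) =
      expect (PMF.uniformOfFintype (Ch1 S × Leaf S)) fun coins =>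
        expect (match (E.query P ((M, c.2), coins)).1, c.1 with
          | false, some τ => PMF.pure τ
          | _, _ => Pt.tape) fun τ =>
          Sum.elim (fun st => V (some τ, st)) (fun _ => 0) (E.update P ((M, c.2), Pt.transcript τ
            (E.query P ((M, c.2), coins)).2.1 (E.query P ((M, c.2), coins)).2.2)) := by
  rw [Extractor.step, expect_bind]
  congr 1
  funext coins
  rw [expect_map]
  congr 1
  funext τ
  generalize E.update P _ = y
  cases y <;> rfl

end Calls

/-! ### Real inequalities -/

section Real

/-- With y = R(u + 2v), independent trials all fail with probability at most e^(-y) ≤ 1 / (1 + y).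
-/
theorem gain_le_one_sub_pow {u v : ℝ} (R : ℕ) (hu0 : 0 ≤ u) (hu1 : u ≤ 1) (hv0 : 0 ≤ v)
    (hv1 : v ≤ 1) : gain R (u + 2 * v) ≤ 1 - (1 - u) ^ R * (1 - v) ^ (2 * R) := by
  set y : ℝ := R * (u + 2 * v) with hy
  have hy0 : 0 ≤ y := by positivity
  have h1 : (1 - u) ^ R * (1 - v) ^ (2 * R) ≤ Real.exp (-y) := by
    have e1 : (1 - u) ^ R ≤ Real.exp (-u) ^ R :=
      pow_le_pow_left₀ (by linarith) (Real.one_sub_le_exp_neg u) _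
    have e2 : (1 - v) ^ (2 * R) ≤ Real.exp (-v) ^ (2 * R) :=
      pow_le_pow_left₀ (by linarith) (Real.one_sub_le_exp_neg v) _
    refine (mul_le_mul e1 e2 (pow_nonneg (by linarith) _) (by positivity)).trans_eq ?_
    rw [← Real.exp_nat_mul, ← Real.exp_nat_mul, ← Real.exp_add]
    congr 1
    push_cast
    ring
  have h2 : Real.exp (-y) ≤ 1 / (1 + y) := by
    rw [Real.exp_neg, ← one_div]
    exact one_div_le_one_div_of_le (by linarith) (by linarith [Real.add_one_le_exp y])
  have h3 : gain R (u + 2 * v) = 1 - 1 / (1 + y) := by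
    unfold gain
    rw [← hy]
    field_simp
    ring
  linarith

/-- The tangent to `t ↦ t * gain R t` at `Δ` has slope `κ`. -/
theorem exists_tangent {R Δ : ℝ} (hR : 0 ≤ R) (hΔ : 0 < Δ) :
    ∃ κ : ℝ, 0 ≤ κ ∧ Δ * gain R Δ ≤ κ * Δ ∧
      ∀ t, 0 < t → Δ * gain R Δ + κ * (t - Δ) ≤ t * gain R t := by
  have h1 : 0 < 1 + R * Δ := by positivity
  -- The derivative of R t² / (1 + R t) at Δ. The extra inequality says that the tangent is
  -- nonpositive at 0, which later handles tapes with acceptance rate below the soundness error.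
  refine ⟨(2 * R * Δ + R ^ 2 * Δ ^ 2) / (1 + R * Δ) ^ 2, by positivity, ?_, fun t ht => ?_⟩
  · unfold gain
    rw [← mul_div_assoc, div_mul_eq_mul_div, div_le_div_iff₀ h1 (by positivity)]
    have : 0 ≤ (1 + R * Δ) * (R * Δ ^ 2) := by positivity
    nlinarith
  · have h2 : 0 < 1 + R * t := by positivity
    have : t * gain R t - (Δ * gain R Δ + (2 * R * Δ + R ^ 2 * Δ ^ 2) / (1 + R * Δ) ^ 2 * (t - Δ)) =
        R * (t - Δ) ^ 2 / ((1 + R * Δ) ^ 2 * (1 + R * t)) := by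
      unfold gain
      field_simp
      ring
    have h3 : 0 ≤ R * (t - Δ) ^ 2 / ((1 + R * Δ) ^ 2 * (1 + R * t)) := by positivity
    linarith

/-- With R the integer part, (R + 1)e > 1 and Re ≥ e, so 2Re > 1. -/
theorem floor_inv_mul {e : ℝ} (h0 : 0 < e) (h1 : e ≤ 1) :
    1 ≤ ⌊1 / e⌋₊ ∧ 1 / 2 ≤ (⌊1 / e⌋₊ : ℝ) * e ∧ (⌊1 / e⌋₊ : ℝ) * e ≤ 1 := by
  have hR : 1 ≤ ⌊1 / e⌋₊ := Nat.le_floor (by rw [Nat.cast_one, le_div_iff₀ h0]; linarith)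
  have hR' : (1 : ℝ) ≤ ⌊1 / e⌋₊ := by exact_mod_cast hR
  have h2 : (⌊1 / e⌋₊ : ℝ) ≤ 1 / e := Nat.floor_le (by positivity)
  have h3 := Nat.lt_floor_add_one (1 / e)
  rw [le_div_iff₀ h0] at h2
  rw [div_lt_iff₀ h0] at h3
  refine ⟨hR, ?_, h2⟩
  have : e ≤ (⌊1 / e⌋₊ : ℝ) * e := le_mul_of_one_le_left h0.le hR'
  nlinarith

theorem calls_bound {e Δ R : ℝ} (hΔ : 0 < Δ) (he : Δ ≤ e) (hR : 0 < R) (h1 : 1 / 2 ≤ R * e)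
    (h2 : R * e ≤ 1) :
    (1 + 3 * (R * e)) / (Δ * gain R Δ) ≤ 4 / Δ * (1 + e * (2 * Real.log 2 / Δ)) := by
  have he0 : 0 < e := hΔ.trans_le he
  have hl : (69 : ℝ) / 100 ≤ Real.log 2 := by linarith [Real.log_two_gt_d9]
  set ρ := R * e with hρ
  have hρ0 : 0 < ρ := by linarith
  have hR' : R = ρ / e := by rw [hρ]; field_simp
  have e1 : (1 + 3 * ρ) / (Δ * gain R Δ) = (1 + 3 * ρ) * (e / ρ + Δ) / Δ ^ 2 := by
    unfold gain
    rw [hR']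
    field_simp
  have e2 : 4 / Δ * (1 + e * (2 * Real.log 2 / Δ)) = (4 * Δ + 8 * Real.log 2 * e) / Δ ^ 2 := by
    field_simp
    ring
  rw [e1, e2]
  refine div_le_div_of_nonneg_right ?_ (by positivity)
  -- The chord of the convex function 1/ρ over [1/2, 1]. It bounds the coefficient 3 + 1/ρ of e by 6
  -- - 2ρ ≤ 5 < 8 ln 2, while that of Δ is 1 + 3ρ ≤ 4.
  have e3 : 1 / ρ ≤ 3 - 2 * ρ := by
    rw [div_le_iff₀ hρ0]
    nlinarith
  have e4 : e / ρ ≤ e * (3 - 2 * ρ) := by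
    rw [div_eq_mul_one_div]
    exact mul_le_mul_of_nonneg_left e3 he0.le
  have e5 : (1 + 3 * ρ) * (e / ρ + Δ) = e / ρ + 3 * e + (1 + 3 * ρ) * Δ := by
    field_simp
  rw [e5]
  nlinarith

end Real

end MinRankPoK

end

open scoped ENNReal

noncomputable section

namespace MinRankPoK

/-! ### Success of the trials -/

section Trials

variable {lam : ℕ} {S : Params lam} (P : Prims S) (M : Inst S) (Pt : CheatingProver S)

/-- The probability that a trial with the first challenge of `T` fails. -/
def missRow (τ : Pt.Tape) (T : Transcript S) : ℝ :=
  ((Finset.univ.filter fun c : Ch1 S × Leaf S =>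
    (findOutput P M T (Pt.transcript τ T.2.1 c.2)).1 = false).card : ℝ) /
    Fintype.card (Ch1 S × Leaf S)

/-- The probability that a trial with fresh challenges fails. -/
def missAll (τ : Pt.Tape) (T : Transcript S) : ℝ :=
  ((Finset.univ.filter fun c : Ch1 S × Leaf S =>
    (findOutput P M T (Pt.transcript τ c.1 c.2)).1 = false).card : ℝ) /
    Fintype.card (Ch1 S × Leaf S)

theorem card_filter_div_le_one {α : Type} [Fintype α] [Nonempty α] (p : α → Prop)
    [DecidablePred p] : 0 ≤ ((Finset.univ.filter p).card : ℝ) / Fintype.card α ∧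
      ((Finset.univ.filter p).card : ℝ) / Fintype.card α ≤ 1 := by
  have hc : (0 : ℝ) < Fintype.card α := by exact_mod_cast Fintype.card_pos
  refine ⟨by positivity, ?_⟩
  rw [div_le_one hc]
  exact_mod_cast Finset.card_le_univ _

theorem missRow_mem (τ : Pt.Tape) (T : Transcript S) :
    0 ≤ missRow P M Pt τ T ∧ missRow P M Pt τ T ≤ 1 := card_filter_div_le_one _

theorem missAll_mem (τ : Pt.Tape) (T : Transcript S) :
    0 ≤ missAll P M Pt τ T ∧ missAll P M Pt τ T ≤ 1 := card_filter_div_le_one _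

theorem one_sub_missAll (τ : Pt.Tape) (T : Transcript S) :
    1 - missAll P M Pt τ T = ((Finset.univ.filter fun c : Ch1 S × Leaf S =>
      (findOutput P M T (Pt.transcript τ c.1 c.2)).1 = true).card : ℝ) /
      (Fintype.card (Ch1 S) * Fintype.card (Leaf S)) := by
  have hc : (0 : ℝ) < Fintype.card (Ch1 S × Leaf S) := by exact_mod_cast Fintype.card_pos
  have := Finset.card_filter_add_card_filter_not (s := (Finset.univ : Finset (Ch1 S × Leaf S)))
    (fun c => (findOutput P M T (Pt.transcript τ c.1 c.2)).1 = true)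
  simp only [Bool.not_eq_true, Finset.card_univ] at this
  rw [missAll, eq_div_iff (by rw [← Nat.cast_mul, ← Fintype.card_prod]; exact hc.ne'),
    ← Nat.cast_mul, ← Fintype.card_prod, sub_mul, div_mul_cancel₀ _ hc.ne', ← this]
  push_cast
  ring

theorem one_sub_missRow (τ : Pt.Tape) (T : Transcript S) :
    1 - missRow P M Pt τ T = ((Finset.univ.filter fun i : Leaf S =>
      (findOutput P M T (Pt.transcript τ T.2.1 i)).1 = true).card : ℝ) / Fintype.card (Leaf S) := by
  have hc : (0 : ℝ) < Fintype.card (Ch1 S) := by exact_mod_cast Fintype.card_pos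
  have hn : (0 : ℝ) < Fintype.card (Leaf S) := by exact_mod_cast Fintype.card_pos
  have h1 : (Finset.univ.filter fun c : Ch1 S × Leaf S =>
      (findOutput P M T (Pt.transcript τ T.2.1 c.2)).1 = false) = Finset.univ ×ˢ
      (Finset.univ.filter fun i : Leaf S =>
        (findOutput P M T (Pt.transcript τ T.2.1 i)).1 = false) := by
    ext c
    simp
  have := Finset.card_filter_add_card_filter_not (s := (Finset.univ : Finset (Leaf S)))
    (fun i => (findOutput P M T (Pt.transcript τ T.2.1 i)).1 = true)
  simp only [Bool.not_eq_true, Finset.card_univ] at this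
  rw [missRow, h1, Finset.card_product, Fintype.card_prod, Finset.card_univ, Nat.cast_mul,
    Nat.cast_mul, mul_div_mul_left _ _ hc.ne', eq_div_iff hn.ne', sub_mul,
    div_mul_cancel₀ _ hn.ne', ← this]
  push_cast
  ring

open Classical in
/-- The accepted challenges of a tape. -/
def accSet (τ : Pt.Tape) : Finset (Ch1 S × Leaf S) :=
  Finset.univ.filter fun c => Accepts P M (Pt.transcript τ c.1 c.2)

/-- The fraction of accepted challenges of a tape. -/
def accRate (τ : Pt.Tape) : ℝ :=
  ((accSet P M Pt τ).card : ℝ) / (Fintype.card (Ch1 S) * Fintype.card (Leaf S))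

/-- The gain on one tape. -/
theorem tape_gain (τ : Pt.Tape) (R : ℕ) (ht : 0 < accRate P M Pt τ - soundnessError S) :
    ((Fintype.card (Ch1 S) : ℝ) * Fintype.card (Leaf S)) *
      ((accRate P M Pt τ - soundnessError S) * gain R (accRate P M Pt τ - soundnessError S)) ≤
    ∑ c ∈ accSet P M Pt τ, (1 - missRow P M Pt τ (Pt.transcript τ c.1 c.2) ^ R *
      missAll P M Pt τ (Pt.transcript τ c.1 c.2) ^ (2 * R)) := by
  classical
  have hc : (0 : ℝ) < Fintype.card (Ch1 S) := by exact_mod_cast Fintype.card_pos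
  have hn : (0 : ℝ) < Fintype.card (Leaf S) := by exact_mod_cast Fintype.card_pos
  have hacc : ∀ c, c ∈ accSet P M Pt τ ↔ Accepts P M (Pt.transcript τ c.1 c.2) := fun c => by
    simp [accSet]
  let D : Ch1 S × Leaf S → Leaf S → Cmt S := fun c => vCmt P c.2 (Pt.rsp τ c.1 c.2)
  let msg : Ch1 S × Leaf S → Leaf S → Msg S := fun c j => (vOpen P c.2 (Pt.rsp τ c.1 c.2) j).1
  -- The false positives of an assignment: challenges with v = 0 although the committed polynomial
  -- does not kill all e_j. The set is empty if it does.
  let F : (Leaf S → Cmt S) → (Leaf S → Msg S) → Finset (Ch1 S) := fun _ sh =>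
    Finset.univ.filter fun ch =>
      totalV M ch (aggregate (fun j => msgShare P (sh j)) Finset.univ) = 0 ∧
        ¬ Certified M (aggregate (fun j => msgShare P (sh j)) Finset.univ)
  refine (gain_le_sum (accSet P M Pt τ) D msg (R := R) (p := falsePositive S)
    (s := accRate P M Pt τ) (Nat.cast_nonneg R) (falsePositive_nonneg S).1 ?_ ?_ ht F ?_
    (fun c => 1 - missRow P M Pt τ (Pt.transcript τ c.1 c.2))
    (fun c => 1 - missAll P M Pt τ (Pt.transcript τ c.1 c.2)) ?_ ?_ ?_).trans
    (Finset.sum_le_sum fun c _ => ?_)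
  · rw [accRate, div_mul_cancel₀ _ (by positivity)]
  · rw [soundnessError, S.card_leaf]
  · intro d sh
    by_cases h : Certified M (aggregate (fun j => msgShare P (sh j)) Finset.univ)
    · simp only [F, h, not_true_eq_false, and_false, Finset.filter_false, Finset.card_empty,
        Nat.cast_zero]
      exact mul_nonneg (falsePositive_nonneg S).1 hc.le
    · simp only [F, h, not_false_eq_true, and_true]
      convert card_falsePositive M _ h
  · intro c
    linarith [(missRow_mem P M Pt τ (Pt.transcript τ c.1 c.2)).2]
  · intro c hcA
    rw [one_sub_missAll, inconsDensity]
    refine div_le_div_of_nonneg_right ?_ (by positivity)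
    refine Nat.cast_le.2 (Finset.card_le_card fun c' hc' => ?_)
    rw [Finset.mem_filter] at hc' ⊢
    exact ⟨Finset.mem_univ _, findOutput_of_incons ((hacc c).1 hcA) ((hacc c').1 hc'.1) rfl hc'.2⟩
  -- Every consistent accepted view of the row succeeds as a second view except the current one,
  -- whose hidden leaf is the same. This is the origin of the term -1.
  · intro c hcA d sh hcons hF
    rw [one_sub_missRow]
    refine div_le_div_of_nonneg_right ?_ hn.le
    rw [sub_le_iff_le_add, ← Nat.cast_add_one, Nat.cast_le]
    refine (Finset.card_le_card (t := insert c.2 _) fun i hi => ?_).trans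
      (Finset.card_insert_le _ _)
    simp only [Finset.mem_filter, Finset.mem_univ, true_and] at hi
    rw [Finset.mem_insert, Finset.mem_filter]
    refine or_iff_not_imp_left.2 fun hne => ⟨Finset.mem_univ _, ?_⟩
    refine findOutput_of_row (T := Pt.transcript τ c.1 c.2) (T' := Pt.transcript τ c.1 i)
      ((hacc c).1 hcA) ((hacc (c.1, i)).1 hi.1) rfl rfl rfl (fun h => hne h.symm) sh hcons.2
      hi.2.2 fun h0 => ?_
    by_contra hcert
    exact hF (Finset.mem_filter.2 ⟨Finset.mem_univ _, h0, hcert⟩)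
  · have h1 := missRow_mem P M Pt τ (Pt.transcript τ c.1 c.2)
    have h2 := missAll_mem P M Pt τ (Pt.transcript τ c.1 c.2)
    have := gain_le_one_sub_pow (u := 1 - missRow P M Pt τ (Pt.transcript τ c.1 c.2))
      (v := 1 - missAll P M Pt τ (Pt.transcript τ c.1 c.2)) R (by linarith) (by linarith)
      (by linarith) (by linarith)
    simpa only [sub_sub_cancel] using this

theorem soundnessError_nonneg : 0 ≤ soundnessError S := by
  have hN : (1 : ℝ) ≤ S.N := by exact_mod_cast S.N_pos
  have : 1 / (S.N : ℝ) ≤ 1 := by rw [div_le_one (by linarith)]; exact hN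
  have := mul_nonneg (falsePositive_nonneg S).1 (by linarith : 0 ≤ 1 - 1 / (S.N : ℝ))
  unfold soundnessError
  positivity

theorem accRate_nonneg (τ : Pt.Tape) : 0 ≤ accRate P M Pt τ := by unfold accRate; positivity

open Classical in
theorem expect_accRate :
    (expect Pt.tape fun τ => ENNReal.ofReal (accRate P M Pt τ)) =
      Pt.dist.toOuterMeasure {T | Accepts P M T} := by
  rw [toOuterMeasure_eq_expect, CheatingProver.dist, expect_bind]
  congr 1
  funext τ
  have h1 : ∀ ch : Ch1 S, (expect ((PMF.uniformOfFintype (Leaf S)).map fun i =>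
      Pt.transcript τ ch i) fun T => if T ∈ {T | Accepts P M T} then 1 else 0) =
      ENNReal.ofReal ((∑ i, if Accepts P M (Pt.transcript τ ch i) then (1 : ℝ) else 0) /
        Fintype.card (Leaf S)) := fun ch => by
    rw [expect_map, ← expect_uniform _ fun i => by split_ifs <;> norm_num]
    congr 1
    funext i
    simp only [Set.mem_ofPred_eq]
    split_ifs <;> simp
  rw [expect_bind]
  simp_rw [h1]
  rw [expect_uniform _ fun ch => by positivity]
  congr 1
  rw [← Finset.sum_div, div_div, accRate, mul_comm]
  congr 1
  rw [← Fintype.sum_prod_type (f := fun c : Ch1 S × Leaf S =>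
    if Accepts P M (Pt.transcript τ c.1 c.2) then (1 : ℝ) else 0), Finset.sum_boole, accSet]

end Trials

end MinRankPoK

end

open scoped ENNReal

noncomputable section

namespace MinRankPoK

/-! ### The expected number of calls of the extractor -/

section Potential

variable {lam : ℕ} {S : Params lam} (P : Prims S) (M : Inst S) (Pt : CheatingProver S)

/-- The probability that the `n`-th trial fails. -/
def missTrial (R n : ℕ) (τ : Pt.Tape) (T : Transcript S) : ℝ :=
  if n < R + 1 then missRow P M Pt τ T else missAll P M Pt τ T

theorem expect_uniform_ite {α : Type} [Fintype α] [Nonempty α] (p : α → Bool) (w : ℝ)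
    (hw : 0 ≤ w) : (expect (PMF.uniformOfFintype α) fun a =>
      if p a = true then 0 else ENNReal.ofReal w) =
    ENNReal.ofReal (((Finset.univ.filter fun a => p a = false).card : ℝ) / Fintype.card α * w) := by
  have : (fun a => if p a = true then 0 else ENNReal.ofReal w) =
      fun a => ENNReal.ofReal (if p a = false then w else 0) := by
    funext a
    cases p a <;> simp
  rw [this, expect_uniform _ fun a => by split_ifs <;> simp [hw]]
  congr 1
  rw [← Finset.sum_filter, Finset.sum_const, nsmul_eq_mul]
  ring

/-- Trials keep the tape, so only the extractor's coins are random and the state after failure is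
deterministic; w is its potential. -/
theorem expect_trial (R n : ℕ) (hn : 1 ≤ n) (τ : Pt.Tape) (T : Transcript S) (w : ℝ) (hw : 0 ≤ w)
    (V : Option Pt.Tape × (ℕ × Transcript S) → ℝ≥0∞)
    (hV : V (some τ, (if n < 3 * R then n + 1 else 0, T)) = ENNReal.ofReal w) :
    expect ((rewinder S R).step P M Pt (some τ, (n, T))) (Sum.elim V fun _ => 0) =
      ENNReal.ofReal (missTrial P M Pt R n τ T * w) := by
  have hn' : ¬ n < 1 := by omega
  have key : ∀ x : Ch1 S × Leaf S, Sum.elim (fun st => V (some τ, st)) (fun _ => 0)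
      ((rewinder S R).update P ((M, (n, T)), Pt.transcript τ x.1 x.2)) =
      if (findOutput P M T (Pt.transcript τ x.1 x.2)).1 = true then 0 else ENNReal.ofReal w := by
    intro x
    simp only [rewinder, if_neg hn']
    rw [← hV]
    split_ifs <;> rfl
  refine (Extractor.expect_step (rewinder S R) P M Pt (some τ, (n, T)) V).trans ?_
  by_cases h : n < R + 1
  · rw [missTrial, if_pos h, missRow, ← expect_uniform_ite
      (fun c : Ch1 S × Leaf S => (findOutput P M T (Pt.transcript τ T.2.1 c.2)).1) w hw]
    congr 1
    funext coins
    have hq : (rewinder S R).query P ((M, (n, T)), coins) = (false, (T.2.1, coins.2)) := by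
      simp only [rewinder, if_neg hn', if_pos h]
    dsimp only
    rw [hq]
    exact (expect_pure _ _).trans (key (T.2.1, coins.2))
  · rw [missTrial, if_neg h, missAll, ← expect_uniform_ite
      (fun c : Ch1 S × Leaf S => (findOutput P M T (Pt.transcript τ c.1 c.2)).1) w hw]
    congr 1
    funext coins
    have hq : (rewinder S R).query P ((M, (n, T)), coins) = (false, coins) := by
      simp only [rewinder, if_neg hn', if_neg h]
    dsimp only
    rw [hq]
    exact (expect_pure _ _).trans (key coins)

open Classical in
theorem expect_restart (R : ℕ) (t : Option Pt.Tape) (T : Transcript S)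
    (V : Option Pt.Tape × (ℕ × Transcript S) → ℝ≥0∞) :
    expect ((rewinder S R).step P M Pt (t, (0, T))) (Sum.elim V fun _ => 0) =
      expect (PMF.uniformOfFintype (Ch1 S × Leaf S)) fun c => expect Pt.tape fun τ =>
        if Accepts P M (Pt.transcript τ c.1 c.2) then V (some τ, (1, Pt.transcript τ c.1 c.2))
        else V (some τ, (0, T)) := by
  refine (Extractor.expect_step (rewinder S R) P M Pt (t, (0, T)) V).trans ?_
  congr 1
  funext coins
  have hq : (rewinder S R).query P ((M, (0, T)), coins) = (true, coins) := by
    simp only [rewinder, if_pos Nat.zero_lt_one]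
  dsimp only
  rw [hq]
  refine congrArg (expect Pt.tape) (funext fun τ => ?_)
  simp only [rewinder, if_pos Nat.zero_lt_one]
  split_ifs <;> rfl

/-- A bound on the remaining time: that of the current trials, and `B` if they all fail. -/
def potential (R : ℕ) (B : ℝ) : Option Pt.Tape × (ℕ × Transcript S) → ℝ≥0∞
  | (_, (0, _)) => ENNReal.ofReal B
  -- A trial without a tape is never reached from the initial state; the infinite value makes the
  -- potential inequality trivial there.
  | (none, (_ + 1, _)) => ⊤
  -- The current trial is number n + 1. The truncated difference counts it together with the later
  -- ones and stays at least 1 beyond 3R. The exponents count the remaining trials of each kind.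
  | (some τ, (n + 1, T)) => ENNReal.ofReal ((3 * R - (n + 1) + 1 : ℕ) +
      B * (missRow P M Pt τ T ^ (R - n) * missAll P M Pt τ T ^ min (3 * R - n) (2 * R)))

theorem expect_comm {α β : Type} (μ : PMF α) (ν : PMF β) (f : α → β → ℝ≥0∞) :
    (expect μ fun a => expect ν fun b => f a b) = expect ν fun b => expect μ fun a => f a b := by
  unfold expect
  simp_rw [← ENNReal.tsum_mul_left]
  rw [ENNReal.tsum_comm]
  simp_rw [mul_left_comm]

open Classical in
/-- One step from the idle state. -/
theorem restart_le {R : ℕ} {B Δ : ℝ} (hΔ : 0 < Δ) (hB : 0 ≤ B)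
    (hs : Pt.success P M = Δ + soundnessError S)
    (hR : B * (Δ * gain R Δ) = 1 + 3 * (R * (Δ + soundnessError S))) (hR1 : 1 ≤ R) :
    1 + (expect (PMF.uniformOfFintype (Ch1 S × Leaf S)) fun c => expect Pt.tape fun τ =>
      if Accepts P M (Pt.transcript τ c.1 c.2) then
        potential P M Pt R B (some τ, (1, Pt.transcript τ c.1 c.2))
      else ENNReal.ofReal B) ≤ ENNReal.ofReal B := by
  set ε := soundnessError S with hε
  have hε0 : 0 ≤ ε := soundnessError_nonneg
  obtain ⟨κ, hκ0, hκ, htan⟩ := exists_tangent (Nat.cast_nonneg R : (0 : ℝ) ≤ R) hΔ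
  have hc : (0 : ℝ) < Fintype.card (Ch1 S × Leaf S) := by exact_mod_cast Fintype.card_pos
  have hcc : (Fintype.card (Ch1 S × Leaf S) : ℝ) =
      Fintype.card (Ch1 S) * Fintype.card (Leaf S) := by
    rw [Fintype.card_prod, Nat.cast_mul]
  set g := Δ * gain R Δ with hg
  have hg0 : 0 ≤ g := mul_nonneg hΔ.le (gain_nonneg (Nat.cast_nonneg R) hΔ.le)
  -- the expectation for a fixed tape
  have htape : ∀ τ, (expect (PMF.uniformOfFintype (Ch1 S × Leaf S)) fun c =>
      if Accepts P M (Pt.transcript τ c.1 c.2) then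
        potential P M Pt R B (some τ, (1, Pt.transcript τ c.1 c.2))
      else ENNReal.ofReal B) + ENNReal.ofReal (B * g) +
        ENNReal.ofReal (B * κ) * ENNReal.ofReal (accRate P M Pt τ) ≤
      ENNReal.ofReal (3 * R) * ENNReal.ofReal (accRate P M Pt τ) +
        ENNReal.ofReal (B + B * κ * (Δ + ε)) := by
    intro τ
    set s := accRate P M Pt τ with hsdef
    have hs0 : 0 ≤ s := accRate_nonneg P M Pt τ
    set fail : Ch1 S × Leaf S → ℝ := fun c => missRow P M Pt τ (Pt.transcript τ c.1 c.2) ^ R *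
      missAll P M Pt τ (Pt.transcript τ c.1 c.2) ^ (2 * R) with hfail
    have hfail0 : ∀ c, 0 ≤ fail c := fun c => mul_nonneg
      (pow_nonneg (missRow_mem P M Pt τ _).1 _) (pow_nonneg (missAll_mem P M Pt τ _).1 _)
    have hfail1 : ∀ c, fail c ≤ 1 := fun c => mul_le_one₀
      (pow_le_one₀ (missRow_mem P M Pt τ _).1 (missRow_mem P M Pt τ _).2)
      (pow_nonneg (missAll_mem P M Pt τ _).1 _)
      (pow_le_one₀ (missAll_mem P M Pt τ _).1 (missAll_mem P M Pt τ _).2)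
    have hval : (fun c : Ch1 S × Leaf S => if Accepts P M (Pt.transcript τ c.1 c.2) then
        potential P M Pt R B (some τ, (1, Pt.transcript τ c.1 c.2)) else ENNReal.ofReal B) =
        fun c => ENNReal.ofReal (B + if c ∈ accSet P M Pt τ then 3 * R - B * (1 - fail c) else 0) := by
      funext c
      have e1 : 3 * R - (0 + 1) + 1 = 3 * R := by omega
      have e2 : min (3 * R) (2 * R) = 2 * R := by omega
      simp only [accSet, Finset.mem_filter, Finset.mem_univ, true_and]
      split_ifs
      · simp only [potential, Nat.sub_zero, e1, e2, hfail]
        congr 1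
        push_cast
        ring
      · rw [add_zero]
    have hnn : ∀ c : Ch1 S × Leaf S, 0 ≤ B +
        (if c ∈ accSet P M Pt τ then 3 * R - B * (1 - fail c) else 0) := fun c => by
      split_ifs
      · have := mul_nonneg hB (hfail0 c)
        have : (0 : ℝ) ≤ R := Nat.cast_nonneg R
        linarith
      · linarith
    rw [hval, expect_uniform _ hnn, ← ENNReal.ofReal_mul (by positivity),
      ← ENNReal.ofReal_mul (by positivity)]
    have hsum0 := Finset.sum_nonneg fun c (_ : c ∈ Finset.univ) => hnn c
    have hbk : 0 ≤ B * κ := mul_nonneg hB hκ0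
    rw [← ENNReal.ofReal_add (by positivity) (by positivity),
      ← ENNReal.ofReal_add (by positivity) (by positivity),
      ← ENNReal.ofReal_add (by positivity) (by positivity)]
    refine ENNReal.ofReal_le_ofReal ?_
    have hcard : ((accSet P M Pt τ).card : ℝ) = s * Fintype.card (Ch1 S × Leaf S) := by
      rw [hsdef, accRate, hcc, div_mul_cancel₀ _ (by rw [← hcc]; exact hc.ne')]
    have hsum : ∑ c : Ch1 S × Leaf S, (B +
        (if c ∈ accSet P M Pt τ then 3 * R - B * (1 - fail c) else 0)) =
        Fintype.card (Ch1 S × Leaf S) * B + 3 * R * (s * Fintype.card (Ch1 S × Leaf S)) -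
          B * ∑ c ∈ accSet P M Pt τ, (1 - fail c) := by
      rw [Finset.sum_add_distrib, Finset.sum_ite_mem, Finset.univ_inter, Finset.mul_sum,
        Finset.sum_sub_distrib, Finset.sum_const, Finset.sum_const, nsmul_eq_mul,
        nsmul_eq_mul, hcard, Finset.card_univ]
      ring
    -- Good tapes use the counting inequality and then the tangent. On the others the tangent is
    -- nonpositive since g ≤ κΔ, and the sum is nonnegative anyway.
    have hG : Fintype.card (Ch1 S × Leaf S) * (g + κ * (s - ε - Δ)) ≤
        ∑ c ∈ accSet P M Pt τ, (1 - fail c) := by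
      rcases lt_or_ge 0 (s - ε) with hpos | hneg
      · refine le_trans ?_ (tape_gain P M Pt τ R hpos)
        rw [← hcc]
        exact mul_le_mul_of_nonneg_left (htan _ hpos) hc.le
      · refine le_trans ?_ (Finset.sum_nonneg fun c _ => by linarith [hfail1 c])
        refine mul_nonpos_of_nonneg_of_nonpos hc.le ?_
        have := mul_nonneg hκ0 (by linarith : 0 ≤ -(s - ε))
        nlinarith
    rw [hsum]
    have h1 : B * (Fintype.card (Ch1 S × Leaf S) * (g + κ * (s - ε - Δ))) ≤
      B * ∑ c ∈ accSet P M Pt τ, (1 - fail c) := mul_le_mul_of_nonneg_left hG hB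
    have h2 : (Fintype.card (Ch1 S × Leaf S) * B + 3 * R * (s * Fintype.card (Ch1 S × Leaf S)) -
          B * ∑ c ∈ accSet P M Pt τ, (1 - fail c)) / Fintype.card (Ch1 S × Leaf S) ≤
        B + 3 * R * s - B * (g + κ * (s - ε - Δ)) := by
      rw [div_le_iff₀ hc]
      linarith
    linarith
  rw [expect_comm]
  have htot := expect_mono Pt.tape htape
  have hacc : (expect Pt.tape fun τ => ENNReal.ofReal (accRate P M Pt τ)) =
      ENNReal.ofReal (Δ + ε) := by
    rw [expect_accRate, ← hs, CheatingProver.success, ENNReal.ofReal_toReal]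
    rw [toOuterMeasure_eq_expect]
    refine ne_top_of_le_ne_top ENNReal.one_ne_top ((expect_mono _ (g := fun _ => 1) fun a => ?_).trans_eq
      (expect_const _ _))
    split_ifs <;> simp
  rw [expect_add, expect_add, expect_add, expect_const, expect_const, expect_mul_left,
    expect_mul_left, hacc] at htot
  set X := expect Pt.tape fun τ => expect (PMF.uniformOfFintype (Ch1 S × Leaf S)) fun c =>
      if Accepts P M (Pt.transcript τ c.1 c.2) then
        potential P M Pt R B (some τ, (1, Pt.transcript τ c.1 c.2))
      else ENNReal.ofReal B with hX
  have hbk : 0 ≤ B * κ := mul_nonneg hB hκ0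
  have hde : 0 ≤ Δ + ε := by linarith
  have h3 : ENNReal.ofReal (3 * R) * ENNReal.ofReal (Δ + ε) + ENNReal.ofReal (B + B * κ * (Δ + ε)) =
      ENNReal.ofReal B + ENNReal.ofReal (3 * (R * (Δ + ε)) + B * κ * (Δ + ε)) := by
    rw [← ENNReal.ofReal_mul (by positivity), ← ENNReal.ofReal_add (by positivity) (by positivity),
      ← ENNReal.ofReal_add (by positivity) (by positivity)]
    congr 1
    ring
  -- By the choice of B, the expected saving B g pays for the current call and for the up to 3R
  -- trials after an acceptance. The slope terms cancel because the mean acceptance rate is Δ + ε.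
  have h4 : X + ENNReal.ofReal (B * g) + ENNReal.ofReal (B * κ) * ENNReal.ofReal (Δ + ε) =
      (1 + X) + ENNReal.ofReal (3 * (R * (Δ + ε)) + B * κ * (Δ + ε)) := by
    rw [hR, ENNReal.ofReal_add zero_le_one (by positivity), ENNReal.ofReal_one,
      ← ENNReal.ofReal_mul hbk, ENNReal.ofReal_add (by positivity) (by positivity)]
    ring
  rw [h3, h4] at htot
  exact (ENNReal.add_le_add_iff_right ENNReal.ofReal_ne_top).1 htot

theorem potential_step {R : ℕ} {B Δ : ℝ} (hΔ : 0 < Δ) (hB : 0 ≤ B)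
    (hs : Pt.success P M = Δ + soundnessError S)
    (hR : B * (Δ * gain R Δ) = 1 + 3 * (R * (Δ + soundnessError S))) (hR1 : 1 ≤ R)
    (c : Option Pt.Tape × (ℕ × Transcript S)) :
    1 + expect ((rewinder S R).step P M Pt c) (Sum.elim (potential P M Pt R B) fun _ => 0) ≤
      potential P M Pt R B c := by
  obtain ⟨t, n, T⟩ := c
  rcases n with _ | n
  · refine (congrArg (1 + ·) (expect_restart P M Pt R t T (potential P M Pt R B))).trans_le ?_
    have e : ∀ t, potential P M Pt R B (t, (0, T)) = ENNReal.ofReal B := fun t => by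
      cases t <;> rfl
    simp only [e]
    exact restart_le P M Pt hΔ hB hs hR hR1
  rcases t with _ | τ
  · exact le_top
  have hx := missRow_mem P M Pt τ T
  have hy := missAll_mem P M Pt τ T
  set x := missRow P M Pt τ T with hxdef
  set y := missAll P M Pt τ T with hydef
  have hm : 0 ≤ missTrial P M Pt R (n + 1) τ T ∧ missTrial P M Pt R (n + 1) τ T ≤ 1 := by
    unfold missTrial; split_ifs <;> assumption
  -- Each failed trial uses up one factor of the failure probability: first those of the row trials,
  -- then those of the fresh ones.
  have hmul : missTrial P M Pt R (n + 1) τ T *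
      (x ^ (R - (n + 1)) * y ^ min (3 * R - (n + 1)) (2 * R)) ≤
      x ^ (R - n) * y ^ min (3 * R - n) (2 * R) := by
    unfold missTrial
    split_ifs with h
    · rw [← mul_assoc, ← pow_succ', show R - (n + 1) + 1 = R - n by omega,
        show min (3 * R - (n + 1)) (2 * R) = min (3 * R - n) (2 * R) by omega]
    · rw [show R - (n + 1) = 0 by omega, show R - n = 0 by omega, pow_zero, one_mul, one_mul,
        ← pow_succ']
      exact pow_le_pow_of_le_one hy.1 hy.2 (by omega)
  have hxy : ∀ a b : ℕ, 0 ≤ x ^ a * y ^ b := fun a b =>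
    mul_nonneg (pow_nonneg hx.1 _) (pow_nonneg hy.1 _)
  by_cases hn : n + 1 < 3 * R
  · refine (congrArg (1 + ·) (expect_trial P M Pt R (n + 1) (by omega) τ T
      ((3 * R - (n + 2) + 1 : ℕ) + B * (x ^ (R - (n + 1)) * y ^ min (3 * R - (n + 1)) (2 * R)))
      (add_nonneg (Nat.cast_nonneg _) (mul_nonneg hB (hxy _ _))) (potential P M Pt R B)
      (by rw [if_pos hn]; rfl))).trans_le ?_
    rw [potential, ← ENNReal.ofReal_one, ← ENNReal.ofReal_add zero_le_one (mul_nonneg hm.1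
      (add_nonneg (Nat.cast_nonneg _) (mul_nonneg hB (hxy _ _))))]
    refine ENNReal.ofReal_le_ofReal ?_
    rw [show 3 * R - (n + 1) + 1 = (3 * R - (n + 2) + 1) + 1 by omega, Nat.cast_add_one
      (3 * R - (n + 2) + 1)]
    have h1 := mul_le_of_le_one_left (Nat.cast_nonneg (α := ℝ) (3 * R - (n + 2) + 1)) hm.2
    have h2 := mul_le_mul_of_nonneg_left hmul hB
    rw [mul_add, mul_left_comm _ B]
    linarith
  · refine (congrArg (1 + ·) (expect_trial P M Pt R (n + 1) (by omega) τ T B hB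
      (potential P M Pt R B) (by rw [if_neg hn]; rfl))).trans_le ?_
    rw [potential, ← ENNReal.ofReal_one, ← ENNReal.ofReal_add zero_le_one (mul_nonneg hm.1 hB)]
    refine ENNReal.ofReal_le_ofReal ?_
    rw [show 3 * R - (n + 1) + 1 = 1 by omega, Nat.cast_one]
    have h2 := mul_le_mul_of_nonneg_left hmul hB
    have h3 : missTrial P M Pt R (n + 1) τ T ≤
        x ^ (R - n) * y ^ min (3 * R - n) (2 * R) := by
      unfold missTrial
      rw [if_neg (by omega), show R - n = 0 by omega, pow_zero, one_mul, ← hydef]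
      exact (pow_one y).symm.le.trans (pow_le_pow_of_le_one hy.1 hy.2 (by omega))
    have h4 := mul_le_mul_of_nonneg_left h3 hB
    linarith [mul_comm (missTrial P M Pt R (n + 1) τ T) B]

theorem success_le_one : Pt.success P M ≤ 1 := by
  classical
  rw [CheatingProver.success, toOuterMeasure_eq_expect]
  refine ENNReal.toReal_le_of_le_ofReal zero_le_one ?_
  rw [ENNReal.ofReal_one]
  refine (expect_mono _ (g := fun _ => 1) fun a => ?_).trans_eq (expect_const _ _)
  split_ifs <;> simp

theorem rewinder_expectedCalls {et : ℝ} (het : soundnessError S < et)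
    (hs : Pt.success P M = et) :
    (rewinder S ⌊1 / et⌋₊).expectedCalls P M Pt ≤ ENNReal.ofReal
      (4 / (et - soundnessError S) * (1 + et * (2 * Real.log 2 / (et - soundnessError S)))) := by
  have hε0 : 0 ≤ soundnessError S := soundnessError_nonneg
  have het0 : 0 < et := hε0.trans_lt het
  have het1 : et ≤ 1 := hs ▸ success_le_one P M Pt
  obtain ⟨hR1, hR2, hR3⟩ := floor_inv_mul het0 het1
  set R := ⌊1 / et⌋₊ with hRdef
  have hR0 : (0 : ℝ) < R := by exact_mod_cast hR1
  have hΔ : 0 < et - soundnessError S := by linarith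
  have hg : 0 < (et - soundnessError S) * gain R (et - soundnessError S) := by
    unfold gain; positivity
  refine ((rewinder S R).expectedCalls_le P M Pt (potential P M Pt R ((1 + 3 * (R * et)) /
    ((et - soundnessError S) * gain R (et - soundnessError S))))
    (potential_step P M Pt hΔ (by positivity) (by rw [hs]; ring) ?_ hR1)).trans
    (ENNReal.ofReal_le_ofReal (calls_bound hΔ (by linarith) hR0 hR2 hR3))
  rw [div_mul_cancel₀ _ hg.ne', sub_add_cancel]

end Potential

end MinRankPoK

end

open scoped ENNReal

noncomputable section

namespace MinRankPoK

/-! ### Indistinguishability for a fixed security parameter -/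

section Indist

variable {lam : ℕ} {S : Params lam} {P : Prims S} {X Y : Type}

/-- The probability that the test `t` accepts. -/
def pr (μ : PMF X) (t : X → Bool) : ℝ := (μ.toOuterMeasure {x | t x = true}).toReal

/-- Tests of size `c` have advantage at most `δ`. -/
def Indist (S : Params lam) (P : Prims S) (c : ℕ) (δ : ℝ) (μ ν : PMF X) : Prop :=
  ∀ T : Prims S → X → Bool, CostLE S T c → |pr μ (T P) - pr ν (T P)| ≤ δ

theorem pr_eq (μ : PMF X) (t : X → Bool) :
    pr μ t = (expect μ fun x => if t x = true then 1 else 0).toReal := by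
  rw [pr, toOuterMeasure_eq_expect]
  congr 2
  funext x
  by_cases h : t x = true <;> simp [h]

theorem expect_test_le_one (μ : PMF X) (t : X → Bool) :
    (expect μ fun x => if t x = true then 1 else 0) ≤ 1 := by
  refine (expect_mono _ (g := fun _ => 1) fun a => ?_).trans_eq (expect_const _ _)
  split_ifs <;> simp

theorem pr_mem (μ : PMF X) (t : X → Bool) : 0 ≤ pr μ t ∧ pr μ t ≤ 1 := by
  rw [pr_eq]
  exact ⟨ENNReal.toReal_nonneg, ENNReal.toReal_le_of_le_ofReal zero_le_one
    (by rw [ENNReal.ofReal_one]; exact expect_test_le_one μ t)⟩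

theorem pr_map (μ : PMF X) (f : X → Y) (t : Y → Bool) : pr (μ.map f) t = pr μ fun x => t (f x) := by
  rw [pr_eq, pr_eq, expect_map]

theorem toReal_le_toReal_add {a b : ℝ≥0∞} {δ : ℝ} (ha : a ≠ ⊤) (hb : b ≠ ⊤) (hδ : 0 ≤ δ) :
    a.toReal - b.toReal ≤ δ ↔ a ≤ b + ENNReal.ofReal δ := by
  rw [sub_le_iff_le_add', ← ENNReal.toReal_ofReal hδ, ← ENNReal.toReal_add hb ENNReal.ofReal_ne_top,
    ENNReal.toReal_le_toReal ha (ENNReal.add_ne_top.2 ⟨hb, ENNReal.ofReal_ne_top⟩),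
    ENNReal.toReal_ofReal hδ]

/-- Two one-sided inequalities between extended nonnegative expectations can be averaged over a
random parameter by monotonicity alone. -/
theorem abs_pr_sub_le_iff (μ ν : PMF X) (t : X → Bool) {δ : ℝ} (hδ : 0 ≤ δ) :
    |pr μ t - pr ν t| ≤ δ ↔
      (expect μ fun x => if t x = true then 1 else 0) ≤
        (expect ν fun x => if t x = true then 1 else 0) + ENNReal.ofReal δ ∧
      (expect ν fun x => if t x = true then 1 else 0) ≤
        (expect μ fun x => if t x = true then 1 else 0) + ENNReal.ofReal δ := by
  have h : ∀ μ : PMF X, (expect μ fun x => if t x = true then 1 else 0) ≠ ⊤ := fun μ =>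
    ne_top_of_le_ne_top ENNReal.one_ne_top (expect_test_le_one μ t)
  rw [abs_le, neg_le, neg_sub, and_comm, pr_eq, pr_eq, toReal_le_toReal_add (h μ) (h ν) hδ,
    toReal_le_toReal_add (h ν) (h μ) hδ]

namespace Indist

variable {c w : ℕ} {δ δ' : ℝ} {μ ν ρ : PMF X}

theorem refl (μ : PMF X) (hδ : 0 ≤ δ) : Indist S P c δ μ μ := fun T _ => by simpa using hδ

theorem trans (h : Indist S P c δ μ ν) (h' : Indist S P c δ' ν ρ) :
    Indist S P c (δ + δ') μ ρ := fun T hT =>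
  (abs_sub_le _ _ _).trans (add_le_add (h T hT) (h' T hT))

theorem mono {c' : ℕ} (h : Indist S P c δ μ ν) (hc : c' ≤ c) : Indist S P c' δ μ ν :=
  fun T hT => h T (hT.mono hc)

theorem map {g : Prims S → X → Y} (hg : CostLE S g w) (h : Indist S P (c + w) δ μ ν) :
    Indist S P c δ (μ.map (g P)) (ν.map (g P)) := fun T hT => by
  rw [pr_map, pr_map]
  exact h (fun P x => T P (g P x)) ((hg.comp hT).mono (Nat.add_comm w c).le)

/-- The same test is used for every value of the common first stage, so averaging costs neither size
nor advantage. The first stage need not be efficiently samplable. -/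
theorem bind (hδ : 0 ≤ δ) (μ : PMF X) {k k' : X → PMF Y}
    (h : ∀ a, Indist S P c δ (k a) (k' a)) : Indist S P c δ (μ.bind k) (μ.bind k') :=
  fun T hT => by
    rw [abs_pr_sub_le_iff _ _ _ hδ, expect_bind, expect_bind]
    have h' := fun a => (abs_pr_sub_le_iff _ _ _ hδ).1 (h a T hT)
    constructor
    · refine (expect_mono _ fun a => (h' a).1).trans_eq ?_
      rw [expect_add, expect_const]
    · refine (expect_mono _ fun a => (h' a).2).trans_eq ?_
      rw [expect_add, expect_const]

end Indist

/-- The hybrid argument for several samples. -/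
theorem indist_samples {W : ℕ} {δ : ℝ} (hδ : 0 ≤ δ) {μ ν : PMF X} (Q c : ℕ) (hW : Q + 1 ≤ W)
    (h : Indist S P (c + Q * W) δ μ ν) : Indist S P c (Q * δ) (samples μ Q) (samples ν Q) := by
  induction Q generalizing c with
  | zero =>
    rw [Nat.cast_zero, zero_mul]
    exact Indist.refl (PMF.pure Fin.elim0) le_rfl
  | succ Q ih =>
    have ih := ih (c + W) (by omega)
      (h.mono (c' := c + W + Q * W) (by rw [Nat.succ_mul]; omega))
    have h1 : ∀ x : X, CostLE S (fun _ (xs : Fin Q → X) => (Fin.cons x xs : Fin (Q + 1) → X)) W := by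
      intro x
      have : ∀ t : Fin (Q + 1), Computes S (fun _ (xs : Fin Q → X) =>
          (Fin.cons x xs : Fin (Q + 1) → X) t) 1 := by
        intro t
        refine Fin.cases ?_ (fun t => ?_) t
        · exact Computes.const x
        · exact Computes.proj t
      refine (CostLE.of_computes (Computes.tuple this)).mono ?_
      simp
      omega
    have h2 : ∀ xs : Fin Q → X,
        CostLE S (fun _ (x : X) => (Fin.cons x xs : Fin (Q + 1) → X)) W := by
      intro xs
      have : ∀ t : Fin (Q + 1), CostLE S (fun _ (x : X) =>
          (Fin.cons x xs : Fin (Q + 1) → X) t) 1 := by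
        intro t
        refine Fin.cases ?_ (fun t => ?_) t
        · exact (CostLE.of_computes Computes.id).mono zero_le_one
        · exact CostLE.of_computes (Computes.const _)
      choose s hs h using this
      refine (CostLE.of_computes (Computes.tuple h)).mono ?_
      have := Finset.sum_le_sum fun t (_ : t ∈ Finset.univ) => hs t
      simp at this
      omega
    -- The tail of the sample is replaced first and the head second. In each move the remaining part
    -- is fixed and hard-wired into the test as constants; W pays for assembling the tuple.
    have e1 : Indist S P c (Q * δ) (samples μ (Q + 1))
        (μ.bind fun x => (samples ν Q).map fun xs => Fin.cons x xs) :=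
      Indist.bind (mul_nonneg (Nat.cast_nonneg Q) hδ) _ fun x =>
        Indist.map (g := fun _ xs => (Fin.cons x xs : Fin (Q + 1) → X)) (h1 x) ih
    have e2 : Indist S P c δ (μ.bind fun x => (samples ν Q).map fun xs => (Fin.cons x xs : Fin (Q+1) → X))
        (samples ν (Q + 1)) := by
      have e3 : ∀ μ : PMF X, (μ.bind fun x => (samples ν Q).map fun xs =>
          (Fin.cons x xs : Fin (Q+1) → X)) =
          (samples ν Q).bind fun xs => μ.map fun x => Fin.cons x xs := fun μ => by
        simp_rw [← PMF.bind_pure_comp]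
        exact PMF.bind_comm _ _ _
      rw [samples, e3, e3]
      exact Indist.bind hδ _ fun xs => Indist.map
        (g := fun _ x => (Fin.cons x xs : Fin (Q + 1) → X)) (h2 xs)
        (h.mono (by rw [Nat.succ_mul]; omega))
    have := e1.trans e2
    convert this using 1
    push_cast
    ring

end Indist

/-! ### Maps which preserve the uniform distribution -/

section Uniform

variable {X Y : Type} [Fintype X] [Nonempty X] [Fintype Y] [Nonempty Y]

/-- A permutation of the domain carries each fibre into any other, so all fibres have the same mass.
-/
theorem uniform_map_of_homogeneous (f : X → Y)
    (h : ∀ b b', ∃ e : X ≃ X, ∀ a, f a = b → f (e a) = b') :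
    (PMF.uniformOfFintype X).map f = PMF.uniformOfFintype Y := by
  classical
  have hle : ∀ b b', ((PMF.uniformOfFintype X).map f) b ≤ ((PMF.uniformOfFintype X).map f) b' := by
    intro b b'
    obtain ⟨e, he⟩ := h b b'
    rw [PMF.map_apply, PMF.map_apply]
    conv_rhs => rw [← e.tsum_eq]
    refine ENNReal.tsum_le_tsum fun a => ?_
    by_cases ha : b = f a
    · rw [if_pos ha, if_pos (he a ha.symm).symm]
      simp
    · rw [if_neg ha]
      exact zero_le
  have heq : ∀ b b', ((PMF.uniformOfFintype X).map f) b = ((PMF.uniformOfFintype X).map f) b' :=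
    fun b b' => le_antisymm (hle b b') (hle b' b)
  ext b
  have hsum := ((PMF.uniformOfFintype X).map f).tsum_coe
  rw [tsum_fintype, Finset.sum_congr rfl fun b' _ => heq b' b, Finset.sum_const, nsmul_eq_mul,
    Finset.card_univ] at hsum
  rw [PMF.uniformOfFintype_apply]
  exact ENNReal.eq_inv_of_mul_eq_one_left (by rwa [mul_comm] at hsum)

theorem uniform_map_of_bijective (f : X → Y) (hf : Function.Bijective f) :
    (PMF.uniformOfFintype X).map f = PMF.uniformOfFintype Y := by
  classical
  refine uniform_map_of_homogeneous f fun b b' => ?_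
  obtain ⟨a, ha⟩ := hf.2 b
  obtain ⟨a', ha'⟩ := hf.2 b'
  refine ⟨Equiv.swap a a', fun x hx => ?_⟩
  rw [hf.1 (hx.trans ha.symm), Equiv.swap_apply_left, ha']

theorem uniform_prod : (PMF.uniformOfFintype X).bind (fun a =>
    (PMF.uniformOfFintype Y).map fun b => (a, b)) = PMF.uniformOfFintype (X × Y) := by
  classical
  ext ⟨a, b⟩
  rw [PMF.bind_apply, tsum_eq_single a]
  · rw [PMF.map_apply, tsum_eq_single b]
    · simp only [if_pos, PMF.uniformOfFintype_apply, Fintype.card_prod, Nat.cast_mul]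
      rw [ENNReal.mul_inv (Or.inr (ENNReal.natCast_ne_top _)) (Or.inl (ENNReal.natCast_ne_top _))]
    · intro b' hb'
      rw [if_neg (fun h => hb' (Prod.ext_iff.1 h).2.symm)]
  · intro a' ha'
    rw [PMF.map_apply]
    simp [Prod.ext_iff, ha'.symm]

end Uniform

end MinRankPoK

end

open scoped ENNReal

noncomputable section

namespace MinRankPoK

/-! ### Security of the seed tree -/

section TreeSecurity

variable {lam : ℕ} {S : Params lam} {P : Prims S}

/-- The sibling path of a leaf, and its value. -/
def pathLeaf (G : Seed lam → Seed lam × Seed lam) (d : ℕ) (i : Fin d → Bool) (s : Seed lam) :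
    (Fin d → Seed lam) × Seed lam := (siblings G d i s, walk G d i s)

def consPath {d : ℕ} (x : Seed lam × ((Fin d → Seed lam) × Seed lam)) :
    (Fin (d + 1) → Seed lam) × Seed lam := (Fin.cons x.1 x.2.1, x.2.2)

theorem consPath_bijective {d : ℕ} : Function.Bijective (consPath (lam := lam) (d := d)) := by
  refine ⟨fun x y h => ?_, fun y => ⟨(y.1 0, Fin.tail y.1, y.2), ?_⟩⟩
  · obtain ⟨h1, h2⟩ := Prod.ext_iff.1 h
    obtain ⟨h3, h4⟩ := (Fin.cons_inj (α := fun _ => Seed lam)).1 h1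
    exact Prod.ext h3 (Prod.ext h4 h2)
  · simp [consPath, Fin.cons_self_tail]

theorem pathLeaf_succ (G : Seed lam → Seed lam × Seed lam) (d : ℕ) (i : Fin (d + 1) → Bool)
    (s : Seed lam) : pathLeaf G (d + 1) i s =
      consPath (child G s (!(i 0)), pathLeaf G d (Fin.tail i) (child G s (i 0))) := rfl

theorem cost_consPath (d : ℕ) {α : Type} {f : Prims S → α → Seed lam}
    {g : Prims S → α → (Fin d → Seed lam) × Seed lam} {s t : ℕ} (hf : CostLE S f s)
    (hg : CostLE S g t) :
    CostLE S (fun P a => consPath (f P a, g P a)) (s + t + 3 * d + 10) := by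
  have h1 : CostLE S (fun (_ : Prims S) (x : Seed lam × ((Fin d → Seed lam) × Seed lam)) =>
      consPath x) (3 * d + 9) := by
    have h2 : ∀ j : Fin (d + 1), CostLE S (fun (_ : Prims S)
        (x : Seed lam × ((Fin d → Seed lam) × Seed lam)) =>
        (Fin.cons x.1 x.2.1 : Fin (d + 1) → Seed lam) j) 3 := by
      intro j
      refine Fin.cases ?_ (fun j => ?_) j
      · exact (CostLE.of_computes Computes.fst).mono (by norm_num)
      · exact CostLE.of_computes ((Computes.snd.comp Computes.fst).comp (Computes.proj j))
    choose s hs h using h2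
    have h3 := CostLE.of_computes (Computes.tuple h)
    have h4 : CostLE S (fun (_ : Prims S) (x : Seed lam × ((Fin d → Seed lam) × Seed lam)) =>
        x.2.2) 2 := CostLE.of_computes (Computes.snd.comp Computes.snd)
    refine (h3.pair h4).mono ?_
    have := Finset.sum_le_sum fun t (_ : t ∈ Finset.univ) => hs t
    simp only [Finset.sum_const, Finset.card_univ, Fintype.card_fin, smul_eq_mul] at this
    omega
  exact ((hf.pair hg).comp h1).mono (by omega)

theorem cost_pathLeaf (d : ℕ) (i : Fin d → Bool) :
    CostLE S (fun P s => pathLeaf P.prgNode d i s) (d * (3 * d + 20) + 2) := by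
  induction d with
  | zero =>
    exact ((CostLE.of_computes (Computes.const Fin.elim0)).pair
      (CostLE.of_computes Computes.id)).mono (by omega)
  | succ d ih =>
    have hc : ∀ b : Bool, CostLE S (fun P s => child P.prgNode s b) 2 := by
      intro b
      have h1 := CostLE.of_computes (Computes.prgNode (S := S))
      cases b
      · exact h1.comp (CostLE.of_computes Computes.fst)
      · exact h1.comp (CostLE.of_computes Computes.snd)
    refine (cost_consPath d (hc (!(i 0))) ((hc (i 0)).comp (ih (Fin.tail i)))).mono ?_
    ring_nf
    omega

/-- A hybrid down the path with one replacement per level. Once the two children are uniform, the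
sibling is an independent uniform seed and the other child is a fresh root for the remaining levels.
Only the path is expanded, so d replacements suffice; W bounds the reduction's work per level. -/
theorem indist_pathLeaf {δ : ℝ} (hδ : 0 ≤ δ) {W : ℕ} (d c : ℕ) (i : Fin d → Bool)
    (hW : d * (3 * d + 20) + 20 ≤ W)
    (h : Indist S P (c + d * W) δ ((PMF.uniformOfFintype (Seed lam)).map P.prgNode)
      (PMF.uniformOfFintype (Seed lam × Seed lam))) :
    Indist S P c (d * δ) ((PMF.uniformOfFintype (Seed lam)).map (pathLeaf P.prgNode d i))
      (PMF.uniformOfFintype ((Fin d → Seed lam) × Seed lam)) := by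
  induction d generalizing c with
  | zero =>
    rw [Nat.cast_zero, zero_mul, uniform_map_of_bijective]
    · exact Indist.refl _ le_rfl
    · exact ⟨fun a b h => (Prod.ext_iff.1 h).2, fun x => ⟨x.2, Prod.ext (Subsingleton.elim _ _) rfl⟩⟩
  | succ d ih =>
    have hdW : d * (3 * d + 20) + 20 + 6 * d + 23 ≤ W := by
      refine le_trans (le_of_eq ?_) hW
      ring
    have ih := ih (c + W) (Fin.tail i) (by omega) (h.mono (by rw [Nat.succ_mul]; omega))
    set U := PMF.uniformOfFintype (Seed lam) with hU
    -- the children in the order sibling, path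
    let f : Seed lam × Seed lam → Seed lam × Seed lam := fun x => if i 0 then x else x.swap
    have hf : Function.Bijective f := by
      by_cases h0 : i 0 = true
      · simp only [f, if_pos h0]; exact Function.bijective_id
      · simp only [f, if_neg h0]; exact Prod.swap_bijective
    let A : Prims S → Seed lam × Seed lam → (Fin (d + 1) → Seed lam) × Seed lam := fun P x =>
      consPath ((f x).1, pathLeaf P.prgNode d (Fin.tail i) (f x).2)
    have hA : CostLE S A W := by
      have h1 : CostLE S (fun (_ : Prims S) x => (f x).1) 1 := by
        by_cases h0 : i 0 = true
        · simp only [f, if_pos h0]; exact CostLE.of_computes Computes.fst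
        · simp only [f, if_neg h0]; exact CostLE.of_computes Computes.snd
      have h2 : CostLE S (fun (_ : Prims S) x => (f x).2) 1 := by
        by_cases h0 : i 0 = true
        · simp only [f, if_pos h0]; exact CostLE.of_computes Computes.snd
        · simp only [f, if_neg h0]; exact CostLE.of_computes Computes.fst
      exact (cost_consPath d h1 (h2.comp (cost_pathLeaf d (Fin.tail i)))).mono (by omega)
    have e1 : U.map (pathLeaf P.prgNode (d + 1) i) = (U.map P.prgNode).map (A P) := by
      rw [PMF.map_comp]
      congr 1
      funext s
      rw [pathLeaf_succ]
      simp only [A, f, Function.comp_apply, child]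
      cases i 0 <;> rfl
    have e2 : (PMF.uniformOfFintype (Seed lam × Seed lam)).map (A P) =
        U.bind fun t => (U.map (pathLeaf P.prgNode d (Fin.tail i))).map fun y => consPath (t, y) := by
      have : A P = (fun x : Seed lam × Seed lam =>
        consPath (x.1, pathLeaf P.prgNode d (Fin.tail i) x.2)) ∘ f := rfl
      rw [this, ← PMF.map_comp, uniform_map_of_bijective f hf, ← uniform_prod, PMF.map_bind]
      simp_rw [PMF.map_comp]
      rfl
    have e3 : PMF.uniformOfFintype ((Fin (d + 1) → Seed lam) × Seed lam) =
        U.bind fun t => (PMF.uniformOfFintype ((Fin d → Seed lam) × Seed lam)).map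
          fun y => consPath (t, y) := by
      rw [← uniform_map_of_bijective _ consPath_bijective, ← uniform_prod, PMF.map_bind]
      simp_rw [PMF.map_comp]
      rfl
    have k1 : Indist S P c δ (U.map (pathLeaf P.prgNode (d + 1) i))
        ((PMF.uniformOfFintype (Seed lam × Seed lam)).map (A P)) := by
      rw [e1]
      exact Indist.map hA (h.mono (by rw [Nat.succ_mul]; omega))
    have k2 : Indist S P c (d * δ) ((PMF.uniformOfFintype (Seed lam × Seed lam)).map (A P))
        (PMF.uniformOfFintype ((Fin (d + 1) → Seed lam) × Seed lam)) := by
      rw [e2, e3]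
      refine Indist.bind (by positivity) _ fun t =>
        Indist.map (g := fun _ y => consPath (t, y)) ?_ ih
      exact (cost_consPath d (CostLE.of_computes (Computes.const t))
        (CostLE.of_computes Computes.id)).mono (by omega)
    have := k1.trans k2
    convert this using 1
    push_cast
    ring

end TreeSecurity

end MinRankPoK

end

open scoped ENNReal

noncomputable section

namespace MinRankPoK

/-! ### The honest response as a function of the opened part of the seed tree -/

section Response

variable {lam : ℕ} {S : Params lam} (P : Prims S) (M : Inst S) (x : Fin S.k → S.Fq)

/-- The auxiliary shares that complete the sum `rest` of the other shares and the share `a` of the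
last leaf to a sharing of the witness. -/
def completeAux (rest : Share S) (a : Fin S.r → S.Fqme) : Aux S :=
  (x - rest.1, beta M x - rest.2.1,
    -(∑ l, (rest.2.2.1 + a) l * algebraMap S.Fqm S.Fqme (beta M x l)) - rest.2.2.2)

/-- The sum of the shares of the leaves other than the last one and `i`. -/
def openSum (i : Leaf S) (path : Fin S.D → Seed lam) : Share S :=
  ∑ j ∈ (Finset.univ.erase (lastLeaf S)).erase i, P.prgShare (vSeed P i path j).1

/-- The auxiliary shares, from the sibling path of `i` and the seed of `i`. -/
def pathAux (i : Leaf S) (path : Fin S.D → Seed lam) (s : Seed lam) : Aux S :=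
  if i = lastLeaf S then completeAux M x (openSum P i path) (P.prgLast s)
  else completeAux M x (P.prgShare s + openSum P i path)
    (P.prgLast (vSeed P i path (lastLeaf S)).1)

/-- The response, from the sibling path of `i` and the seed and commitment tape of `i`. -/
def pathRsp (ch : Ch1 S) (i : Leaf S) (path : Fin S.D → Seed lam) (s : Seed lam × Rho S) : Rsp S :=
  (P.com (leafState s.1 (pathAux P M x i path s.1) i, s.2),
    shareAlpha M ch {i} (leafShare P s.1 (pathAux P M x i path s.1) i), path,
    if i = lastLeaf S then 0 else pathAux P M x i path s.1)

/-- Every other leaf can be recomputed from the sibling path, so the root influences the auxiliary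
shares only through the path and the seed of the hidden leaf. -/
theorem honestAux_eq (root : Seed lam) (i : Leaf S) :
    honestAux P M x root =
      pathAux P M x i (siblings P.prgNode S.D i root) (leafSeed P root i).1 := by
  have hv : ∀ j, j ≠ i → vSeed P i (siblings P.prgNode S.D i root) j = leafSeed P root j :=
    fun j hj => by rw [vSeed, recover_siblings _ _ _ _ _ hj, leafSeed]
  have h0 : honestAux P M x root = completeAux M x
      (∑ j ∈ Finset.univ.erase (lastLeaf S), P.prgShare (leafSeed P root j).1)
      (P.prgLast (leafSeed P root (lastLeaf S)).1) := rfl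
  have ho : openSum P i (siblings P.prgNode S.D i root) =
      ∑ j ∈ (Finset.univ.erase (lastLeaf S)).erase i, P.prgShare (leafSeed P root j).1 :=
    Finset.sum_congr rfl fun j hj => by rw [hv j (Finset.ne_of_mem_erase hj)]
  rw [h0, pathAux, ho]
  split_ifs with hi
  · subst hi
    rw [Finset.erase_idem]
  · rw [hv _ (Ne.symm hi), Finset.add_sum_erase _ (fun j => P.prgShare (leafSeed P root j).1)
      (Finset.mem_erase.2 ⟨hi, Finset.mem_univ i⟩)]

theorem honestRsp_eq (root : Seed lam) (ch : Ch1 S) (i : Leaf S) :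
    honestRsp P M x root ch i =
      pathRsp P M x ch i (siblings P.prgNode S.D i root) (leafSeed P root i) := by
  rw [pathRsp, ← honestAux_eq]
  rfl

/-- The response without the auxiliary shares if they are not sent. -/
def maskRsp (i : Leaf S) (rsp : Rsp S) : Rsp S :=
  (rsp.1, rsp.2.1, rsp.2.2.1, if i = lastLeaf S then 0 else rsp.2.2.2)

end Response

/-! ### Programs -/

namespace PC

variable {lam : ℕ} {S : Params lam} {α : Type} {e : ℕ}

theorem completeAux (M : Inst S) (x : Fin S.k → S.Fq) {rest : Prims S → α → Share S}
    {a : Prims S → α → Fin S.r → S.Fqme} (hr : PC S e rest) (ha : PC S e a) :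
    PC S (e + 30) (fun P t => MinRankPoK.completeAux M x (rest P t) (a P t)) := by
  have h1 := tuple fun j : Fin S.k => (const (α := α) (x j)).subq (hr.fst.proj j)
  have h2 := tuple fun j : Fin S.r => (const (α := α) (beta M x j)).subm (hr.snd.fst.proj j)
  have h3 := ((sume fun l : Fin S.r => ((hr.snd.snd.fst.proj l).adde (ha.proj l)).mule
    (const (algebraMap S.Fqm S.Fqme (beta M x l)))).nege).sube hr.snd.snd.snd
  exact (h1.pair (h2.pair h3)).mono (by omega)

theorem openSum (i : Leaf S) {p : Prims S → α → Fin S.D → Seed lam} (hp : PC S e p) :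
    PC S (e + 30) (fun P t => MinRankPoK.openSum P i (p P t)) :=
  (agg (A := fun _ _ => (Finset.univ.erase (lastLeaf S)).erase i) add_share
    (fun _ => const _) (fun j => op Computes.prgShare
      (vSeed (e := e) ((const i).mono (Nat.zero_le e)) hp j).fst)).mono (by omega)

theorem pathAux (M : Inst S) (x : Fin S.k → S.Fq) (i : Leaf S)
    {p : Prims S → α → Fin S.D → Seed lam} {s : Prims S → α → Seed lam} (hp : PC S e p)
    (hs : PC S e s) :
    PC S (e + 100) (fun P t => MinRankPoK.pathAux P M x i (p P t) (s P t)) := by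
  unfold MinRankPoK.pathAux
  split_ifs with hi
  · exact (completeAux (e := e + 60) M x ((openSum i hp).mono (by omega))
      ((op Computes.prgLast hs).mono (by omega))).mono (by omega)
  · exact (completeAux (e := e + 60) M x
      ((((op Computes.prgShare hs).pair (openSum i hp)).comp add_share).mono (by omega))
      ((op Computes.prgLast (vSeed (e := e) ((const i).mono (Nat.zero_le e)) hp _).fst).mono
        (by omega))).mono (by omega)

theorem pathRsp (M : Inst S) (x : Fin S.k → S.Fq) (ch : Ch1 S) (i : Leaf S)
    {p : Prims S → α → Fin S.D → Seed lam} {s : Prims S → α → Seed lam × Rho S} (hp : PC S e p)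
    (hs : PC S e s) :
    PC S (e + 200) (fun P t => MinRankPoK.pathRsp P M x ch i (p P t) (s P t)) := by
  have ha := pathAux (e := e + 1) M x i (hp.mono (by omega)) hs.fst
  have hs' : PC S (e + 101) (fun P t => (s P t).1) := hs.fst.mono (by omega)
  have h1 := op Computes.com ((leafState hs' ha i).pair hs.snd)
  have h2 := shareAlpha (A := fun _ _ => {i}) (e := e + 110)
    ((const (α := α) M).mono (by omega)) ((const ch).mono (by omega))
    (fun _ => (const _).mono (by omega)) ((leafShare hs' ha i).mono (by omega))
  have h3 : PC S (e + 101) (fun P t => if i = lastLeaf S then (0 : Aux S) else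
      MinRankPoK.pathAux P M x i (p P t) (s P t).1) := by
    split_ifs
    · exact (const _).mono (by omega)
    · exact ha
  exact (h1.pair (h2.pair (hp.pair h3))).mono (by omega)

end PC

/-! ### Simulation of the response -/

section Simulation

variable {lam : ℕ} {S : Params lam} (P : Prims S) (M : Inst S) (x : Fin S.k → S.Fq)

/-- The advantages against the primitives for tests of size `c`. -/
structure Bounds (P : Prims S) (c : ℕ) (δ : ℝ) : Prop where
  nonneg : 0 ≤ δ
  node : Indist S P c δ ((PMF.uniformOfFintype (Seed lam)).map P.prgNode)
    (PMF.uniformOfFintype (Seed lam × Seed lam))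
  leaf : Indist S P c δ ((PMF.uniformOfFintype (Seed lam)).map P.prgLeaf)
    (PMF.uniformOfFintype (Seed lam × Rho S))
  share : Indist S P c δ ((PMF.uniformOfFintype (Seed lam)).map P.prgShare)
    (PMF.uniformOfFintype (Share S))
  last : Indist S P c δ ((PMF.uniformOfFintype (Seed lam)).map P.prgLast)
    (PMF.uniformOfFintype (Fin S.r → S.Fqme))
  com : ∀ msg : Msg S, Indist S P c δ
    ((PMF.uniformOfFintype (Rho S)).map fun ρ => P.com (msg, ρ)) (PMF.uniformOfFintype (Cmt S))

/-- This hides the witness when the hidden leaf is not the last. The auxiliary shares determine the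
hidden shares of x and β, the share of α then determines that of a, and the last component that of
c. Hence a uniform hidden share gives uniform data. -/
theorem shareAlpha_completeAux_bijective (ch : Ch1 S) (A : Finset (Leaf S)) (rest : Share S)
    (a : Fin S.r → S.Fqme) : Function.Bijective fun s : Share S =>
      ((shareAlpha M ch A s, completeAux M x (s + rest) a) : (Fin S.r → S.Fqme) × Aux S) := by
  refine (Fintype.bijective_iff_injective_and_card _).2 ⟨fun s t h => ?_, ?_⟩
  · obtain ⟨s1, s2, s3, s4⟩ := s
    obtain ⟨t1, t2, t3, t4⟩ := t
    simp only [completeAux, Prod.mk.injEq, Prod.fst_add, Prod.snd_add, sub_right_inj,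
      add_left_inj] at h
    obtain ⟨ha, rfl, rfl, hc⟩ := h
    have h3 : s3 = t3 := funext fun l => add_left_cancel (congrFun ha l)
    subst h3
    simp only [sub_right_inj, add_left_inj] at hc
    rw [hc]
  · simp only [Fintype.card_prod]
    ring

/-- The case of the last leaf hidden: no auxiliary shares are sent, and the uniform share of a masks
that of α. -/
theorem shareAlpha_bijective (ch : Ch1 S) (A : Finset (Leaf S)) (s : Share S) :
    Function.Bijective fun a : Fin S.r → S.Fqme =>
      shareAlpha M ch A (s.1, s.2.1, a, s.2.2.2) := by
  refine Finite.injective_iff_bijective.1 fun a b h => funext fun l => ?_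
  exact add_left_cancel (congrFun h l)

/-- With uniform commitment, `α` and auxiliary shares. -/
theorem uniform_rsp (i : Leaf S) : (PMF.uniformOfFintype (Rsp S)).map (maskRsp i) =
    (PMF.uniformOfFintype (Fin S.D → Seed lam)).bind fun path =>
    (PMF.uniformOfFintype (Cmt S)).bind fun cmt =>
    (PMF.uniformOfFintype ((Fin S.r → S.Fqme) × Aux S)).map fun y =>
      (cmt, y.1, path, if i = lastLeaf S then 0 else y.2) := by
  let f : (Fin S.D → Seed lam) × (Cmt S × ((Fin S.r → S.Fqme) × Aux S)) → Rsp S := fun z =>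
    (z.2.1, z.2.2.1, z.1, z.2.2.2)
  have hf : Function.Bijective f :=
    ⟨fun a b h => by
      simp only [f, Prod.mk.injEq] at h
      exact Prod.ext h.2.2.1 (Prod.ext h.1 (Prod.ext h.2.1 h.2.2.2)),
     fun r => ⟨(r.2.2.1, r.1, r.2.1, r.2.2.2), rfl⟩⟩
  rw [← uniform_map_of_bijective f hf, PMF.map_comp, ← uniform_prod, PMF.map_bind]
  congr 1
  funext path
  rw [PMF.map_comp, ← uniform_prod, PMF.map_bind]
  congr 1
  funext cmt
  rw [PMF.map_comp]
  rfl

end Simulation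

end MinRankPoK

end

open scoped ENNReal

noncomputable section

namespace MinRankPoK

/-! ### Hybrids from the honest response to a uniform one -/

section Simulation

variable {lam : ℕ} {S : Params lam} (P : Prims S) (M : Inst S) (x : Fin S.k → S.Fq)

theorem uniform_map_fst {X Y Z : Type} [Fintype X] [Nonempty X] [Fintype Y] [Nonempty Y]
    (f : X → Z) : (PMF.uniformOfFintype (X × Y)).map (fun y => f y.1) =
      (PMF.uniformOfFintype X).map f := by
  rw [← uniform_prod, PMF.map_bind, ← PMF.bind_pure_comp]
  congr 1
  funext a
  rw [PMF.map_comp]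
  exact PMF.map_const (PMF.uniformOfFintype Y) (f a)

/-- The response for a fixed sibling path and commitment, and a uniform seed of the hidden leaf. -/
theorem indist_share {c : ℕ} {δ : ℝ} (hB : Bounds P (c + S.size ^ 200) δ) (ch : Ch1 S) (i : Leaf S)
    (path : Fin S.D → Seed lam) (cmt : Cmt S) :
    Indist S P c δ ((PMF.uniformOfFintype (Seed lam)).map fun s =>
        ((cmt, shareAlpha M ch {i} (leafShare P s (pathAux P M x i path s) i), path,
          if i = lastLeaf S then 0 else pathAux P M x i path s) : Rsp S))
      ((PMF.uniformOfFintype ((Fin S.r → S.Fqme) × Aux S)).map fun y =>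
        (cmt, y.1, path, if i = lastLeaf S then 0 else y.2)) := by
  by_cases hi : i = lastLeaf S
  · simp only [if_pos hi]
    set x0 := x - (openSum P i path).1 with hx0
    -- The share of α involves only the x- and a-components, so β and c may be set to zero. The
    -- value x0 depends on the witness but is a constant for the test.
    let g : Prims S → (Fin S.r → S.Fqme) → Rsp S := fun _ a =>
      (cmt, shareAlpha M ch {i} (x0, 0, a, 0), path, 0)
    have hg : PC S 200 g := by
      have h1 := PC.shareAlpha (A := fun _ _ => {i}) (e := 10) ((PC.const M).mono (by omega))
        ((PC.const ch).mono (by omega)) (fun _ => (PC.const _).mono (by omega))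
        (((PC.const x0).pair ((PC.const (0 : Fin S.r → S.Fqm)).pair
          (PC.var.pair (PC.const (0 : S.Fqme))))).mono (by omega))
      exact ((PC.const cmt).pair (h1.pair ((PC.const path).pair (PC.const 0)))).mono (by omega)
    have h := Indist.map hg hB.last
    rw [PMF.map_comp] at h
    have e1 : (g P ∘ P.prgLast) = fun s =>
        ((cmt, shareAlpha M ch {i} (leafShare P s (pathAux P M x i path s) i), path, 0) : Rsp S) := by
      funext s
      simp only [g, Function.comp_apply, leafShare, if_pos hi, pathAux, completeAux, hx0]
      rfl
    have e2 : (PMF.uniformOfFintype ((Fin S.r → S.Fqme) × Aux S)).map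
        (fun y => ((cmt, y.1, path, 0) : Rsp S)) =
        (PMF.uniformOfFintype (Fin S.r → S.Fqme)).map (g P) := by
      rw [uniform_map_fst (fun y => ((cmt, y, path, 0) : Rsp S))]
      conv_lhs => rw [← uniform_map_of_bijective _ (shareAlpha_bijective M ch {i} (x0, 0, 0, 0)),
        PMF.map_comp]
      rfl
    rw [e1] at h
    rw [e2]
    exact h
  · simp only [if_neg hi]
    set R0 := openSum P i path with hR0
    set a0 := P.prgLast (vSeed P i path (lastLeaf S)).1 with ha0
    let g : Prims S → Share S → Rsp S := fun _ s =>
      (cmt, shareAlpha M ch {i} s, path, completeAux M x (s + R0) a0)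
    have hg : PC S 200 g := by
      have h1 := PC.shareAlpha (A := fun _ _ => {i}) (e := 0) (PC.const M) (PC.const ch)
        (fun _ => PC.const _) (PC.var (S := S))
      have h2 := PC.completeAux (e := 30) M x
        (((PC.var.pair (PC.const R0)).comp PC.add_share).mono (by omega))
        ((PC.const a0).mono (by omega))
      exact ((PC.const cmt).pair (h1.pair ((PC.const path).pair h2))).mono (by omega)
    have h := Indist.map hg hB.share
    rw [PMF.map_comp] at h
    have e1 : (g P ∘ P.prgShare) = fun s =>
        ((cmt, shareAlpha M ch {i} (leafShare P s (pathAux P M x i path s) i), path,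
          pathAux P M x i path s) : Rsp S) := by
      funext s
      simp only [g, Function.comp_apply, leafShare, if_neg hi, pathAux, hR0, ha0]
    have e2 : (PMF.uniformOfFintype ((Fin S.r → S.Fqme) × Aux S)).map
        (fun y => ((cmt, y.1, path, y.2) : Rsp S)) =
        (PMF.uniformOfFintype (Share S)).map (g P) := by
      rw [← uniform_map_of_bijective _ (shareAlpha_completeAux_bijective M x ch {i} R0 a0),
        PMF.map_comp]
      rfl
    rw [e1] at h
    rw [e2]
    exact h

theorem tree_cost_le : S.D * (3 * S.D + 20) + 20 ≤ S.size ^ 4 ∧ S.D * S.size ^ 4 ≤ S.size ^ 5 := by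
  have h1 := S.D_le_size
  have h2 := S.four_le_size
  constructor
  · have h3 : S.D * (3 * S.D + 20) ≤ S.size * (3 * S.size + 20) :=
      Nat.mul_le_mul h1 (by omega)
    have h4 : 16 * (S.size * S.size) ≤ S.size ^ 4 := by
      calc 16 * (S.size * S.size) = 4 * 4 * (S.size * S.size) := rfl
        _ ≤ S.size * S.size * (S.size * S.size) :=
          Nat.mul_le_mul_right _ (Nat.mul_le_mul h2 h2)
        _ = S.size ^ 4 := by ring
    nlinarith
  · rw [pow_succ S.size 4, mul_comm]
    exact Nat.mul_le_mul_left _ h1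

-- There are D replacements in the tree and one each for the leaf generator, the hidden commitment
-- and the hidden share. The order matters: the leaf generator makes the commitment tape independent
-- of the seed. The commitment can then be replaced while its message, which contains the seed, is
-- fixed. After that the seed occurs only in the expansion of the hidden share.
set_option exponentiation.threshold 500 in
theorem indist_rsp {c : ℕ} {δ : ℝ} (hB : Bounds P (c + S.size ^ 400) δ) (ch : Ch1 S) (i : Leaf S) :
    Indist S P c ((S.D + 3) * δ)
      ((PMF.uniformOfFintype (Seed lam)).map fun root => honestRsp P M x root ch i)
      ((PMF.uniformOfFintype (Rsp S)).map (maskRsp i)) := by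
  have hδ := hB.nonneg
  have hpow : ∀ a b : ℕ, a ≤ b → S.size ^ a ≤ S.size ^ b := fun a b h =>
    Nat.pow_le_pow_right (by have := S.four_le_size; omega) h
  set U := PMF.uniformOfFintype (Seed lam) with hU
  set Upath := PMF.uniformOfFintype (Fin S.D → Seed lam) with hUp
  -- the seed tree
  let g₁ : Prims S → (Fin S.D → Seed lam) × Seed lam → Rsp S := fun P z =>
    pathRsp P M x ch i z.1 (P.prgLeaf z.2)
  have hg₁ : PC S 300 g₁ := by
    have v : PC S 0 (fun _ (z : (Fin S.D → Seed lam) × Seed lam) => z) := PC.var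
    exact (PC.pathRsp (e := 5) M x ch i (v.fst.mono (by omega))
      ((PC.op Computes.prgLeaf v.snd).mono (by omega))).mono (by omega)
  have k₁ : Indist S P c (S.D * δ) (U.map fun root => honestRsp P M x root ch i)
      ((PMF.uniformOfFintype ((Fin S.D → Seed lam) × Seed lam)).map (g₁ P)) := by
    have h := Indist.map hg₁ (indist_pathLeaf hδ S.D (c + S.size ^ 300) i tree_cost_le.1
      (Indist.mono hB.node (by
        have h1 := tree_cost_le (S := S) |>.2
        have h2 := hpow 5 300 (by norm_num)
        have h3 : 4 * S.size ^ 300 ≤ S.size ^ 301 := four_mul_pow_le S 300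
        have h4 := hpow 301 400 (by norm_num)
        generalize S.size ^ 300 = a at *
        generalize S.size ^ 301 = a' at *
        generalize S.size ^ 400 = b at *
        omega)))
    rw [PMF.map_comp] at h
    convert h using 2
    funext root
    rw [honestRsp_eq]
    rfl
  -- the seed and the commitment tape of the hidden leaf
  have hg₂ : ∀ path : Fin S.D → Seed lam, PC S 300 (fun P (z : Seed lam × Rho S) =>
      pathRsp P M x ch i path z) := fun path =>
    (PC.pathRsp (e := 0) M x ch i (PC.const path) PC.var).mono (by omega)
  have k₂ : Indist S P c δ ((PMF.uniformOfFintype ((Fin S.D → Seed lam) × Seed lam)).map (g₁ P))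
      (Upath.bind fun path => (PMF.uniformOfFintype (Seed lam × Rho S)).map fun z =>
        pathRsp P M x ch i path z) := by
    rw [← uniform_prod, PMF.map_bind]
    refine Indist.bind hδ _ fun path => ?_
    have h := Indist.map (c := c) (hg₂ path) (hB.leaf.mono (Nat.add_le_add_left
      (hpow 300 400 (by norm_num)) c))
    rw [PMF.map_comp] at h ⊢
    exact h
  -- the commitment of the hidden leaf
  have k₃ : Indist S P c δ (Upath.bind fun path =>
        (PMF.uniformOfFintype (Seed lam × Rho S)).map fun z => pathRsp P M x ch i path z)
      (Upath.bind fun path => (PMF.uniformOfFintype (Cmt S)).bind fun cmt => U.map fun s =>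
        ((cmt, shareAlpha M ch {i} (leafShare P s (pathAux P M x i path s) i), path,
          if i = lastLeaf S then 0 else pathAux P M x i path s) : Rsp S)) := by
    refine Indist.bind hδ _ fun path => ?_
    -- Sampling the seed first makes the committed message a fixed one, as the assumption on
    -- commitments requires.
    have e1 : ((PMF.uniformOfFintype (Cmt S)).bind fun cmt => U.map fun s =>
        ((cmt, shareAlpha M ch {i} (leafShare P s (pathAux P M x i path s) i), path,
          if i = lastLeaf S then 0 else pathAux P M x i path s) : Rsp S)) =
        U.bind fun s => (PMF.uniformOfFintype (Cmt S)).map fun cmt =>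
        ((cmt, shareAlpha M ch {i} (leafShare P s (pathAux P M x i path s) i), path,
          if i = lastLeaf S then 0 else pathAux P M x i path s) : Rsp S) := by
      simp_rw [← PMF.bind_pure_comp]
      exact PMF.bind_comm _ _ _
    rw [e1, ← uniform_prod, PMF.map_bind]
    refine Indist.bind hδ _ fun s => ?_
    rw [PMF.map_comp]
    let g : Prims S → Cmt S → Rsp S := fun _ cmt =>
      (cmt, shareAlpha M ch {i} (leafShare P s (pathAux P M x i path s) i), path,
          if i = lastLeaf S then 0 else pathAux P M x i path s)
    have hg : PC S 400 g := (PC.var.pair (PC.const _)).mono (by omega)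
    have h := Indist.map (c := c) hg (hB.com (leafState s (pathAux P M x i path s) i))
    rw [PMF.map_comp] at h
    exact h
  -- the shares of the hidden leaf
  have k₄ : Indist S P c δ (Upath.bind fun path => (PMF.uniformOfFintype (Cmt S)).bind fun cmt =>
        U.map fun s =>
          ((cmt, shareAlpha M ch {i} (leafShare P s (pathAux P M x i path s) i), path,
            if i = lastLeaf S then 0 else pathAux P M x i path s) : Rsp S))
      ((PMF.uniformOfFintype (Rsp S)).map (maskRsp i)) := by
    rw [uniform_rsp]
    have hm := Nat.add_le_add_left (hpow 200 400 (by norm_num)) c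
    refine Indist.bind hδ _ fun path => Indist.bind hδ _ fun cmt =>
      indist_share P M x ⟨hδ, hB.node.mono hm, hB.leaf.mono hm, hB.share.mono hm, hB.last.mono hm,
        fun msg => (hB.com msg).mono hm⟩ ch i path cmt
  have := ((k₁.trans k₂).trans k₃).trans k₄
  convert this using 1
  ring

end Simulation

/-! ### The simulator -/

section Simulator

variable {lam : ℕ} (S : Params lam)

/-- The cells of the random tape of the simulator: the bits of the sibling path and of the
commitment, and field elements. -/
abbrev CellIdx : Type :=
  ((Fin S.D × Fin lam) ⊕ Fin S.lenCmt) ⊕ (Fin S.k ⊕ (Fin S.r ⊕ Unit))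

variable {S}

/-- The response read from a random tape. -/
def tapeRsp (t : CellIdx S → Cell S) : Rsp S :=
  (fun b => (t (Sum.inl (Sum.inr b))).1, fun l => (t (Sum.inr (Sum.inr (Sum.inl l)))).2.2.2,
    fun d b => (t (Sum.inl (Sum.inl (d, b)))).1, fun j => (t (Sum.inr (Sum.inl j))).2.1,
    fun l => (t (Sum.inr (Sum.inr (Sum.inl l)))).2.2.1, (t (Sum.inr (Sum.inr (Sum.inr ())))).2.2.2)

/-- A random tape which encodes a given response. -/
def rspTape (rsp : Rsp S) : CellIdx S → Cell S
  | Sum.inl (Sum.inl (d, b)) => (rsp.2.2.1 d b, 0)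
  | Sum.inl (Sum.inr b) => (rsp.1 b, 0)
  | Sum.inr (Sum.inl j) => (false, rsp.2.2.2.1 j, 0)
  | Sum.inr (Sum.inr (Sum.inl l)) => (false, 0, rsp.2.2.2.2.1 l, rsp.2.1 l)
  | Sum.inr (Sum.inr (Sum.inr _)) => (false, 0, 0, rsp.2.2.2.2.2)

/-- Cells contain unused components, so reading is not injective. Swapping, cell by cell, the
entries encoding two responses permutes the tapes and carries one fibre into the other. -/
theorem uniform_tapeRsp : (PMF.uniformOfFintype (CellIdx S → Cell S)).map tapeRsp =
    PMF.uniformOfFintype (Rsp S) := by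
  classical
  refine uniform_map_of_homogeneous tapeRsp fun r r' => ⟨Equiv.piCongrRight fun j =>
    Equiv.prodCongr (Equiv.swap (rspTape r j).1 (rspTape r' j).1)
      (Equiv.prodCongr (Equiv.swap (rspTape r j).2.1 (rspTape r' j).2.1)
        (Equiv.prodCongr (Equiv.swap (rspTape r j).2.2.1 (rspTape r' j).2.2.1)
          (Equiv.swap (rspTape r j).2.2.2 (rspTape r' j).2.2.2))), ?_⟩
  rintro t rfl
  simp [tapeRsp, rspTape]

/-- The simulator chooses a uniform response and computes the digests like the verifier. -/
def simulator (S : Params lam) : Simulator S where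
  width := Fintype.card (CellIdx S)
  run := fun P a =>
    let T := recompute P a.1.1 a.1.2.1 a.1.2.2
      (maskRsp a.1.2.2 (tapeRsp fun j => a.2 (Fintype.equivFin (CellIdx S) j)))
    (T.1, T.2.2.1, T.2.2.2.2)

set_option exponentiation.threshold 500 in
theorem simulator_time : ∃ C : ℕ, ∀ (lam : ℕ) (S : Params lam),
    (simulator S).Time (C * S.size ^ C) := by
  refine ⟨300, fun lam S => ?_⟩
  have hrun : PC S 300 (simulator S).run := by
    have v : PC S 0 (fun _ (a : (Inst S × Ch1 S × Leaf S) × (Fin (Fintype.card (CellIdx S)) →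
      Cell S)) => a) := PC.var
    have ht : ∀ j, PC S 2 (fun _ (a : (Inst S × Ch1 S × Leaf S) ×
        (Fin (Fintype.card (CellIdx S)) → Cell S)) => a.2 (Fintype.equivFin (CellIdx S) j)) :=
      fun j => v.snd.proj _
    have hi := v.fst.snd.snd
    have haux := (PC.tuple fun j : Fin S.k => (ht (Sum.inr (Sum.inl j))).snd.fst).pair
      ((PC.tuple fun l : Fin S.r => (ht (Sum.inr (Sum.inr (Sum.inl l)))).snd.snd.fst).pair
        (ht (Sum.inr (Sum.inr (Sum.inr ())))).snd.snd.snd)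
    have hlast := PC.eqd (PC.eqTest_bits S.D_le_size) hi (PC.const (lastLeaf S))
    have hrsp := (PC.tuple fun b : Fin S.lenCmt => (ht (Sum.inl (Sum.inr b))).fst).pair
      ((PC.tuple fun l : Fin S.r => (ht (Sum.inr (Sum.inr (Sum.inl l)))).snd.snd.snd).pair
        ((PC.tuple fun d : Fin S.D => PC.tuple fun b : Fin lam =>
          (ht (Sum.inl (Sum.inl (d, b)))).fst).pair (hlast.ite (PC.const 0) haux)))
    have hT := PC.recompute (e := 40) (v.fst.fst.mono (by omega)) (v.fst.snd.fst.mono (by omega))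
      (hi.mono (by omega)) (hrsp.mono (by omega))
    have := (hT.fst.pair (hT.snd.snd.fst.pair hT.snd.snd.snd.snd)).mono (e' := 300) (by omega)
    exact this
  obtain ⟨s, hs, h⟩ := hrun
  refine ⟨s, h, ?_⟩
  have hw : (simulator S).width ≤ 5 * S.size ^ 300 := by
    have h1 : S.D * lam ≤ S.size * S.size :=
      Nat.mul_le_mul S.D_le_size (by unfold Params.size; omega)
    have h2 : (simulator S).width = S.D * lam + S.lenCmt + (S.k + (S.r + 1)) := by
      simp [simulator]
    have h3 : S.lenCmt + (S.k + (S.r + 1)) ≤ S.size := by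
      have := S.N_pos
      unfold Params.size
      omega
    have h4 : S.size * S.size ≤ S.size ^ 300 := by
      rw [← pow_two]
      exact Nat.pow_le_pow_right (by have := S.four_le_size; omega) (by norm_num)
    have h5 : S.size ≤ S.size * S.size :=
      Nat.le_mul_of_pos_left _ (by have := S.four_le_size; omega)
    generalize S.size ^ 300 = a at *
    omega
  generalize S.size ^ 300 = a at *
  omega

end Simulator

/-! ### Honest-verifier zero-knowledge for a fixed security parameter -/

section HVZK

variable {lam : ℕ} {S : Params lam} (P : Prims S) (M : Inst S) (x : Fin S.k → S.Fq)

theorem simulator_dist : (simulator S).dist P M =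
    (PMF.uniformOfFintype (Ch1 S)).bind fun ch => (PMF.uniformOfFintype (Leaf S)).bind fun i =>
      ((PMF.uniformOfFintype (Rsp S)).map (maskRsp i)).map (recompute P M ch i) := by
  unfold Simulator.dist
  congr 1
  funext ch
  congr 1
  funext i
  have hb : Function.Bijective fun (t : Fin (simulator S).width → Cell S) (j : CellIdx S) =>
      t (Fintype.equivFin (CellIdx S) j) :=
    ((Fintype.equivFin (CellIdx S)).arrowCongr (Equiv.refl (Cell S))).symm.bijective
  rw [← uniform_tapeRsp, ← uniform_map_of_bijective _ hb, PMF.map_comp, PMF.map_comp, PMF.map_comp]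
  rfl

/-- The honest transcript arises from its response by the same postprocessing that the simulator
applies, so the comparison reduces to the responses for fixed challenges. -/
theorem realDist_eq (h : IsSolution M x) : realDist P M x =
    (PMF.uniformOfFintype (Ch1 S)).bind fun ch => (PMF.uniformOfFintype (Leaf S)).bind fun i =>
      ((PMF.uniformOfFintype (Seed lam)).map fun root => honestRsp P M x root ch i).map
        (recompute P M ch i) := by
  unfold realDist
  rw [PMF.bind_comm]
  congr 1
  funext ch
  simp_rw [← PMF.bind_pure_comp]
  rw [PMF.bind_comm]
  congr 1
  funext i
  rw [PMF.bind_bind]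
  congr 1
  funext root
  rw [Function.comp_apply, honestTranscript_eq P h, Function.comp_apply, PMF.pure_bind]
  rfl

theorem indist_real_sim {c : ℕ} {δ : ℝ} (h : IsSolution M x)
    (hB : Bounds P (c + 2 * S.size ^ 400) δ) :
    Indist S P c ((S.D + 3) * δ) (realDist P M x) ((simulator S).dist P M) := by
  have hδ := hB.nonneg
  have hδ' : 0 ≤ ((S.D : ℝ) + 3) * δ := by positivity
  rw [realDist_eq P M x h, simulator_dist]
  refine Indist.bind hδ' _ fun ch => Indist.bind hδ' _ fun i => ?_
  have hg : PC S 400 (fun P (rsp : Rsp S) => recompute P M ch i rsp) :=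
    (PC.recompute (e := 0) (PC.const M) (PC.const ch) (PC.const i) PC.var).mono (by omega)
  have hB' : Bounds P (c + S.size ^ 400 + S.size ^ 400) δ := by
    rwa [add_assoc, ← two_mul]
  have h := Indist.map (c := c) hg (indist_rsp P M x hB' ch i)
  exact h

end HVZK

end MinRankPoK

end

open scoped ENNReal

noncomputable section

namespace MinRankPoK

/-! ### Asymptotics -/

section Asymptotics

theorem PolyBounded.mono {f g : ℕ → ℕ} (hg : PolyBounded g) (h : ∀ l, f l ≤ g l) :
    PolyBounded f :=
  let ⟨p, hp⟩ := hg
  ⟨p, fun l => (h l).trans (hp l)⟩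

theorem PolyBounded.const (c : ℕ) : PolyBounded fun _ => c :=
  ⟨Polynomial.C c, fun l => by simp⟩

theorem PolyBounded.add {f g : ℕ → ℕ} (hf : PolyBounded f) (hg : PolyBounded g) :
    PolyBounded fun l => f l + g l :=
  let ⟨p, hp⟩ := hf
  let ⟨p', hp'⟩ := hg
  ⟨p + p', fun l => by rw [Polynomial.eval_add]; exact Nat.add_le_add (hp l) (hp' l)⟩

theorem PolyBounded.mul {f g : ℕ → ℕ} (hf : PolyBounded f) (hg : PolyBounded g) :
    PolyBounded fun l => f l * g l :=
  let ⟨p, hp⟩ := hf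
  let ⟨p', hp'⟩ := hg
  ⟨p * p', fun l => by rw [Polynomial.eval_mul]; exact Nat.mul_le_mul (hp l) (hp' l)⟩

theorem PolyBounded.pow {f : ℕ → ℕ} (hf : PolyBounded f) (e : ℕ) :
    PolyBounded fun l => f l ^ e :=
  let ⟨p, hp⟩ := hf
  ⟨p ^ e, fun l => by rw [Polynomial.eval_pow]; exact Nat.pow_le_pow_left (hp l) e⟩

theorem Negligible.of_le_mul {f : ℕ → ℕ} {μ ν : ℕ → ℝ} (hf : PolyBounded f) (hμ : Negligible μ)
    (h0 : ∀ l, 0 ≤ μ l) (h : ∀ l, |ν l| ≤ f l * μ l) : Negligible ν := by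
  obtain ⟨p, hp⟩ := hf
  have h1 := hμ.polynomial_mul (p.map (Nat.castRingHom ℝ))
  refine h1.trans_abs_le fun l => (h l).trans ?_
  refine le_trans ?_ (le_abs_self _)
  simp only [Polynomial.eval_natCast_map, eq_natCast]
  refine mul_le_mul_of_nonneg_right ?_ (h0 l)
  exact_mod_cast hp l

theorem Negligible.add {μ ν : ℕ → ℝ} (hμ : Negligible μ) (hν : Negligible ν) :
    Negligible fun l => μ l + ν l :=
  Asymptotics.SuperpolynomialDecay.add hμ hν

/-- A family of advantages which is negligible for every choice of adversaries is uniformly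
negligible. -/
theorem exists_negligible_bound {I : ℕ → Type} [∀ l, Nonempty (I l)] (a : (l : ℕ) → I l → ℝ)
    (h0 : ∀ l i, 0 ≤ a l i) (h1 : ∀ l i, a l i ≤ 1)
    (h : ∀ i : (l : ℕ) → I l, Negligible fun l => a l (i l)) :
    ∃ δ : ℕ → ℝ, Negligible δ ∧ (∀ l, 0 ≤ δ l) ∧ ∀ l i, a l i ≤ δ l := by
  -- The supremum need not be attained, but some adversary reaches half of it. Applying the
  -- assumption to this choice of adversaries bounds all others.
  have hmax : ∀ l, ∃ i, ∀ j, a l j ≤ 2 * a l i := by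
    intro l
    have hb : BddAbove (Set.range (a l)) := ⟨1, by rintro _ ⟨i, rfl⟩; exact h1 l i⟩
    obtain ⟨i0⟩ := (inferInstance : Nonempty (I l))
    have hle : ∀ j, a l j ≤ ⨆ i, a l i := fun j => le_ciSup hb j
    rcases (h0 l i0).trans (hle i0) |>.eq_or_lt with hs | hs
    · exact ⟨i0, fun j => by linarith [hle j, h0 l i0]⟩
    · obtain ⟨i, hi⟩ := exists_lt_of_lt_ciSup (half_lt_self hs)
      exact ⟨i, fun j => by linarith [hle j]⟩
  choose i hi using hmax
  refine ⟨fun l => 2 * a l (i l), ?_, fun l => by linarith [h0 l (i l)], hi⟩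
  exact Negligible.of_le_mul (PolyBounded.const 2) (h i) (fun l => h0 l _) fun l => by
    rw [abs_of_nonneg (by linarith [h0 l (i l)])]
    norm_num

variable {S : (lam : ℕ) → Params lam} {P : (lam : ℕ) → Prims (S lam)}

theorem acceptProb_one {X : Type} (μ : PMF X) (t : X → Bool) :
    acceptProb μ 1 (fun xs => t (xs 0)) = pr μ t := by
  have h : (samples μ 1).map (fun xs => xs 0) = μ := by
    rw [samples, PMF.map_bind]
    have : ∀ x : X, ((samples μ 0).map fun xs => (Fin.cons x xs : Fin 1 → X)).map
        (fun xs => xs 0) = PMF.pure x := fun x => by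
      rw [PMF.map_comp]
      exact PMF.map_const _ x
    simp_rw [this]
    exact PMF.bind_pure μ
  conv_rhs => rw [← h, pr_map]
  rfl

/-- The assumptions speak of one family of tests and messages at a time, whereas the hybrids at a
given security parameter need one bound for all of them. Non-uniform adversaries make the passage
possible. -/
theorem exists_indist {J X : ℕ → Type} [∀ l, Nonempty (J l)] (μ : (l : ℕ) → J l → PMF (X l))
    (ν : (l : ℕ) → PMF (X l)) (h : ∀ j : (l : ℕ) → J l, CompIndist S P (fun l => μ l (j l)) ν)
    {c : ℕ → ℕ} (hc : PolyBounded c) :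
    ∃ δ : ℕ → ℝ, Negligible δ ∧ (∀ l, 0 ≤ δ l) ∧
      ∀ l j, Indist (S l) (P l) (c l) (δ l) (μ l j) (ν l) := by
  -- The additional unit of size admits the constant test, so the set of adversaries is nonempty.
  let I : ℕ → Type := fun l =>
    J l × {T : Prims (S l) → X l → Bool // CostLE (S l) T (c l + 1)}
  have hI : ∀ l, Nonempty (I l) := fun l => by
    obtain ⟨j⟩ := (inferInstance : Nonempty (J l))
    exact ⟨(j, ⟨fun _ _ => true, (CostLE.of_computes (Computes.const true)).mono (by omega)⟩)⟩
  obtain ⟨δ, hδ, hδ0, hle⟩ := exists_negligible_bound (I := I)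
    (fun l i => |pr (μ l i.1) (i.2.1 (P l)) - pr (ν l) (i.2.1 (P l))|)
    (fun l i => abs_nonneg _)
    (fun l i => by
      have h1 := pr_mem (μ l i.1) (i.2.1 (P l))
      have h2 := pr_mem (ν l) (i.2.1 (P l))
      rw [abs_le]
      constructor <;> linarith)
    (fun i => by
      choose s hs hT using fun l => (i l).2.2
      have := h (fun l => (i l).1) (fun _ => 1) (fun l => 1 + s l)
        (fun l P xs => (i l).2.1 P (xs 0)) (fun l => (Computes.proj 0).comp (hT l))
        ((hc.add (PolyBounded.const 3)).mono fun l => by have := hs l; omega)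
      simp only [acceptProb_one] at this
      exact this)
  exact ⟨δ, hδ, hδ0, fun l j T hT => hle l (j, ⟨T, hT.mono (Nat.le_succ _)⟩)⟩

theorem Indist.mono_right {lam : ℕ} {S : Params lam} {P : Prims S} {X : Type} {c : ℕ} {δ δ' : ℝ}
    {μ ν : PMF X} (h : Indist S P c δ μ ν) (hδ : δ ≤ δ') : Indist S P c δ' μ ν :=
  fun T hT => (h T hT).trans hδ

theorem exists_bounds (hP : PRGSecure S P) (hC : ComUniform S P) {c : ℕ → ℕ} (hc : PolyBounded c) :
    ∃ δ : ℕ → ℝ, Negligible δ ∧ ∀ l, Bounds (P l) (c l) (δ l) := by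
  obtain ⟨h1, h2, h3, h4⟩ := hP
  obtain ⟨δ₁, n₁, p₁, b₁⟩ := exists_indist (J := fun _ => Unit) (fun l _ => _) _ (fun _ => h1) hc
  obtain ⟨δ₂, n₂, p₂, b₂⟩ := exists_indist (J := fun _ => Unit) (fun l _ => _) _ (fun _ => h2) hc
  obtain ⟨δ₃, n₃, p₃, b₃⟩ := exists_indist (J := fun _ => Unit) (fun l _ => _) _ (fun _ => h3) hc
  obtain ⟨δ₄, n₄, p₄, b₄⟩ := exists_indist (J := fun _ => Unit) (fun l _ => _) _ (fun _ => h4) hc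
  obtain ⟨δ₅, n₅, p₅, b₅⟩ := exists_indist (J := fun l => Msg (S l))
    (fun l msg => (PMF.uniformOfFintype (Rho (S l))).map fun ρ => (P l).com (msg, ρ)) _ hC hc
  refine ⟨fun l => δ₁ l + δ₂ l + δ₃ l + δ₄ l + δ₅ l, (((n₁.add n₂).add n₃).add n₄).add n₅,
    fun l => ?_⟩
  have q₁ := p₁ l
  have q₂ := p₂ l
  have q₃ := p₃ l
  have q₄ := p₄ l
  have q₅ := p₅ l
  exact ⟨by positivity, (b₁ l ()).mono_right (by linarith), (b₂ l ()).mono_right (by linarith),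
    (b₃ l ()).mono_right (by linarith), (b₄ l ()).mono_right (by linarith),
    fun msg => (b₅ l msg).mono_right (by linarith)⟩

/-- The loss is a factor Q for the samples and D + 3 for the hybrids, both polynomial. The bounds on
the primitives are taken at the distinguisher's size plus the cost of these reductions. -/
theorem compIndist_real_sim (hS : PolyBounded fun lam => (S lam).size) (hP : PRGSecure S P)
    (hC : ComUniform S P) (M : (lam : ℕ) → Inst (S lam))
    (x : (lam : ℕ) → Fin (S lam).k → (S lam).Fq) (hx : ∀ lam, IsSolution (M lam) (x lam)) :
    CompIndist S P (fun lam => realDist (P lam) (M lam) (x lam))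
      (fun lam => (simulator (S lam)).dist (P lam) (M lam)) := by
  intro Q s A hA hQs
  have hQ : PolyBounded Q := hQs.mono fun l => Nat.le_add_right _ _
  have hs : PolyBounded s := hQs.mono fun l => Nat.le_add_left _ _
  obtain ⟨δ, hδ, hB⟩ := exists_bounds hP hC
    ((hs.add (hQ.mul (hQ.add (PolyBounded.const 1)))).add
      ((PolyBounded.const 2).mul (hS.pow 400)))
  refine Negligible.of_le_mul (hQ.mul (hS.add (PolyBounded.const 3))) hδ (fun l => (hB l).nonneg)
    fun l => ?_
  have hδ0 := (hB l).nonneg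
  have h := indist_samples (W := Q l + 1) (by positivity) (Q l) (s l) le_rfl
    (indist_real_sim (P l) (M l) (x l) (hx l) (hB l)) (A l) (CostLE.of_computes (hA l))
  rw [abs_abs]
  refine h.trans ?_
  rw [← mul_assoc]
  refine mul_le_mul_of_nonneg_right ?_ hδ0
  push_cast
  have : ((S l).D : ℝ) ≤ (S l).size := by exact_mod_cast (S l).D_le_size
  gcongr

end Asymptotics

end MinRankPoK

end

/-! ### Assembly of the theorem -/

open MinRankPoK in
theorem mainTheorem1 :
    -- perfect completeness
    (∀ (lam : ℕ) (S : Params lam) (P : Prims S) (M : Inst S) (x : Fin S.k → S.Fq),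
      IsSolution M x → (realDist P M x).toOuterMeasure {T | Accepts P M T} = 1) ∧
    -- knowledge soundness: the extractor has polynomial time per step and depends on the parameters
    -- and on the success probability `et` only
    (∃ C : ℕ, ∀ (lam : ℕ) (S : Params lam) (et : ℝ), soundnessError S < et →
      ∃ E : Extractor S, E.StepTime (C * S.size ^ C) ∧
        ∀ (P : Prims S) (M : Inst S) (Pt : CheatingProver S), Pt.success P M = et →
          (∀ (t : ℕ) (o : Output S), Sum.inr o ∈ (E.run P M Pt t).support → ValidOutput P M o) ∧
          E.expectedCalls P M Pt ≤ ENNReal.ofReal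
            (4 / (et - soundnessError S) *
              (1 + et * (2 * Real.log 2 / (et - soundnessError S))))) ∧
    -- honest-verifier zero-knowledge
    (∃ sim : (lam : ℕ) → (S : Params lam) → Simulator S,
      (∃ C : ℕ, ∀ (lam : ℕ) (S : Params lam), (sim lam S).Time (C * S.size ^ C)) ∧
      ∀ (S : (lam : ℕ) → Params lam) (P : (lam : ℕ) → Prims (S lam)),
        PolyBounded (fun lam => (S lam).size) → PRGSecure S P → ComUniform S P →
        ∀ (M : (lam : ℕ) → Inst (S lam)) (x : (lam : ℕ) → Fin (S lam).k → (S lam).Fq),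
          (∀ lam, IsSolution (M lam) (x lam)) →
          CompIndist S P (fun lam => realDist (P lam) (M lam) (x lam))
            (fun lam => (sim lam (S lam)).dist (P lam) (M lam))) := by
  refine ⟨fun lam S P M x h => completeness P h, ?_, fun lam S => simulator S, simulator_time,
    fun S P hS hP hC M x hx => compIndist_real_sim hS hP hC M x hx⟩
  obtain ⟨C, hC⟩ := rewinder_stepTime
  -- The success probability enters the extractor only through the number of trials, which keeps R ·
  -- et between 1/2 and 1. The cost of the trials after an acceptance then balances that of waiting
  -- for one.
  exact ⟨C, fun lam S et het => ⟨rewinder S ⌊1 / et⌋₊, hC lam S _, fun P M Pt hs =>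
    ⟨fun t o => (rewinder S _).run_valid P M Pt (rewinder_update_valid _ P) t o,
      rewinder_expectedCalls P M Pt het hs⟩⟩⟩
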